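/- An instance $I$ of the bin packing problem with $d$ scenarios (normalized to bin capacity $1$) consists of a finite set $\mathcal I=[n]$ of items, where each item $i$ has a rational size $s_i\ge 0$ and a set $\mathcal K_i\subseteq[d]$ of scenarios; let $S_k=\{i\in\mathcal I: k\in\mathcal K_i\}$. A packing is a partition $\mathcal P$ of $\mathcal I$ into nonempty bins such that $\sum_{i\in B\cap S_k}s_i\le 1$ for every bin $B\in\mathcal P$ and every scenario $k\in[d]$. Its value is $$\mathrm{val}_{\mathrm{BPPS}}(\mathcal P)=\max_{k\in[d]}\bigl|\{B\in\mathcal P: B\cap S_k\ne\emptyset\}\bigr|$$ (equal to $0$ if $d=0$), and $\mathrm{opt}(I)$ is the minimum value of a packing of $I$. **Theorem.** For every number $d$ of scenarios and every real $\varepsilon'>0$ (both constant, i.e. not part of the input) there is a polynomial-time algorithm that, given an instance $I$ with $d$ scenarios that admits a packing, finds a packing $\mathcal P$ of $I$ with $$\mathrm{val}_{\mathrm{BPPS}}(\mathcal P)\le(1+\varepsilon')\,\mathrm{opt}(I)+2+2^d.$$ Here the input is given by $n$, the numerators and denominators of the sizes, and the scenario sets; the output is a list of bin labels, one for each item; and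 the running time, on a random access machine whose unit-cost arithmetic consists of addition, truncated subtraction and halving, is at most a polynomial, depending only on $d$ and $\varepsilon'$, in the number of bits of the input. -/

import Mathlib

/-! ### Random access machines

Programs with structured control flow over finitely many registers and finitely many unbounded
arrays of natural numbers. Elementary operations (constants, reading a register or an array cell,
addition, truncated subtraction, halving, writing a register or an array cell, testing for zero)
have unit cost. There is no multiplication, so that a run of `t` steps only creates numbers of at
most `O(t)` more bits than the program and its input hold, and running times agree, up to a
polynomial, with those of Turing machines. -/

namespace RAM

/-- Expressions. Registers and arrays are named by natural numbers that are fixed in the program;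
`cell a e` reads array `a` at the computed index `e`. -/
inductive Expr : Type
  | const (c : ℕ)
  | reg (x : ℕ)
  | cell (a : ℕ) (e : Expr)
  | add (e₁ e₂ : Expr)
  | sub (e₁ e₂ : Expr)
  | half (e : Expr)

/-- Contents of the registers and of the arrays. -/
structure State : Type where
  reg : ℕ → ℕ
  arr : ℕ → ℕ → ℕ

/-- The value of an expression. Subtraction is truncated at zero, `half` rounds down. -/
def Expr.eval (s : State) : Expr → ℕ
  | .const c => c
  | .reg x => s.reg x
  | .cell a e => s.arr a (e.eval s)
  | .add e₁ e₂ => e₁.eval s + e₂.eval s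
  | .sub e₁ e₂ => e₁.eval s - e₂.eval s
  | .half e => e.eval s / 2

/-- The cost of evaluating an expression: the number of its nodes. -/
def Expr.cost : Expr → ℕ
  | .const _ => 1
  | .reg _ => 1
  | .cell _ e => e.cost + 1
  | .add e₁ e₂ => e₁.cost + e₂.cost + 1
  | .sub e₁ e₂ => e₁.cost + e₂.cost + 1
  | .half e => e.cost + 1

/-- Programs. -/
inductive Prog : Type
  | skip
  /-- write the value of `e` into register `x` -/
  | assign (x : ℕ) (e : Expr)
  /-- write the value of `e` into array `a` at index `i` -/
  | store (a : ℕ) (i e : Expr)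
  | seq (p q : Prog)
  /-- run `p` if `e` is nonzero and `q` otherwise -/
  | branch (e : Expr) (p q : Prog)
  /-- run `p` as long as `e` is nonzero -/
  | loop (e : Expr) (p : Prog)

/-- The state after writing `v` into register `x`. -/
def State.setReg (s : State) (x v : ℕ) : State :=
  { s with reg := Function.update s.reg x v }

/-- The state after writing `v` into array `a` at index `i`. -/
def State.setArr (s : State) (a i v : ℕ) : State :=
  { s with arr := Function.update s.arr a (Function.update (s.arr a) i v) }

/-- `Exec p s t s'`: the program `p`, started in the state `s`, halts after exactly `t` steps in
the state `s'`. -/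
inductive Exec : Prog → State → ℕ → State → Prop
  | skip (s : State) : Exec .skip s 1 s
  | assign (s : State) (x : ℕ) (e : Expr) :
      Exec (.assign x e) s (e.cost + 1) (s.setReg x (e.eval s))
  | store (s : State) (a : ℕ) (i e : Expr) :
      Exec (.store a i e) s (i.cost + e.cost + 1) (s.setArr a (i.eval s) (e.eval s))
  | seq {p q : Prog} {s s₁ s₂ : State} {t₁ t₂ : ℕ} :
      Exec p s t₁ s₁ → Exec q s₁ t₂ s₂ → Exec (.seq p q) s (t₁ + t₂) s₂
  | branch_true {e : Expr} {p q : Prog} {s s₁ : State} {t : ℕ} :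
      e.eval s ≠ 0 → Exec p s t s₁ → Exec (.branch e p q) s (e.cost + 1 + t) s₁
  | branch_false {e : Expr} {p q : Prog} {s s₁ : State} {t : ℕ} :
      e.eval s = 0 → Exec q s t s₁ → Exec (.branch e p q) s (e.cost + 1 + t) s₁
  | loop_true {e : Expr} {p : Prog} {s s₁ s₂ : State} {t₁ t₂ : ℕ} :
      e.eval s ≠ 0 → Exec p s t₁ s₁ → Exec (.loop e p) s₁ t₂ s₂ →
      Exec (.loop e p) s (e.cost + 1 + t₁ + t₂) s₂
  | loop_false {e : Expr} {p : Prog} {s : State} :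
      e.eval s = 0 → Exec (.loop e p) s (e.cost + 1) s

/-- The initial state on the input word `w`: array `0` holds `w`, everything else is zero. -/
def init (w : List ℕ) : State where
  reg := fun _ => 0
  arr := fun a i => if a = 0 then w.getD i 0 else 0

/-- The number of binary digits of the input word `w`, plus one separator for each entry. -/
def bitLength (w : List ℕ) : ℕ := (w.map fun m => Nat.size m + 1).sum

end RAM

/-! ### The bin packing problem with scenarios -/

/-- An instance with `d` scenarios, normalized to bin capacity `1`: there are `n` items, item `i`
has size `size i` and occurs in the scenarios in `scen i`. -/
structure BPPS (d : ℕ) : Type where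
  n : ℕ
  size : Fin n → ℚ≥0
  scen : Fin n → Finset (Fin d)

namespace BPPS

variable {d : ℕ}

/-- The items of scenario `k`. -/
def items (I : BPPS d) (k : Fin d) : Finset (Fin I.n) :=
  Finset.univ.filter fun i => k ∈ I.scen i

/-- A packing is a partition of the set of items (into nonempty bins). -/
abbrev Packing (I : BPPS d) : Type := Finpartition (Finset.univ : Finset (Fin I.n))

/-- A packing is feasible if no bin exceeds its capacity in any scenario. -/
def IsFeasible (I : BPPS d) (P : I.Packing) : Prop :=
  ∀ B ∈ P.parts, ∀ k : Fin d, ∑ i ∈ B ∩ I.items k, I.size i ≤ 1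

/-- The value of a packing: the number of bins used in the worst scenario. -/
def val (I : BPPS d) (P : I.Packing) : ℕ :=
  Finset.univ.sup fun k : Fin d => (P.parts.filter fun B => (B ∩ I.items k).Nonempty).card

/-- The optimal value (meaningful if the instance has a feasible packing). -/
noncomputable def opt (I : BPPS d) : ℕ :=
  sInf {v | ∃ P : I.Packing, I.IsFeasible P ∧ I.val P = v}

/-- An instance as a word: the number of items, followed for each item by the numerator and the
denominator of its size and by `d` entries telling in which scenarios the item occurs. -/
def encode (I : BPPS d) : List ℕ :=
  I.n :: (List.finRange I.n).flatMap fun i =>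
    (I.size i).num :: (I.size i).den ::
      (List.finRange d).map fun k => if k ∈ I.scen i then 1 else 0

/-- Array `1` of the state `s` represents the packing `P`: its entry at `i` is a label of the bin
of item `i`, that is, two items are in the same bin if and only if they have the same label. -/
def Represents (I : BPPS d) (s : RAM.State) (P : I.Packing) : Prop :=
  ∀ i j : Fin I.n, s.arr 1 i = s.arr 1 j ↔ P.part i = P.part j

end BPPS

/-! Choose natural numbers `h ≥ 2^(d+2)/ε'` and `M ≥ 8h²/ε'`, and put `η = 1/(2h)` and `δ =
1/(4h²)`. Items of size at most `δ` are small, the others large. From a packing of value `v` one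
derives a list of bins, each described only by the classes of the slots it offers
(`Blueprint.plan`), whose value is hardly larger and which can be found by exhaustive search.

Large items are grouped linearly, separately for each set of scenarios (`exists_shift_scen`).
Outside an exceptional set `G`, which contains at most a fraction `1/M` of the large items of each
scenario, every large item is shifted injectively to an item that is at least as large and has the
same scenarios, with one of at most `2^d * 2M` threshold sizes in between. The scenario set and the
position relative to the thresholds form the class of a large item. The largest item of the class of
`i` still fits where the image of `i` was, so that place becomes a slot for the class. The items of
`G` get bins of their own.

Small items with the same scenarios form one class. In each bin they are replaced by as many slots
of capacity `η + δ` as their volume allows. If `n` bins contain small items of the class, the loss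
due to rounding and to the slack `δ` is less than `2n + 1` slots, and `⌊2n/h⌋ + 1` additional bins
with `h` slots each make up for it (`Blueprint.small_suffices`). A scenario has at most `4h²v` large
items, so the value of the plan is at most `v + 2^d(2v/h + 1) + 4h²v/M` (`Blueprint.value_le`),
which is at most `(1 + ε')v + 2^d` (`valueBound_le`).

A plan can be carried out greedily without knowing the packing it came from. A slot takes free items
of its class until their weight exceeds `η`, where a large item has weight `1`. Thus it holds one
large item, or small items of total size at most `η + δ`, and it stays underfilled only if its class
is exhausted. Enough slots therefore label every item that occurs in a scenario (`Fills.sound`,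
`Blueprint.suffices_plan`).

A plan matters only up to order, that is, through the multiplicities of its configurations. Classes
are bounded in number and configurations in length by constants (`classOf_lt`,
`Blueprint.mem_plan`), so constantly many numbers describe thresholds and plan. The program
enumerates all their values below `N`, a constant multiple of the input length, fills greedily,
checks the labeling and keeps the best one. Since everything is checked, one good guess suffices
(`improve_spec`, `forAll_goal`, `search_spec`). Apart from the computation of `N`, every loop has
exactly `N` rounds, so the running time is polynomial (`LoopProg.exists_exec`). Indices from the
number of items up to `N` act as dummy items that occur in no scenario. -/

namespace RAM

/-! ### Programs with counted loops: semantics and running time -/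

@[simp] theorem State.setReg_reg (s : State) (x v y : ℕ) :
    (s.setReg x v).reg y = if y = x then v else s.reg y := by
  simp [State.setReg, Function.update_apply]

@[simp] theorem State.setReg_arr (s : State) (x v : ℕ) : (s.setReg x v).arr = s.arr := rfl

@[simp] theorem State.setArr_reg (s : State) (a i v : ℕ) : (s.setArr a i v).reg = s.reg := rfl

@[simp] theorem State.setArr_arr (s : State) (a i v b j : ℕ) :
    (s.setArr a i v).arr b j = if b = a ∧ j = i then v else s.arr b j := by
  by_cases hb : b = a
  · subst hb
    simp [State.setArr, Function.update_apply]
  · simp [State.setArr, hb]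

theorem State.setArr_arr_of_ne (s : State) (a i v b : ℕ) (h : b ≠ a) :
    (s.setArr a i v).arr b = s.arr b := by
  simp [State.setArr, h]

attribute [simp] Expr.eval

/-- Programs whose only loops are counted loops. The number of rounds is always the content of
register `0`. -/
inductive LoopProg : Type
  | skip
  | assign (x : ℕ) (e : Expr)
  | store (a : ℕ) (i e : Expr)
  | seq (p q : LoopProg)
  | branch (e : Expr) (p q : LoopProg)
  /-- run `p` with register `x` counting from `0` up to the content of register `0` -/
  | iter (x : ℕ) (p : LoopProg)

namespace LoopProg

/-- The program of the random access machine that implements a loop program. -/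
def prog : LoopProg → Prog
  | skip => .skip
  | assign x e => .assign x e
  | store a i e => .store a i e
  | seq p q => .seq p.prog q.prog
  | branch e p q => .branch e p.prog q.prog
  | iter x p => .seq (.assign x (.const 0)) (.loop (.sub (.reg 0) (.reg x))
      (.seq p.prog (.assign x (.add (.reg x) (.const 1)))))

/-- The state after `i` rounds of a loop with counter `x` and with body `f`. -/
def rounds (f : State → State) (x : ℕ) (s : State) : ℕ → State
  | 0 => s.setReg x 0
  | i + 1 => (f (rounds f x s i)).setReg x (i + 1)

/-- The final state of a loop program. -/
def run : LoopProg → State → State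
  | skip, s => s
  | assign x e, s => s.setReg x (e.eval s)
  | store a i e, s => s.setArr a (i.eval s) (e.eval s)
  | seq p q, s => q.run (p.run s)
  | branch e p q, s => if e.eval s ≠ 0 then p.run s else q.run s
  | iter x p, s => rounds p.run x s (s.reg 0)

/-- The program does not write into register `y`. -/
def Keeps (y : ℕ) : LoopProg → Prop
  | skip => True
  | assign x _ => y ≠ x
  | store _ _ _ => True
  | seq p q => p.Keeps y ∧ q.Keeps y
  | branch _ p q => p.Keeps y ∧ q.Keeps y
  | iter x p => y ≠ x ∧ p.Keeps y

/-- The program does not write into array `b`. -/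
def KeepsArr (b : ℕ) : LoopProg → Prop
  | skip => True
  | assign _ _ => True
  | store a _ _ => b ≠ a
  | seq p q => p.KeepsArr b ∧ q.KeepsArr b
  | branch _ p q => p.KeepsArr b ∧ q.KeepsArr b
  | iter _ p => p.KeepsArr b

/-- No loop writes into its counter. -/
def WF : LoopProg → Prop
  | skip => True
  | assign _ _ => True
  | store _ _ _ => True
  | seq p q => p.WF ∧ q.WF
  | branch _ p q => p.WF ∧ q.WF
  | iter x p => p.Keeps x ∧ p.WF

theorem run_reg {p : LoopProg} {y : ℕ} (h : p.Keeps y) (s : State) :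
    (p.run s).reg y = s.reg y := by
  induction p generalizing s with
  | skip => rfl
  | assign x e => simp only [Keeps] at h; simp [run, h]
  | store a i e => rfl
  | seq p q ihp ihq => rw [run, ihq h.2, ihp h.1]
  | branch e p q ihp ihq =>
    rw [run]; split_ifs
    · exact ihp h.1 s
    · exact ihq h.2 s
  | iter x p ih =>
    have key : ∀ i, (rounds p.run x s i).reg y = s.reg y := by
      intro i
      induction i with
      | zero => simp [rounds, h.1]
      | succ i hi => simp [rounds, h.1, ih h.2, hi]
    exact key _

theorem run_arr {p : LoopProg} {b : ℕ} (h : p.KeepsArr b) (s : State) :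
    (p.run s).arr b = s.arr b := by
  induction p generalizing s with
  | skip => rfl
  | assign x e => rfl
  | store a i e => exact State.setArr_arr_of_ne _ _ _ _ _ h
  | seq p q ihp ihq => rw [run, ihq h.2, ihp h.1]
  | branch e p q ihp ihq =>
    rw [run]; split_ifs
    · exact ihp h.1 s
    · exact ihq h.2 s
  | iter x p ih =>
    have key : ∀ i, (rounds p.run x s i).arr b = s.arr b := by
      intro i
      induction i with
      | zero => simp [rounds]
      | succ i hi => simp only [rounds, State.setReg_arr]; rw [ih h, hi]
    exact key _

/-- The invariant rule for counted loops. -/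
theorem run_iter_induction {x : ℕ} {p : LoopProg} {s : State}
    (Inv : ℕ → State → Prop) (init : Inv 0 (s.setReg x 0))
    (step : ∀ i < s.reg 0, ∀ s' : State, s'.reg x = i →
      (∀ y, (iter x p).Keeps y → s'.reg y = s.reg y) → (∀ b, p.KeepsArr b → s'.arr b = s.arr b) →
      Inv i s' → Inv (i + 1) ((p.run s').setReg x (i + 1))) :
    Inv (s.reg 0) ((iter x p).run s) := by
  have key : ∀ i ≤ s.reg 0, Inv i (rounds p.run x s i) ∧ (rounds p.run x s i).reg x = i ∧
      (∀ y, (iter x p).Keeps y → (rounds p.run x s i).reg y = s.reg y) ∧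
      (∀ b, p.KeepsArr b → (rounds p.run x s i).arr b = s.arr b) := by
    intro i
    induction i with
    | zero => exact fun _ => ⟨init, by simp [rounds], fun y hy => by simp [rounds, hy.1],
        fun b hb => rfl⟩
    | succ i ih =>
      intro hi
      obtain ⟨h1, h2, h3, h4⟩ := ih (by omega)
      refine ⟨step i hi _ h2 h3 h4 h1, by simp [rounds], fun y hy => ?_, fun b hb => ?_⟩
      · simp [rounds, hy.1, run_reg hy.2, h3 y hy]
      · simp only [rounds, State.setReg_arr]
        rw [run_arr hb, h4 b hb]
  exact (key _ le_rfl).1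

/-- Induction on the number `m` of rounds that are left. Besides the body, a round costs four steps
for the test and four for the increment; the last, failing test costs another four. -/
theorem exec_loop {x : ℕ} {p : LoopProg} {T : ℕ} (hx : 0 ≠ x) (h0 : p.Keeps 0) (hp : p.Keeps x)
    (s : State)
    (ih : ∀ s', s'.reg 0 = s.reg 0 → ∃ t, Exec p.prog s' t (p.run s') ∧ t ≤ T) (m : ℕ) :
    ∀ i, i + m = s.reg 0 → ∃ t, Exec (.loop (.sub (.reg 0) (.reg x))
      (.seq p.prog (.assign x (.add (.reg x) (.const 1))))) (rounds p.run x s i) t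
        (rounds p.run x s (s.reg 0)) ∧ t ≤ m * (T + 8) + 4 := by
  have hreg : ∀ i, (rounds p.run x s i).reg x = i ∧ (rounds p.run x s i).reg 0 = s.reg 0 := by
    intro i
    induction i with
    | zero => simp [rounds, hx]
    | succ i ih => simp [rounds, hx, run_reg h0, ih.2]
  induction m with
  | zero =>
    intro i hi
    have hi' : i = s.reg 0 := by simpa using hi
    subst hi'
    exact ⟨_, Exec.loop_false (by simp [hreg]), by simp [Expr.cost]⟩
  | succ m ihm =>
    intro i hi
    obtain ⟨t, ht, hT⟩ := ih _ (hreg i).2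
    obtain ⟨t', ht', hT'⟩ := ihm (i + 1) (by omega)
    have hb : Exec (.seq p.prog (.assign x (.add (.reg x) (.const 1)))) (rounds p.run x s i)
        (t + 4) (rounds p.run x s (i + 1)) := by
      have := Exec.seq ht (Exec.assign (p.run (rounds p.run x s i)) x (.add (.reg x) (.const 1)))
      simpa [Expr.cost, rounds, run_reg hp, hreg] using this
    refine ⟨_, Exec.loop_true ?_ hb ht', ?_⟩
    · simp [hreg]; omega
    · simp only [Expr.cost]
      nlinarith

/-- Loop programs run in polynomial time. -/
theorem exists_exec {p : LoopProg} (hp : p.WF) (h0 : p.Keeps 0) :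
    ∃ c : Polynomial ℕ, ∀ s, ∃ t, Exec p.prog s t (p.run s) ∧ t ≤ c.eval (s.reg 0) := by
  induction p with
  | skip => exact ⟨1, fun s => ⟨1, Exec.skip s, by simp⟩⟩
  | assign x e =>
    exact ⟨Polynomial.C (e.cost + 1), fun s => ⟨_, Exec.assign s x e, by simp⟩⟩
  | store a i e =>
    exact ⟨Polynomial.C (i.cost + e.cost + 1), fun s => ⟨_, Exec.store s a i e, by simp⟩⟩
  | seq p q ihp ihq =>
    obtain ⟨c, hc⟩ := ihp hp.1 h0.1
    obtain ⟨c', hc'⟩ := ihq hp.2 h0.2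
    refine ⟨c + c', fun s => ?_⟩
    obtain ⟨t, ht, hT⟩ := hc s
    obtain ⟨t', ht', hT'⟩ := hc' (p.run s)
    rw [run_reg h0.1] at hT'
    exact ⟨_, Exec.seq ht ht', by simpa using add_le_add hT hT'⟩
  | branch e p q ihp ihq =>
    obtain ⟨c, hc⟩ := ihp hp.1 h0.1
    obtain ⟨c', hc'⟩ := ihq hp.2 h0.2
    refine ⟨Polynomial.C (e.cost + 1) + c + c', fun s => ?_⟩
    by_cases he : e.eval s = 0
    · obtain ⟨t, ht, hT⟩ := hc' s
      refine ⟨_, by simpa [run, prog, he] using Exec.branch_false he ht, ?_⟩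
      simp only [Polynomial.eval_add, Polynomial.eval_C]; omega
    · obtain ⟨t, ht, hT⟩ := hc s
      refine ⟨_, by simpa [run, prog, he] using Exec.branch_true he ht, ?_⟩
      simp only [Polynomial.eval_add, Polynomial.eval_C]; omega
  | iter x p ih =>
    obtain ⟨c, hc⟩ := ih hp.2 h0.2
    -- The constant is four for the final test plus two for resetting the counter.
    refine ⟨Polynomial.X * (c + 8) + 6, fun s => ?_⟩
    obtain ⟨t, ht, hT⟩ := exec_loop (T := c.eval (s.reg 0)) h0.1 h0.2 hp.1 s
      (fun s' hs' => by rw [← hs']; exact hc s') (s.reg 0) 0 (by simp)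
    refine ⟨_, Exec.seq (Exec.assign s x (.const 0)) ht, ?_⟩
    simp only [Expr.cost, Polynomial.eval_add, Polynomial.eval_mul, Polynomial.eval_X,
      Polynomial.eval_ofNat]
    omega

end LoopProg
end RAM

namespace BPPS

/-! ### Labelings -/

/-- The total size of the items of `U` in scenario `k` with label `b`. -/
def load {d : ℕ} (U : Finset ℕ) (size : ℕ → ℚ) (scen : ℕ → Finset (Fin d)) (L : ℕ → ℕ) (b : ℕ)
    (k : Fin d) : ℚ :=
  ∑ i ∈ U with L i = b ∧ k ∈ scen i, size i

/-- The labels of the items of `U` in scenario `k`. -/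
def used {d : ℕ} (U : Finset ℕ) (scen : ℕ → Finset (Fin d)) (L : ℕ → ℕ) (k : Fin d) : Finset ℕ :=
  {i ∈ U | k ∈ scen i}.image L

/-- Items that are divided into classes. All items of a class occur in the same scenarios, and they
are either all small or all large; `cap` bounds the size that a slot of a class takes. -/
structure Classified (d : ℕ) where
  U : Finset ℕ
  size : ℕ → ℚ
  scen : ℕ → Finset (Fin d)
  cls : ℕ → ℕ
  weight : ℕ → ℚ
  classScen : ℕ → Finset (Fin d)
  small : ℕ → Prop
  cap : ℕ → ℚ
  η : ℚ
  δ : ℚ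
  size_nonneg : ∀ i, 0 ≤ size i
  η_pos : 0 < η
  δ_pos : 0 < δ
  η_lt_one : η < 1
  classScen_cls : ∀ i ∈ U, classScen (cls i) = scen i
  weight_small : ∀ i ∈ U, small (cls i) → weight i = size i
  size_small : ∀ i ∈ U, small (cls i) → size i ≤ δ
  weight_large : ∀ i ∈ U, ¬ small (cls i) → 1 ≤ weight i
  cap_small : ∀ κ, small κ → cap κ = η + δ
  cap_nonneg : ∀ κ, 0 ≤ cap κ
  size_le_cap : ∀ i ∈ U, ¬ small (cls i) → size i ≤ cap (cls i)

/-! ### Greedy filling of slots -/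

namespace Classified

variable {d : ℕ} (S : Classified d)

/-- The unlabelled items of class `κ`. -/
def free (κ : ℕ) (L : ℕ → ℕ) : Finset ℕ := {i ∈ S.U | S.cls i = κ ∧ L i = 0}

/-- The labeling `L'` results from `L` by giving the label `b` to free items of class `κ`, one after
the other, until their weight exceeds `η` or no more items are left. -/
def Fill (κ b : ℕ) (L L' : ℕ → ℕ) : Prop :=
  ∃ F ⊆ S.free κ L, (∀ i, L' i = if i ∈ F then b else L i) ∧
    (F = S.free κ L ∨ S.η < ∑ i ∈ F, S.weight i) ∧
    (F = ∅ ∨ ∃ i₀ ∈ F, ∑ i ∈ F.erase i₀, S.weight i ≤ S.η)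

/-- A sequence of filling operations, each given by a class and a label. -/
inductive Fills : List (ℕ × ℕ) → (ℕ → ℕ) → (ℕ → ℕ) → Prop
  | nil (L : ℕ → ℕ) : Fills [] L L
  | cons {κ b : ℕ} {ops : List (ℕ × ℕ)} {L L₁ L₂ : ℕ → ℕ} :
      S.Fill κ b L L₁ → Fills ops L₁ L₂ → Fills ((κ, b) :: ops) L L₂

variable {S}

theorem Fills.append {ops ops' : List (ℕ × ℕ)} {L L₁ L₂ : ℕ → ℕ} (h : S.Fills ops L L₁)
    (h' : S.Fills ops' L₁ L₂) : S.Fills (ops ++ ops') L L₂ := by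
  induction h with
  | nil => exact h'
  | cons hf _ ih => exact .cons hf (ih h')

/-- Small items other than `i₀` contribute at most `η`, and `i₀` adds at most `δ`. A second large
item is impossible, as each weighs at least `1 > η`. -/
theorem sum_size_le_cap {κ : ℕ} {L : ℕ → ℕ} {F : Finset ℕ} (hF : F ⊆ S.free κ L)
    (h : F = ∅ ∨ ∃ i₀ ∈ F, ∑ i ∈ F.erase i₀, S.weight i ≤ S.η) :
    ∑ i ∈ F, S.size i ≤ S.cap κ := by
  rcases h with rfl | ⟨i₀, hi₀, h⟩
  · simpa using S.cap_nonneg κ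
  have hm : ∀ i ∈ F, i ∈ S.U ∧ S.cls i = κ := fun i hi => by
    have := hF hi
    simp only [free, Finset.mem_filter] at this
    exact ⟨this.1, this.2.1⟩
  by_cases hs : S.small κ
  · rw [S.cap_small κ hs, ← Finset.sum_erase_add _ _ hi₀]
    refine add_le_add (le_trans (le_of_eq ?_) h) ?_
    · refine Finset.sum_congr rfl fun i hi => ?_
      obtain ⟨h1, h2⟩ := hm i (Finset.mem_of_mem_erase hi)
      rw [S.weight_small i h1 (by rwa [h2])]
    · obtain ⟨h1, h2⟩ := hm i₀ hi₀
      exact S.size_small _ h1 (by rwa [h2])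
  · have he : F.erase i₀ = ∅ := by
      by_contra hne
      obtain ⟨j, hj⟩ := Finset.nonempty_iff_ne_empty.2 hne
      have hw : ∀ i ∈ F.erase i₀, 1 ≤ S.weight i := fun i hi => by
        obtain ⟨h1, h2⟩ := hm i (Finset.mem_of_mem_erase hi)
        exact S.weight_large i h1 (by rwa [h2])
      have := Finset.single_le_sum (f := S.weight)
        (fun i hi => (zero_le_one.trans (hw i hi))) hj
      linarith [hw j hj, S.η_lt_one]
    rw [← Finset.sum_erase_add _ _ hi₀, he]
    obtain ⟨h1, h2⟩ := hm i₀ hi₀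
    simpa [h2] using S.size_le_cap _ h1 (by rwa [h2])

/-- The total capacity of the slots with label `b` that count in scenario `k`. -/
noncomputable def slotSum (S : Classified d) (k : Fin d) (b : ℕ) (ops : List (ℕ × ℕ)) : ℚ :=
  (ops.map fun o => if o.2 = b ∧ k ∈ S.classScen o.1 then S.cap o.1 else 0).sum

/-- The newly labelled items share one class and hence their scenarios: either all of them count in
scenario `k` or none does. Label `0` is excluded because it means unlabelled. -/
theorem Fill.load_le {κ b : ℕ} {L L' : ℕ → ℕ} (h : S.Fill κ b L L') (k : Fin d) {b' : ℕ}
    (hb : b' ≠ 0) :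
    load S.U S.size S.scen L' b' k ≤
      (if b = b' ∧ k ∈ S.classScen κ then S.cap κ else 0) + load S.U S.size S.scen L b' k := by
  obtain ⟨F, hF, hL, -, h2⟩ := h
  have hm : ∀ i ∈ F, i ∈ S.U ∧ S.cls i = κ ∧ L i = 0 := fun i hi => by
    simpa only [free, Finset.mem_filter] using hF hi
  have hsplit : load S.U S.size S.scen L' b' k =
      (∑ i ∈ F with b = b' ∧ k ∈ S.classScen κ, S.size i) + load S.U S.size S.scen L b' k := by
    unfold load
    rw [← Finset.sum_union]
    · congr 1
      ext i
      simp only [Finset.mem_filter, Finset.mem_union, hL]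
      by_cases hi : i ∈ F
      · obtain ⟨h1, h2, h3⟩ := hm i hi
        have := S.classScen_cls i h1
        rw [h2] at this
        simp [hi, h1, h3, this, hb.symm]
      · simp [hi]
    · rw [Finset.disjoint_left]
      intro i hi hi'
      simp only [Finset.mem_filter] at hi hi'
      exact hb (hi'.2.1.symm.trans (hm i hi.1).2.2)
  rw [hsplit]
  gcongr
  split_ifs with hc
  · simpa [hc] using sum_size_le_cap hF h2
  · simp [hc]

theorem Fills.load_le {ops : List (ℕ × ℕ)} {L L' : ℕ → ℕ} (h : S.Fills ops L L') (k : Fin d)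
    {b : ℕ} (hb : b ≠ 0) :
    load S.U S.size S.scen L' b k ≤ S.slotSum k b ops + load S.U S.size S.scen L b k := by
  induction h with
  | nil => simp [slotSum]
  | cons hf _ ih =>
    have := hf.load_le k hb
    simp only [slotSum, List.map_cons, List.sum_cons] at ih ⊢
    linarith

theorem Fills.mem_ops {ops : List (ℕ × ℕ)} {L L' : ℕ → ℕ} (h : S.Fills ops L L') {i : ℕ}
    (hi : L' i ≠ L i) : (S.cls i, L' i) ∈ ops := by
  induction h with
  | nil => exact absurd rfl hi
  | @cons κ b ops L L₁ L₂ hf hfs ih =>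
    by_cases h1 : L₂ i = L₁ i
    · obtain ⟨F, hF, hL, -⟩ := hf
      have hiF : i ∈ F := by
        by_contra hc
        exact hi (by rw [h1, hL, if_neg hc])
      have h2 : L₁ i = b := by rw [hL, if_pos hiF]
      have := hF hiF
      simp only [free, Finset.mem_filter] at this
      simp [h1, h2, this.2.1]
    · exact List.mem_cons_of_mem _ (ih h1)

open Classical in
/-- The measure of an item in which the progress of filling is counted. -/
noncomputable def measure (S : Classified d) (i : ℕ) : ℚ :=
  if S.small (S.cls i) then S.size i else 1

open Classical in
/-- The progress that filling a slot of class `κ` guarantees. -/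
noncomputable def need (S : Classified d) (κ : ℕ) : ℚ := if S.small κ then S.η else 1

theorem measure_nonneg (i : ℕ) : 0 ≤ S.measure i := by
  unfold measure
  split_ifs
  · exact S.size_nonneg i
  · exact zero_le_one

theorem free_antitone {κ : ℕ} {L L' : ℕ → ℕ} (h : ∀ i, L i ≠ 0 → L' i = L i) :
    S.free κ L' ⊆ S.free κ L := by
  intro i hi
  simp only [free, Finset.mem_filter] at hi ⊢
  refine ⟨hi.1, hi.2.1, ?_⟩
  by_contra hc
  exact hc ((h i hc).symm.trans hi.2.2)

theorem Fill.eq_of_ne_zero {κ b : ℕ} {L L' : ℕ → ℕ} (h : S.Fill κ b L L') (i : ℕ) (hi : L i ≠ 0) :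
    L' i = L i := by
  obtain ⟨F, hF, hL, -⟩ := h
  rw [hL, if_neg]
  intro hiF
  have := hF hiF
  simp only [free, Finset.mem_filter] at this
  exact hi this.2.2

/-- A slot that does not exhaust its class has received weight more than `η`. For small items weight
and measure agree; for large ones it means that at least one item, of measure `1`, was taken. -/
theorem Fill.progress {κ b : ℕ} {L L' : ℕ → ℕ} (h : S.Fill κ b L L') (hb : b ≠ 0) (κ' : ℕ) :
    S.free κ' L' = ∅ ∨ ∑ i ∈ S.free κ' L', S.measure i + (if κ = κ' then S.need κ' else 0) ≤
      ∑ i ∈ S.free κ' L, S.measure i := by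
  have hanti : S.free κ' L' ⊆ S.free κ' L := free_antitone h.eq_of_ne_zero
  split_ifs with hκ
  · subst hκ
    obtain ⟨F, hF, hL, h1, h2⟩ := h
    have hfree : S.free κ L' = S.free κ L \ F := by
      ext i
      by_cases hi : i ∈ F
      · simp [free, hL, hi, hb]
      · simp [free, hL, hi]
    rcases h1 with rfl | h1
    · left; simp [hfree]
    right
    rw [hfree, ← Finset.sum_sdiff hF]
    gcongr
    have hm : ∀ i ∈ F, i ∈ S.U ∧ S.cls i = κ := fun i hi => by
      have := hF hi
      simp only [free, Finset.mem_filter] at this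
      exact ⟨this.1, this.2.1⟩
    by_cases hs : S.small κ
    · have : ∑ i ∈ F, S.measure i = ∑ i ∈ F, S.weight i := by
        refine Finset.sum_congr rfl fun i hi => ?_
        obtain ⟨h3, h4⟩ := hm i hi
        rw [measure, h4, if_pos hs, S.weight_small i h3 (by rwa [h4])]
      rw [this, need, if_pos hs]
      exact h1.le
    · have hne : F.Nonempty := by
        rw [Finset.nonempty_iff_ne_empty]
        rintro rfl
        simp only [Finset.sum_empty] at h1
        exact absurd S.η_pos h1.not_gt
      obtain ⟨j, hj⟩ := hne
      have h3 := Finset.single_le_sum (f := S.measure) (fun i _ => measure_nonneg i) hj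
      rw [need, if_neg hs]
      refine le_trans (le_of_eq ?_) h3
      rw [measure, (hm j hj).2, if_neg hs]
  · right
    rw [add_zero]
    exact Finset.sum_le_sum_of_subset_of_nonneg hanti fun i _ _ => measure_nonneg i

/-- An exhausted class stays exhausted, since labels are never withdrawn; otherwise the guarantees
of the single slots add up. -/
theorem Fills.progress {ops : List (ℕ × ℕ)} {L L' : ℕ → ℕ} (h : S.Fills ops L L')
    (hb : ∀ o ∈ ops, o.2 ≠ 0) (κ : ℕ) :
    S.free κ L' = ∅ ∨ ∑ i ∈ S.free κ L', S.measure i + ((ops.map Prod.fst).count κ) * S.need κ ≤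
      ∑ i ∈ S.free κ L, S.measure i := by
  induction h with
  | nil => right; simp
  | @cons κ' b ops L L₁ L₂ hf hfs ih =>
    have hb' : ∀ o ∈ ops, o.2 ≠ 0 := fun o ho => hb o (List.mem_cons_of_mem _ ho)
    rcases ih hb' with h1 | h1
    · exact Or.inl h1
    rcases hf.progress (hb _ List.mem_cons_self) κ with h2 | h2
    · left
      have hanti : S.free κ L₂ ⊆ S.free κ L₁ := by
        clear h1 ih hf h2 hb
        induction hfs with
        | nil => exact subset_rfl
        | cons hf _ ih =>
          exact (ih fun o ho => hb' o (List.mem_cons_of_mem _ ho)).trans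
            (free_antitone hf.eq_of_ne_zero)
      rw [h2] at hanti
      exact Finset.subset_empty.1 hanti
    · right
      refine le_trans ?_ h2
      rw [List.map_cons, List.count_cons]
      by_cases hκ : κ' = κ
      · simp [hκ]; linarith
      · simp [hκ]; linarith

/-- The filling operations for a list of bins, each given by the list of the classes of its slots;
the bins are numbered from `b` on. -/
def numbered : ℕ → List (List ℕ) → List (ℕ × ℕ)
  | _, [] => []
  | b, c :: cs => c.map (fun κ => (κ, b)) ++ numbered (b + 1) cs

theorem numbered_append (b : ℕ) (cs cs' : List (List ℕ)) :
    numbered b (cs ++ cs') = numbered b cs ++ numbered (b + cs.length) cs' := by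
  induction cs generalizing b with
  | nil => rfl
  | cons c cs ih => simp [numbered, ih, add_assoc, add_comm 1]

theorem le_of_mem_numbered {b : ℕ} {cs : List (List ℕ)} {o : ℕ × ℕ} (h : o ∈ numbered b cs) :
    b ≤ o.2 := by
  induction cs generalizing b with
  | nil => simp [numbered] at h
  | cons c cs ih =>
    rw [numbered, List.mem_append] at h
    rcases h with h | h
    · obtain ⟨κ, -, rfl⟩ := List.mem_map.1 h
      exact le_rfl
    · exact (Nat.le_succ b).trans (ih h)

theorem lt_of_mem_numbered {b : ℕ} {cs : List (List ℕ)} {o : ℕ × ℕ} (h : o ∈ numbered b cs) :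
    o.2 < b + cs.length := by
  induction cs generalizing b with
  | nil => simp [numbered] at h
  | cons c cs ih =>
    rw [numbered, List.mem_append] at h
    rw [List.length_cons]
    rcases h with h | h
    · obtain ⟨κ, -, rfl⟩ := List.mem_map.1 h
      simp
    · have := ih h
      omega

theorem map_fst_numbered (b : ℕ) (cs : List (List ℕ)) :
    (numbered b cs).map Prod.fst = cs.flatten := by
  induction cs generalizing b with
  | nil => rfl
  | cons c cs ih => simp [numbered, ih, Function.comp_def]

/-- The total capacity in scenario `k` of the slots of a bin. -/
noncomputable def binSum (S : Classified d) (k : Fin d) (c : List ℕ) : ℚ :=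
  (c.map fun κ => if k ∈ S.classScen κ then S.cap κ else 0).sum

/-- Different bins carry different numbers, so all slots with label `b'` belong to a single bin. -/
theorem slotSum_numbered_le {k : Fin d} {cs : List (List ℕ)} {B : ℚ} (hB : 0 ≤ B)
    (h : ∀ c ∈ cs, S.binSum k c ≤ B) (b b' : ℕ) : S.slotSum k b' (numbered b cs) ≤ B := by
  induction cs generalizing b with
  | nil => simpa [numbered, slotSum] using hB
  | cons c cs ih =>
    have happ : S.slotSum k b' (numbered b (c :: cs)) =
        S.slotSum k b' (c.map fun κ => (κ, b)) + S.slotSum k b' (numbered (b + 1) cs) := by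
      simp [slotSum, numbered]
    rw [happ]
    by_cases hb : b = b'
    · subst hb
      have h0 : S.slotSum k b (numbered (b + 1) cs) = 0 := by
        refine List.sum_eq_zero fun x hx => ?_
        obtain ⟨o, ho, rfl⟩ := List.mem_map.1 hx
        have := le_of_mem_numbered ho
        rw [if_neg]
        rintro ⟨rfl, -⟩
        omega
      have h1 : S.slotSum k b (c.map fun κ => (κ, b)) = S.binSum k c := by
        simp [slotSum, binSum, Function.comp_def]
      rw [h0, h1, add_zero]
      exact h c List.mem_cons_self
    · have h0 : S.slotSum k b' (c.map fun κ => (κ, b)) = 0 := by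
        simp [slotSum, hb, Function.comp_def]
      rw [h0, zero_add]
      exact ih (fun c hc => h c (List.mem_cons_of_mem _ hc)) _

/-- The bin with the slots `c` is used in scenario `k`. -/
def touches (S : Classified d) (k : Fin d) (c : List ℕ) : Bool :=
  c.any fun κ => k ∈ S.classScen κ

theorem card_labels_numbered_le (k : Fin d) (cs : List (List ℕ)) (b : ℕ) :
    (((numbered b cs).filter fun o => k ∈ S.classScen o.1).map Prod.snd).toFinset.card ≤
      cs.countP (S.touches k) := by
  induction cs generalizing b with
  | nil => simp [numbered]
  | cons c cs ih =>
    rw [numbered, List.filter_append, List.map_append, List.toFinset_append, List.countP_cons]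
    refine (Finset.card_union_le _ _).trans ?_
    rw [add_comm]
    refine add_le_add (ih _) ?_
    split_ifs with hc
    · have hsub : (((c.map fun κ => (κ, b)).filter
          fun o => k ∈ S.classScen o.1).map Prod.snd).toFinset ⊆ {b} := by
        intro x
        simp only [List.mem_toFinset, List.mem_map, List.mem_filter, Finset.mem_singleton]
        rintro ⟨o, ⟨⟨κ, -, rfl⟩, -⟩, rfl⟩
        rfl
      exact (Finset.card_le_card hsub).trans (by simp)
    · have hc' : ∀ κ ∈ c, k ∉ S.classScen κ := by simpa [touches] using hc
      rw [List.filter_eq_nil_iff.2]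
      · simp
      · rintro o ho
        obtain ⟨κ, hκ, rfl⟩ := List.mem_map.1 ho
        simpa using hc' κ hκ

/-- Every item that occurs in some scenario gets a slot. -/
def Suffices (S : Classified d) (cs : List (List ℕ)) : Prop :=
  ∀ κ, (S.classScen κ).Nonempty → ∀ X ⊆ {i ∈ S.U | S.cls i = κ}, X.Nonempty →
    ∑ i ∈ S.U with S.cls i = κ, S.measure i <
      ∑ i ∈ X, S.measure i + cs.flatten.count κ * S.need κ

/-- If an item of some scenario were left over, the set `X` of free items of its class would be
nonempty, and `Suffices` for this `X` would contradict the guaranteed progress. Hence label `0` has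
no load, every other load is bounded by the slots of one bin, and each label used in scenario `k`
belongs to a bin with a slot that counts there. -/
theorem Fills.sound {cs : List (List ℕ)} {L : ℕ → ℕ} (h : S.Fills (numbered 1 cs) (fun _ => 0) L)
    (hcap : ∀ k, ∀ c ∈ cs, S.binSum k c ≤ 1) (hs : S.Suffices cs) (k : Fin d) :
    (∀ b, load S.U S.size S.scen L b k ≤ 1) ∧
      (used S.U S.scen L k).card ≤ cs.countP (S.touches k) := by
  have hpos : ∀ o ∈ numbered 1 cs, o.2 ≠ 0 := fun o ho => by
    have := le_of_mem_numbered ho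
    omega
  have hall : ∀ i ∈ S.U, (S.scen i).Nonempty → L i ≠ 0 := by
    intro i hi hne hL
    have hmem : i ∈ S.free (S.cls i) L := by simp [free, hi, hL]
    rcases h.progress hpos (S.cls i) with h1 | h1
    · simp [h1] at hmem
    · have h2 := hs (S.cls i) (by rwa [S.classScen_cls i hi]) (S.free (S.cls i) L) (by
        intro j hj
        simp only [free, Finset.mem_filter] at hj ⊢
        exact ⟨hj.1, hj.2.1⟩) ⟨i, hmem⟩
      rw [map_fst_numbered] at h1
      simp only [free, and_true] at h1 h2
      exact absurd h2 h1.not_gt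
  constructor
  · intro b
    by_cases hb : b = 0
    · have : load S.U S.size S.scen L b k = 0 := by
        refine Finset.sum_eq_zero fun i hi => ?_
        simp only [Finset.mem_filter] at hi
        exact absurd (hi.2.1.trans hb) (hall i hi.1 ⟨k, hi.2.2⟩)
      rw [this]; exact zero_le_one
    · have h1 := h.load_le k hb
      have h0 : load S.U S.size S.scen (fun _ => 0) b k = 0 := by
        simp [load, Ne.symm hb]
      rw [h0, add_zero] at h1
      exact h1.trans (slotSum_numbered_le zero_le_one (hcap k) _ _)
  · refine le_trans (Finset.card_le_card ?_) (card_labels_numbered_le k cs 1)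
    intro b hb
    simp only [used, Finset.mem_image, Finset.mem_filter] at hb
    obtain ⟨i, ⟨hi, hk⟩, rfl⟩ := hb
    simp only [List.mem_toFinset, List.mem_map, List.mem_filter]
    exact ⟨_, ⟨h.mem_ops (hall i hi ⟨k, hk⟩), by simpa [S.classScen_cls i hi] using hk⟩, rfl⟩

end Classified
end BPPS

namespace BPPS

/-! ### Linear grouping -/

/-- Linear grouping: apart from a few items of `G`, the items can be shifted to larger ones in such
a way that a threshold out of a small set `T` lies between each item and its image. -/
theorem exists_shift (Λ : Finset ℕ) (s : ℕ → ℚ) {M : ℕ} (hM : 0 < M) :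
    ∃ (T G : Finset ℕ) (σ : ℕ → ℕ), T ⊆ Λ ∧ G ⊆ Λ ∧ T.card ≤ 2 * M ∧ G.card * M ≤ Λ.card ∧
      (∀ i ∈ Λ \ G, σ i ∈ Λ) ∧ Set.InjOn σ (Λ \ G : Finset ℕ) ∧
      ∀ i ∈ Λ \ G, ∃ t ∈ T, s i ≤ s t ∧ s t ≤ s (σ i) := by
  rcases lt_or_ge Λ.card M with hlt | hge
  -- With fewer than `M` items every item can be its own threshold.
  · exact ⟨Λ, ∅, id, subset_rfl, by simp, by omega, by simp, by simp,
      Function.injective_id.injOn, fun i hi => ⟨i, by simpa using hi, le_rfl, le_rfl⟩⟩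
  obtain ⟨m, hm⟩ : ∃ m, Λ.card = m := ⟨_, rfl⟩
  obtain ⟨g, hg⟩ : ∃ g, g = m / M := ⟨_, rfl⟩
  have hg1 : 1 ≤ g := hg ▸ (Nat.one_le_div_iff hM).2 (hm ▸ hge)
  have hgM : g * M ≤ m := hg ▸ Nat.div_mul_le_self m M
  -- As `g ≥ 1`, `m < M(g + 1) ≤ 2Mg`; so at most `2M` multiples of `g` lie below `m`.
  have hmg : m < 2 * M * g := by
    have : m < M * (m / M + 1) := Nat.lt_mul_div_succ m hM
    rw [← hg] at this
    nlinarith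
  let e₀ : Fin m ≃ Λ := (Λ.equivFinOfCardEq hm).symm
  let e : Fin m ≃ Λ := (Tuple.sort fun j => s (e₀ j)).trans e₀
  have hmono : ∀ j j' : Fin m, j ≤ j' → s (e j) ≤ s (e j') := fun j j' hj =>
    Tuple.monotone_sort (fun j => s (e₀ j)) hj
  let f : ℕ → ℕ := fun r => if h : r < m then (e ⟨r, h⟩ : ℕ) else 0
  have hf : ∀ r (h : r < m), f r = e ⟨r, h⟩ := fun r h => dif_pos h
  have hfm : ∀ r < m, f r ∈ Λ := fun r h => by rw [hf r h]; exact (e ⟨r, h⟩).2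
  have hfmono : ∀ r r', r ≤ r' → r' < m → s (f r) ≤ s (f r') := fun r r' h h' => by
    rw [hf r (h.trans_lt h'), hf r' h']
    exact hmono _ _ h
  have hfinj : ∀ r < m, ∀ r' < m, f r = f r' → r = r' := fun r h r' h' hrr => by
    rw [hf r h, hf r' h'] at hrr
    simpa using e.injective (Subtype.ext hrr)
  let ρ : ℕ → ℕ := fun i => if h : i ∈ Λ then (e.symm ⟨i, h⟩ : ℕ) else 0
  have hρ : ∀ i ∈ Λ, ρ i < m ∧ f (ρ i) = i := fun i hi => by
    have h1 : ρ i = e.symm ⟨i, hi⟩ := dif_pos hi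
    have h2 : ρ i < m := h1 ▸ (e.symm ⟨i, hi⟩).2
    refine ⟨h2, ?_⟩
    rw [hf _ h2]
    simp [h1]
  -- The last `g` ranks have no partner `g` ranks higher.
  let G : Finset ℕ := {i ∈ Λ | m ≤ ρ i + g}
  have hG : ∀ i ∈ Λ \ G, i ∈ Λ ∧ ρ i + g < m := fun i hi => by
    simp only [G, Finset.mem_sdiff, Finset.mem_filter, not_and, not_le] at hi
    exact ⟨hi.1, hi.2 hi.1⟩
  -- The thresholds are the items whose rank is a multiple of `g`. Intersecting with `Λ` discards
  -- the default value of `f` at ranks from `m` on.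
  refine ⟨(Finset.range (2 * M)).image (fun l => f (g * l)) ∩ Λ, G, fun i => f (ρ i + g),
    Finset.inter_subset_right, Finset.filter_subset _ _, ?_, ?_, ?_, ?_, ?_⟩
  · refine (Finset.card_le_card Finset.inter_subset_left).trans ?_
    simpa using Finset.card_image_le (s := Finset.range (2 * M)) (f := fun l => f (g * l))
  · have hsub : G ⊆ (Finset.Ico (m - g) m).image f := by
      intro i hi
      simp only [G, Finset.mem_filter] at hi
      obtain ⟨h1, h2⟩ := hρ i hi.1
      exact Finset.mem_image.2 ⟨ρ i, Finset.mem_Ico.2 ⟨by omega, h1⟩, h2⟩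
    have hcard : G.card ≤ g := by
      refine (Finset.card_le_card hsub).trans (Finset.card_image_le.trans ?_)
      rw [Nat.card_Ico]; omega
    exact (Nat.mul_le_mul_right M hcard).trans (hm ▸ hgM)
  · exact fun i hi => hfm _ (hG i hi).2
  · intro i hi j hj hij
    have h1 := hG i hi
    have h2 := hG j hj
    have h3 := hfinj _ h1.2 _ h2.2 hij
    rw [← (hρ i h1.1).2, ← (hρ j h2.1).2]
    congr 1; omega
  · intro i hi
    obtain ⟨h1, h2⟩ := hG i hi
    have h3 : g * (ρ i / g) ≤ ρ i := Nat.mul_div_le (ρ i) g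
    have h4 : ρ i < g * (ρ i / g + 1) := Nat.lt_mul_div_succ _ hg1
    have h5 : g * (ρ i / g + 1) ≤ ρ i + g := by rw [mul_add]; omega
    -- The first multiple of `g` beyond the rank of `i` is at most `g` ranks away, so it does not
    -- lie beyond the image of `i`.
    refine ⟨f (g * (ρ i / g + 1)), Finset.mem_inter.2 ⟨?_, hfm _ (h5.trans_lt h2)⟩, ?_,
      hfmono _ _ h5 h2⟩
    · refine Finset.mem_image.2 ⟨ρ i / g + 1, Finset.mem_range.2 ?_, rfl⟩
      by_contra hc
      have : 2 * M * g ≤ (ρ i / g + 1) * g := Nat.mul_le_mul_right g (not_lt.1 hc)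
      rw [mul_comm (ρ i / g + 1) g] at this
      omega
    · have := hfmono (ρ i) _ h4.le (h5.trans_lt h2)
      rwa [(hρ i h1).2] at this

/-- Linear grouping for each set of scenarios separately. -/
theorem exists_shift_scen {d : ℕ} (Λ : Finset ℕ) (s : ℕ → ℚ) (scen : ℕ → Finset (Fin d)) {M : ℕ}
    (hM : 0 < M) :
    ∃ (T G : Finset ℕ) (σ : ℕ → ℕ), T ⊆ Λ ∧ G ⊆ Λ ∧ T.card ≤ 2 ^ d * (2 * M) ∧
      (∀ k, {i ∈ G | k ∈ scen i}.card * M ≤ {i ∈ Λ | k ∈ scen i}.card) ∧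
      (∀ i ∈ Λ \ G, σ i ∈ Λ ∧ scen (σ i) = scen i) ∧ Set.InjOn σ (Λ \ G : Finset ℕ) ∧
      ∀ i ∈ Λ \ G, ∃ t ∈ T, s i ≤ s t ∧ s t ≤ s (σ i) := by
  choose T G σ hT hG hTc hGc hσ hinj hs using
    fun K : Finset (Fin d) => exists_shift {i ∈ Λ | scen i = K} s hM
  let G' : Finset ℕ := {i ∈ Λ | i ∈ G (scen i)}
  have hmem : ∀ i ∈ Λ \ G', i ∈ {j ∈ Λ | scen j = scen i} \ G (scen i) := fun i hi => by
    simp only [G', Finset.mem_sdiff, Finset.mem_filter, not_and] at hi ⊢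
    exact ⟨⟨hi.1, trivial⟩, hi.2 hi.1⟩
  have hσ' : ∀ i ∈ Λ \ G', σ (scen i) i ∈ Λ ∧ scen (σ (scen i) i) = scen i := fun i hi =>
    Finset.mem_filter.1 (hσ _ i (hmem i hi))
  refine ⟨Finset.univ.biUnion T, G', fun i => σ (scen i) i, ?_, Finset.filter_subset _ _, ?_, ?_,
    hσ', ?_, ?_⟩
  · exact Finset.biUnion_subset.2 fun K _ => (hT K).trans (Finset.filter_subset _ _)
  · refine Finset.card_biUnion_le.trans ((Finset.sum_le_card_nsmul _ _ _ fun K _ => hTc K).trans ?_)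
    simp
  · intro k
    -- The items of scenario `k` are split by their exact scenario set; the grouping bound holds for
    -- each part and is summed.
    have h1 : ∀ (A : Finset ℕ), {i ∈ A | k ∈ scen i}.card =
        ∑ K with k ∈ K, {i ∈ A | scen i = K}.card := fun A => by
      rw [Finset.card_eq_sum_card_fiberwise (f := scen) (t := {K | k ∈ K})]
      · refine Finset.sum_congr rfl fun K hK => ?_
        congr 1
        ext i
        simp only [Finset.mem_filter, Finset.mem_univ, true_and] at hK ⊢
        constructor
        · rintro ⟨⟨h1, -⟩, h2⟩; exact ⟨h1, h2⟩
        · rintro ⟨h1, rfl⟩; exact ⟨⟨h1, hK⟩, rfl⟩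
      · intro i hi
        simp only [Finset.coe_filter, Set.mem_ofPred_eq, Finset.mem_univ, true_and] at hi ⊢
        exact hi.2
    rw [h1, h1, Finset.sum_mul]
    refine Finset.sum_le_sum fun K _ => le_trans (Nat.mul_le_mul_right _ ?_) (hGc K)
    refine Finset.card_le_card fun i hi => ?_
    simp only [G', Finset.mem_filter] at hi
    obtain ⟨⟨-, h⟩, rfl⟩ := hi
    exact h
  · intro i hi j hj hij
    have h3 : scen i = scen j := by
      rw [← (hσ' i hi).2, ← (hσ' j hj).2]
      exact congrArg scen hij
    have hj' := hmem j hj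
    rw [← h3] at hj'
    refine hinj (scen i) (hmem i hi) hj' ?_
    simpa [h3] using hij
  · intro i hi
    obtain ⟨t, ht, h1⟩ := hs _ i (hmem i hi)
    exact ⟨t, Finset.mem_biUnion.2 ⟨_, Finset.mem_univ _, ht⟩, h1⟩

end BPPS

namespace BPPS

theorem sum_map_flatMap {α β : Type*} (l : List α) (g : α → List β) (f : β → ℚ) :
    ((l.flatMap g).map f).sum = (l.map fun a => ((g a).map f).sum).sum := by
  induction l with
  | nil => rfl
  | cons a l ih => simp [ih]

theorem sum_map_indicator (l : List ℕ) (κ : ℕ) :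
    (l.map fun x => if x = κ then (1 : ℚ) else 0).sum = l.count κ := by
  induction l with
  | nil => rfl
  | cons a l ih =>
    rw [List.map_cons, List.sum_cons, ih, List.count_cons]
    by_cases h : a = κ <;> simp [h, add_comm]

theorem countP_toList {α : Type*} (s : Finset α) (p : α → Bool) :
    s.toList.countP p = {a ∈ s | p a}.card := by
  have := Multiset.countP_eq_card_filter (fun a => p a = true) s.val
  rw [← Finset.coe_toList, Multiset.coe_countP] at this
  simpa [Finset.card, Finset.filter] using this

/-! ### From a packing to a plan -/

namespace Classified

variable {d : ℕ} (S : Classified d)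

/-- The large items that occur in some scenario. -/
def large : Finset ℕ := {i ∈ S.U | (S.scen i).Nonempty ∧ S.δ < S.size i}

/-- The small items that occur in some scenario. -/
def smallItems : Finset ℕ := {i ∈ S.U | (S.scen i).Nonempty ∧ S.size i ≤ S.δ}

/-- A feasible packing, given by the labels `Q` and of value at most `v`, along with a shift `σ` of
the large items outside of `G`; from these data a list of bins is derived. -/
structure Blueprint where
  h : ℕ
  M : ℕ
  v : ℕ
  Q : ℕ → ℕ
  sc : Finset (Fin d) → ℕ
  G : Finset ℕ
  σ : ℕ → ℕ
  h_pos : 0 < h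
  M_pos : 0 < M
  η_eq : S.η = 1 / (2 * h)
  δ_eq : S.δ = 1 / (4 * h ^ 2)
  small_iff : ∀ i ∈ S.U, S.small (S.cls i) ↔ S.size i ≤ S.δ
  cls_small : ∀ i ∈ S.U, S.size i ≤ S.δ → S.cls i = sc (S.scen i)
  load_le : ∀ b k, load S.U S.size S.scen Q b k ≤ 1
  used_le : ∀ k, (used S.U S.scen Q k).card ≤ v
  σ_mem : ∀ i ∈ S.large \ G, σ i ∈ S.large ∧ S.scen (σ i) = S.scen i
  σ_inj : Set.InjOn σ (S.large \ G : Finset ℕ)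
  cap_le_σ : ∀ i ∈ S.large \ G, S.cap (S.cls i) ≤ S.size (σ i)
  cap_le_one : ∀ i ∈ S.large, S.cap (S.cls i) ≤ 1
  G_sub : G ⊆ S.large
  card_G : ∀ k, {i ∈ G | k ∈ S.scen i}.card * M ≤ {i ∈ S.large | k ∈ S.scen i}.card

namespace Blueprint

variable {S} (B : Blueprint S)

/-- The sets of scenarios of the small items. -/
def types (S : Classified d) : Finset (Finset (Fin d)) := S.smallItems.image S.scen

/-- The small items of type `K` in bin `β`. -/
def smallIn (β : ℕ) (K : Finset (Fin d)) : Finset ℕ :=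
  {i ∈ S.smallItems | B.Q i = β ∧ S.scen i = K}

/-- The total size of the small items of type `K` in bin `β`. -/
def vol (β : ℕ) (K : Finset (Fin d)) : ℚ := ∑ i ∈ B.smallIn β K, S.size i

/-- The number of slots for small items of type `K` in bin `β`. -/
def slots (β : ℕ) (K : Finset (Fin d)) : ℕ := ⌊B.vol β K / (S.η + S.δ)⌋₊

/-- The bins with small items of type `K`. -/
def bins (K : Finset (Fin d)) : Finset ℕ := {i ∈ S.smallItems | S.scen i = K}.image B.Q

/-- The large items that are shifted into bin `β`. -/
def shifted (β : ℕ) : Finset ℕ := {i ∈ S.large \ B.G | B.Q (B.σ i) = β}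

/-- The slots of a bin. -/
noncomputable def mixedBin (β : ℕ) : List ℕ :=
  (B.shifted β).toList.map S.cls ++
    (types S).toList.flatMap fun K => List.replicate (B.slots β K) (B.sc K)

/-- The bins of the packing, in terms of the slots that they offer. -/
def allBins : Finset ℕ := {i ∈ S.U | (S.scen i).Nonempty}.image B.Q

/-- The number of additional bins for small items of type `K`. -/
def extra (K : Finset (Fin d)) : ℕ := 2 * (B.bins K).card / B.h + 1

/-- The list of all bins. -/
noncomputable def plan : List (List ℕ) :=
  B.allBins.toList.map B.mixedBin ++
    ((types S).toList.flatMap fun K =>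
      List.replicate (B.extra K) (List.replicate B.h (B.sc K))) ++
    B.G.toList.map fun i => [S.cls i]

theorem sum_mixedBin (β : ℕ) (f : ℕ → ℚ) :
    ((B.mixedBin β).map f).sum =
      ∑ i ∈ B.shifted β, f (S.cls i) + ∑ K ∈ types S, B.slots β K * f (B.sc K) := by
  rw [mixedBin, List.map_append, List.sum_append, sum_map_flatMap, List.map_map,
    Finset.sum_map_toList, Finset.sum_map_toList]
  simp

theorem mem_smallItems {i : ℕ} (hi : i ∈ S.smallItems) :
    i ∈ S.U ∧ (S.scen i).Nonempty ∧ S.size i ≤ S.δ ∧ S.small (S.cls i) ∧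
      S.cls i = B.sc (S.scen i) := by
  simp only [smallItems, Finset.mem_filter] at hi
  exact ⟨hi.1, hi.2.1, hi.2.2, (B.small_iff i hi.1).2 hi.2.2, B.cls_small i hi.1 hi.2.2⟩

theorem mem_large (B : Blueprint S) {i : ℕ} (hi : i ∈ S.large) :
    i ∈ S.U ∧ (S.scen i).Nonempty ∧ S.δ < S.size i ∧ ¬ S.small (S.cls i) := by
  simp only [large, Finset.mem_filter] at hi
  exact ⟨hi.1, hi.2.1, hi.2.2, fun h => ((B.small_iff i hi.1).1 h).not_gt hi.2.2⟩

theorem mem_types {K : Finset (Fin d)} (hK : K ∈ types S) :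
    K.Nonempty ∧ S.small (B.sc K) ∧ S.classScen (B.sc K) = K ∧ B.sc K ∈ S.U.image S.cls := by
  obtain ⟨i, hi, rfl⟩ := Finset.mem_image.1 hK
  obtain ⟨h1, h2, -, h4, h5⟩ := B.mem_smallItems hi
  rw [← h5]
  exact ⟨h2, h4, S.classScen_cls i h1, Finset.mem_image_of_mem _ h1⟩

theorem η_add_δ_pos (S : Classified d) : 0 < S.η + S.δ := add_pos S.η_pos S.δ_pos

theorem vol_nonneg (β : ℕ) (K : Finset (Fin d)) : 0 ≤ B.vol β K :=
  Finset.sum_nonneg fun i _ => S.size_nonneg i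

theorem slots_mul_le (β : ℕ) (K : Finset (Fin d)) : B.slots β K * (S.η + S.δ) ≤ B.vol β K := by
  have := Nat.floor_le (div_nonneg (B.vol_nonneg β K) (η_add_δ_pos S).le)
  rwa [le_div_iff₀ (η_add_δ_pos S)] at this

theorem large_disjoint_small (S : Classified d) : Disjoint S.large S.smallItems := by
  rw [Finset.disjoint_left]
  intro i hi hi'
  simp only [large, smallItems, Finset.mem_filter] at hi hi'
  exact hi.2.2.not_ge hi'.2.2

/-- What is put into a bin weighs at most what was in it. -/
theorem mixed_le (β : ℕ) (p : Finset (Fin d) → Prop) [DecidablePred p] :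
    ∑ i ∈ B.shifted β with p (S.scen i), S.size (B.σ i) +
      ∑ K ∈ types S with p K, B.slots β K * (S.η + S.δ) ≤
    ∑ i ∈ S.U with B.Q i = β ∧ p (S.scen i), S.size i := by
  -- The shift is injective and preserves scenarios, so the images are distinct large items of bin
  -- `β` that satisfy the same predicate. The predicate is membership of `k` for capacities, and
  -- nonemptiness for the length of a configuration.
  have h1 : ∑ i ∈ B.shifted β with p (S.scen i), S.size (B.σ i) ≤
      ∑ i ∈ S.large with B.Q i = β ∧ p (S.scen i), S.size i := by
    rw [← Finset.sum_image (f := S.size) (g := B.σ)]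
    · refine Finset.sum_le_sum_of_subset_of_nonneg ?_ fun i _ _ => S.size_nonneg i
      intro j hj
      obtain ⟨i, hi, rfl⟩ := Finset.mem_image.1 hj
      simp only [shifted, Finset.mem_filter] at hi ⊢
      obtain ⟨h1, h2⟩ := B.σ_mem i hi.1.1
      exact ⟨h1, hi.1.2, h2 ▸ hi.2⟩
    · intro i hi j hj hij
      simp only [shifted, Finset.coe_filter, Finset.mem_filter] at hi hj
      exact B.σ_inj hi.1.1 hj.1.1 hij
  have h2 : ∑ K ∈ types S with p K, B.slots β K * (S.η + S.δ) ≤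
      ∑ i ∈ S.smallItems with B.Q i = β ∧ p (S.scen i), S.size i := by
    refine (Finset.sum_le_sum fun K _ => B.slots_mul_le β K).trans (le_of_eq ?_)
    rw [← Finset.sum_fiberwise_of_maps_to (g := S.scen) (t := (types S).filter p)]
    · refine Finset.sum_congr rfl fun K hK => ?_
      unfold vol smallIn
      refine Finset.sum_congr ?_ fun _ _ => rfl
      ext i
      simp only [Finset.mem_filter] at hK ⊢
      constructor
      · rintro ⟨h1, h2, rfl⟩; exact ⟨⟨h1, h2, hK.2⟩, rfl⟩
      · rintro ⟨⟨h1, h2, -⟩, h3⟩; exact ⟨h1, h2, h3⟩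
    · intro i hi
      simp only [Finset.mem_filter] at hi ⊢
      exact ⟨Finset.mem_image_of_mem _ hi.1, hi.2.2⟩
  refine (add_le_add h1 h2).trans ?_
  rw [← Finset.sum_union]
  · refine Finset.sum_le_sum_of_subset_of_nonneg ?_ fun i _ _ => S.size_nonneg i
    intro i
    simp only [large, smallItems, Finset.mem_union, Finset.mem_filter]
    tauto
  · exact Finset.disjoint_filter_filter (large_disjoint_small S)

theorem cast_h_pos : (0 : ℚ) < B.h := by exact_mod_cast B.h_pos

/-- This is why `h` slots fit into an additional bin: the product is `1/2 + 1/(4h)`. -/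
theorem h_mul_le_one : B.h * (S.η + S.δ) ≤ 1 := by
  have h1 : (1 : ℚ) ≤ B.h := by exact_mod_cast B.h_pos
  rw [B.η_eq, B.δ_eq]
  have : (B.h : ℚ) * (1 / (2 * B.h) + 1 / (4 * B.h ^ 2)) = 1 / 2 + 1 / (4 * B.h) := by
    field_simp
  rw [this]
  have : 1 / (4 * (B.h : ℚ)) ≤ 1 / 4 := by
    apply one_div_le_one_div_of_le <;> linarith
  linarith

/-- No bin of the plan is too full. -/
theorem binSum_plan_le (k : Fin d) : ∀ c ∈ B.plan, S.binSum k c ≤ 1 := by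
  intro c hc
  simp only [plan, List.mem_append, List.mem_map, List.mem_flatMap, Finset.mem_toList] at hc
  rcases hc with (⟨β, -, rfl⟩ | ⟨K, hK, hc⟩) | ⟨i, hi, rfl⟩
  · refine le_trans ?_ (B.load_le β k)
    rw [binSum, B.sum_mixedBin]
    refine le_trans ?_ (B.mixed_le β fun K => k ∈ K)
    rw [Finset.sum_filter, Finset.sum_filter]
    refine add_le_add (Finset.sum_le_sum fun i hi => ?_) (Finset.sum_le_sum fun K hK => ?_)
    · simp only [shifted, Finset.mem_filter] at hi
      have hl := B.mem_large (Finset.mem_sdiff.1 hi.1).1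
      rw [S.classScen_cls i hl.1]
      split_ifs
      · exact B.cap_le_σ i hi.1
      · exact le_rfl
    · obtain ⟨-, h2, h3, -⟩ := B.mem_types hK
      rw [h3, S.cap_small _ h2]
      split_ifs
      · exact le_rfl
      · simp
  · obtain ⟨-, h2, h3, -⟩ := B.mem_types hK
    rw [(List.mem_replicate.1 hc).2, binSum, List.map_replicate, List.sum_replicate, h3,
      S.cap_small _ h2, nsmul_eq_mul]
    split_ifs
    · exact B.h_mul_le_one
    · simp
  · have h1 := B.cap_le_one i (B.G_sub hi)
    simp only [binSum, List.map_cons, List.map_nil, List.sum_cons, List.sum_nil, add_zero]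
    split_ifs
    · exact h1
    · exact zero_le_one

/-- Any scenario of `K` sees all these items at once. -/
theorem vol_le_one (β : ℕ) {K : Finset (Fin d)} (hK : K.Nonempty) : B.vol β K ≤ 1 := by
  obtain ⟨k, hk⟩ := hK
  refine le_trans ?_ (B.load_le β k)
  refine Finset.sum_le_sum_of_subset_of_nonneg ?_ fun i _ _ => S.size_nonneg i
  intro i hi
  simp only [smallIn, smallItems, Finset.mem_filter] at hi ⊢
  exact ⟨hi.1.1, hi.2.1, hi.2.2 ▸ hk⟩

theorem bins_subset_allBins (K : Finset (Fin d)) : B.bins K ⊆ B.allBins := by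
  refine Finset.image_subset_image fun i hi => ?_
  simp only [smallItems, Finset.mem_filter] at hi ⊢
  exact ⟨hi.1.1, hi.1.2.1⟩

theorem count_plan (κ : ℕ) : (B.plan.flatten.count κ : ℚ) =
    ∑ β ∈ B.allBins, (∑ i ∈ B.shifted β, (if S.cls i = κ then (1 : ℚ) else 0) +
      ∑ K ∈ types S, B.slots β K * (if B.sc K = κ then (1 : ℚ) else 0)) +
    ∑ K ∈ types S, B.extra K * (B.h * (if B.sc K = κ then (1 : ℚ) else 0)) +
    ∑ i ∈ B.G, (if S.cls i = κ then (1 : ℚ) else 0) := by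
  rw [← sum_map_indicator, ← List.flatMap_id, sum_map_flatMap, plan, List.map_append,
    List.sum_append, List.map_append, List.sum_append, sum_map_flatMap, List.map_map,
    Finset.sum_map_toList, Finset.sum_map_toList, List.map_map, Finset.sum_map_toList]
  congr 1
  · congr 1
    · refine Finset.sum_congr rfl fun β _ => ?_
      exact B.sum_mixedBin β fun x => if x = κ then (1 : ℚ) else 0
    · refine Finset.sum_congr rfl fun K _ => ?_
      simp
  · refine Finset.sum_congr rfl fun i _ => ?_
    simp

/-- There are enough slots for the small items of type `K`. -/
theorem small_suffices {K : Finset (Fin d)} (hK : K ∈ types S) :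
    ∑ i ∈ S.smallItems with S.scen i = K, S.size i <
      (B.plan.flatten.count (B.sc K) : ℚ) * S.η := by
  obtain ⟨hne, -, -, -⟩ := B.mem_types hK
  set V := ∑ i ∈ S.smallItems with S.scen i = K, S.size i with hV
  set n : ℚ := ((B.bins K).card : ℚ) with hn
  have hVsum : V = ∑ β ∈ B.bins K, B.vol β K := by
    rw [hV, ← Finset.sum_fiberwise_of_maps_to (g := B.Q) (t := B.bins K)]
    · refine Finset.sum_congr rfl fun β _ => ?_
      unfold vol smallIn
      refine Finset.sum_congr ?_ fun _ _ => rfl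
      ext i
      simp only [Finset.mem_filter]
      tauto
    · exact fun i hi => Finset.mem_image_of_mem _ hi
  have hVn : V ≤ n := by
    rw [hVsum]
    refine (Finset.sum_le_card_nsmul _ _ 1 fun β _ => B.vol_le_one β hne).trans ?_
    simp [hn]
  have hV0 : 0 ≤ V := Finset.sum_nonneg fun i _ => S.size_nonneg i
  -- Rounding down loses at most one slot in each of the `n` bins; the additional bins supply at
  -- least `2n + 1` slots, because `h(⌊2n/h⌋ + 1) > 2n`.
  have hcount : V / (S.η + S.δ) - n + (2 * n + 1) ≤ B.plan.flatten.count (B.sc K) := by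
    rw [B.count_plan]
    have h1 : V / (S.η + S.δ) - n ≤ ∑ β ∈ B.allBins,
        (∑ i ∈ B.shifted β, (if S.cls i = B.sc K then (1 : ℚ) else 0) +
        ∑ K' ∈ types S, B.slots β K' * (if B.sc K' = B.sc K then (1 : ℚ) else 0)) := by
      have h2 : V / (S.η + S.δ) - n ≤ ∑ β ∈ B.bins K, (B.slots β K : ℚ) := by
        have : V / (S.η + S.δ) - n = ∑ β ∈ B.bins K, (B.vol β K / (S.η + S.δ) - 1) := by
          rw [Finset.sum_sub_distrib, ← Finset.sum_div, ← hVsum]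
          simp [hn]
        rw [this]
        refine Finset.sum_le_sum fun β _ => ?_
        have := Nat.lt_floor_add_one (B.vol β K / (S.η + S.δ))
        rw [slots]
        linarith
      refine h2.trans ((Finset.sum_le_sum_of_subset_of_nonneg (B.bins_subset_allBins K)
        fun _ _ _ => Nat.cast_nonneg _).trans (Finset.sum_le_sum fun β _ => ?_))
      refine le_add_of_nonneg_of_le (Finset.sum_nonneg fun i _ => by positivity) ?_
      have := Finset.single_le_sum (s := types S)
        (f := fun K' => (B.slots β K' : ℚ) * (if B.sc K' = B.sc K then (1 : ℚ) else 0))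
        (fun K' _ => by positivity) hK
      simpa using this
    have h2 : 2 * n + 1 ≤ ∑ K' ∈ types S, B.extra K' *
        (B.h * (if B.sc K' = B.sc K then (1 : ℚ) else 0)) := by
      have h3 : 2 * (B.bins K).card + 1 ≤ B.extra K * B.h := by
        have := Nat.lt_mul_div_succ (2 * (B.bins K).card) B.h_pos
        rw [extra, mul_comm _ B.h]; exact this
      have h4 : 2 * n + 1 ≤ B.extra K * (B.h : ℚ) := by
        rw [hn]; exact_mod_cast h3
      refine h4.trans ?_
      have := Finset.single_le_sum (s := types S)
        (f := fun K' => (B.extra K' : ℚ) *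
          (B.h * (if B.sc K' = B.sc K then (1 : ℚ) else 0)))
        (fun K' _ => by positivity) hK
      simpa using this
    have h3 : (0 : ℚ) ≤ ∑ i ∈ B.G, (if S.cls i = B.sc K then (1 : ℚ) else 0) :=
      Finset.sum_nonneg fun i _ => by positivity
    linarith
  have hη := S.η_pos
  have hδ := S.δ_pos
  have hδη : S.δ = S.η * S.η := by
    rw [B.η_eq, B.δ_eq]
    have := B.cast_h_pos
    field_simp
    norm_num
  -- A slot takes `η + δ` of the volume but guarantees progress only `η`. The difference totals
  -- `δV/(η + δ)`, which is at most `ηV ≤ ηn` because `δ = η²`. The one slot still to spare makes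
  -- the final inequality strict.
  have key : V ≤ S.η * (V / (S.η + S.δ)) + S.η * n := by
    have h1 : V = (S.η + S.δ) * (V / (S.η + S.δ)) := by field_simp
    have h2 : S.δ * (V / (S.η + S.δ)) ≤ S.η * n := by
      rw [hδη, mul_assoc]
      refine mul_le_mul_of_nonneg_left (le_trans ?_ hVn) hη.le
      rw [← mul_div_assoc, div_le_iff₀ (by positivity)]
      nlinarith [mul_nonneg hV0 (mul_pos hη hη).le]
    linarith
  have := mul_le_mul_of_nonneg_right hcount hη.le
  nlinarith

/-- There are enough slots for the large items of each class. -/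
theorem large_suffices (κ : ℕ) :
    {i ∈ S.large | S.cls i = κ}.card ≤ B.plan.flatten.count κ := by
  -- Each large item outside `G` yields one slot, in the bin of its image.
  have hR : ∑ β ∈ B.allBins, ∑ i ∈ B.shifted β, (if S.cls i = κ then (1 : ℚ) else 0) =
      ∑ i ∈ S.large \ B.G, (if S.cls i = κ then (1 : ℚ) else 0) := by
    unfold shifted
    refine Finset.sum_fiberwise_of_maps_to (g := fun i => B.Q (B.σ i)) (fun i hi => ?_) _
    obtain ⟨h1, -⟩ := B.σ_mem i hi
    obtain ⟨h2, h3, -⟩ := B.mem_large h1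
    exact Finset.mem_image_of_mem _ (Finset.mem_filter.2 ⟨h2, h3⟩)
  have h1 : (({i ∈ S.large | S.cls i = κ}.card : ℕ) : ℚ) ≤ B.plan.flatten.count κ := by
    rw [B.count_plan, Finset.sum_add_distrib, hR, Finset.card_filter]
    push_cast
    rw [← Finset.sum_sdiff B.G_sub]
    have h2 : (0 : ℚ) ≤ ∑ β ∈ B.allBins,
        ∑ K ∈ types S, (B.slots β K : ℚ) * (if B.sc K = κ then (1 : ℚ) else 0) := by positivity
    have h3 : (0 : ℚ) ≤ ∑ K ∈ types S, (B.extra K : ℚ) *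
        (B.h * (if B.sc K = κ then (1 : ℚ) else 0)) := by positivity
    linarith
  exact_mod_cast h1

/-- For a small class the slots alone exceed the total size strictly. For a large class slots and
items are counted, and the nonempty set `X` provides strictness. -/
theorem suffices_plan : S.Suffices B.plan := by
  intro κ hκ X hX ⟨i, hi⟩
  have hcls : ∀ j ∈ S.U, S.cls j = κ → (S.scen j).Nonempty := fun j hj h => by
    rw [← S.classScen_cls j hj, h]; exact hκ
  obtain ⟨hiU, hicls⟩ := Finset.mem_filter.1 (hX hi)
  have hXnn : 0 ≤ ∑ j ∈ X, S.measure j := Finset.sum_nonneg fun j _ => measure_nonneg j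
  by_cases hs : S.small κ
  · have hiZ : i ∈ S.smallItems := Finset.mem_filter.2
      ⟨hiU, hcls i hiU hicls, (B.small_iff i hiU).1 (by rwa [hicls])⟩
    have hK : S.scen i ∈ types S := Finset.mem_image_of_mem _ hiZ
    have hsc : B.sc (S.scen i) = κ := by rw [← (B.mem_smallItems hiZ).2.2.2.2, hicls]
    have h1 := B.small_suffices hK
    rw [hsc] at h1
    rw [need, if_pos hs]
    refine lt_of_le_of_lt (le_of_eq ?_) (h1.trans_le (le_add_of_nonneg_left hXnn))
    refine Finset.sum_congr ?_ fun j hj => ?_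
    · ext j
      simp only [Finset.mem_filter]
      constructor
      · rintro ⟨h2, h3⟩
        refine ⟨Finset.mem_filter.2 ⟨h2, hcls j h2 h3, (B.small_iff j h2).1 (by rwa [h3])⟩, ?_⟩
        rw [← S.classScen_cls j h2, ← S.classScen_cls i hiU, h3, hicls]
      · rintro ⟨h2, h3⟩
        have := B.mem_smallItems h2
        exact ⟨this.1, by rw [this.2.2.2.2, h3, hsc]⟩
    · have := B.mem_smallItems (Finset.mem_filter.1 hj).1
      rw [measure, if_pos this.2.2.2.1]
  · have hm : ∀ j ∈ S.U, S.cls j = κ → S.measure j = 1 := fun j _ h => by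
      rw [measure, h, if_neg hs]
    have h1 : (1 : ℚ) ≤ ∑ j ∈ X, S.measure j := by
      rw [← hm i hiU hicls]
      exact Finset.single_le_sum (fun j _ => measure_nonneg j) hi
    have h2 : ∑ j ∈ S.U with S.cls j = κ, S.measure j = {j ∈ S.large | S.cls j = κ}.card := by
      rw [Finset.sum_congr rfl fun j hj => hm j (Finset.mem_filter.1 hj).1
        (Finset.mem_filter.1 hj).2, Finset.sum_const, nsmul_eq_mul, mul_one]
      congr 2
      ext j
      simp only [large, Finset.mem_filter]
      constructor
      · rintro ⟨h2, h3⟩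
        refine ⟨⟨h2, hcls j h2 h3, ?_⟩, h3⟩
        by_contra hc
        exact hs (h3 ▸ (B.small_iff j h2).2 (not_lt.1 hc))
      · rintro ⟨⟨h2, -⟩, h3⟩; exact ⟨h2, h3⟩
    have h3 : ({j ∈ S.large | S.cls j = κ}.card : ℚ) ≤ B.plan.flatten.count κ := by
      exact_mod_cast B.large_suffices κ
    rw [h2, need, if_neg hs, mul_one]
    linarith

end Blueprint
end Classified
end BPPS

/-! ### Value, number of bins and configurations of the plan -/

namespace BPPS
namespace Classified
namespace Blueprint

variable {d : ℕ} {S : Classified d} (B : Blueprint S)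

theorem card_types_le (S : Classified d) : (types S).card ≤ 2 ^ d := by
  simpa using Finset.card_le_univ (types S)

/-- The items that occur in some scenario. -/
def active (S : Classified d) : Finset ℕ := {i ∈ S.U | (S.scen i).Nonempty}

/-- Behind every slot stands an item of the given packing in bin `β` with the same scenarios: the
image of a shifted item, or a small item, since positively many slots require positive volume. Hence
the mixed bins do not increase the value. -/
theorem touches_mixedBin {k : Fin d} {β : ℕ} (h : S.touches k (B.mixedBin β)) :
    β ∈ used S.U S.scen B.Q k := by
  simp only [touches, List.any_eq_true, decide_eq_true_eq] at h
  obtain ⟨κ, hκ, hk⟩ := h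
  simp only [mixedBin, List.mem_append, List.mem_map, List.mem_flatMap, Finset.mem_toList,
    List.mem_replicate] at hκ
  rcases hκ with ⟨i, hi, rfl⟩ | ⟨K, hK, hs, rfl⟩
  · simp only [shifted, Finset.mem_filter] at hi
    rw [S.classScen_cls i (B.mem_large (Finset.mem_sdiff.1 hi.1).1).1] at hk
    obtain ⟨h1, h2⟩ := B.σ_mem i hi.1
    exact Finset.mem_image.2 ⟨B.σ i, Finset.mem_filter.2 ⟨(B.mem_large h1).1, h2 ▸ hk⟩, hi.2⟩
  · rw [(B.mem_types hK).2.2.1] at hk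
    have hne : (B.smallIn β K).Nonempty := by
      rw [Finset.nonempty_iff_ne_empty]
      intro h0
      exact hs (by simp [slots, vol, h0])
    obtain ⟨i, hi⟩ := hne
    simp only [smallIn, smallItems, Finset.mem_filter] at hi
    obtain ⟨⟨h1, -⟩, h2, rfl⟩ := hi
    exact Finset.mem_image.2 ⟨i, Finset.mem_filter.2 ⟨h1, hk⟩, h2⟩

theorem countP_plan_le (k : Fin d) : B.plan.countP (S.touches k) ≤
    B.v + ∑ K ∈ types S with k ∈ K, B.extra K + {i ∈ B.G | k ∈ S.scen i}.card := by
  rw [plan, List.countP_append, List.countP_append, List.countP_map, List.countP_flatMap,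
    List.countP_map, countP_toList, countP_toList]
  refine add_le_add (add_le_add ?_ (le_of_eq ?_)) (Finset.card_le_card ?_)
  · refine le_trans (Finset.card_le_card fun β hβ => ?_) (B.used_le k)
    exact B.touches_mixedBin (Finset.mem_filter.1 hβ).2
  · rw [Finset.sum_map_toList, Finset.sum_filter]
    refine Finset.sum_congr rfl fun K hK => ?_
    simp only [Function.comp, List.countP_replicate]
    have : S.touches k (List.replicate B.h (B.sc K)) = true ↔ k ∈ K := by
      simp [touches, List.any_replicate, B.h_pos.ne', (B.mem_types hK).2.2.1]
    simp only [this]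
  · intro i hi
    simp only [touches, Function.comp, List.any_cons, List.any_nil, Bool.or_false,
      decide_eq_true_eq, Finset.mem_filter] at hi ⊢
    rw [S.classScen_cls i (B.mem_large (B.G_sub hi.1)).1] at hi
    exact hi

/-- The total size of the items of a scenario is at most the value of the packing. -/
theorem total_le (k : Fin d) : ∑ i ∈ S.U with k ∈ S.scen i, S.size i ≤ B.v := by
  have h1 : ∑ i ∈ S.U with k ∈ S.scen i, S.size i =
      ∑ β ∈ used S.U S.scen B.Q k, load S.U S.size S.scen B.Q β k := by
    rw [← Finset.sum_fiberwise_of_maps_to (g := B.Q) (t := used S.U S.scen B.Q k)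
      fun i hi => Finset.mem_image_of_mem _ hi]
    refine Finset.sum_congr rfl fun β _ => Finset.sum_congr ?_ fun _ _ => rfl
    ext i
    simp only [Finset.mem_filter]
    tauto
  rw [h1]
  refine (Finset.sum_le_card_nsmul _ _ 1 fun β _ => B.load_le β k).trans ?_
  rw [nsmul_eq_mul, mul_one]
  exact_mod_cast B.used_le k

/-- The items of a scenario have total size at most `v`, and each large one exceeds `δ`. -/
theorem card_large_le (k : Fin d) :
    ({i ∈ S.large | k ∈ S.scen i}.card : ℚ) ≤ 4 * B.h ^ 2 * B.v := by
  have h1 : ({i ∈ S.large | k ∈ S.scen i}.card : ℚ) * S.δ ≤ B.v := by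
    refine le_trans ?_ (B.total_le k)
    rw [← nsmul_eq_mul]
    refine (Finset.card_nsmul_le_sum _ S.size _ fun i hi => ?_).trans
      (Finset.sum_le_sum_of_subset_of_nonneg ?_ fun i _ _ => S.size_nonneg i)
    · exact (B.mem_large (Finset.mem_filter.1 hi).1).2.2.1.le
    · intro i hi
      obtain ⟨h1, h2⟩ := Finset.mem_filter.1 hi
      exact Finset.mem_filter.2 ⟨(B.mem_large h1).1, h2⟩
  have hh := B.cast_h_pos
  rw [B.δ_eq, mul_one_div, div_le_iff₀ (by positivity)] at h1
  linarith

/-- The value of the plan. -/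
theorem value_le (k : Fin d) : (B.plan.countP (S.touches k) : ℚ) ≤
    B.v + 2 ^ d * (2 * B.v / B.h + 1) + 4 * B.h ^ 2 * B.v / B.M := by
  have hh := B.cast_h_pos
  have hM : (0 : ℚ) < B.M := by exact_mod_cast B.M_pos
  have h1 : (B.plan.countP (S.touches k) : ℚ) ≤ B.v +
      ∑ K ∈ types S with k ∈ K, (B.extra K : ℚ) + {i ∈ B.G | k ∈ S.scen i}.card := by
    exact_mod_cast B.countP_plan_le k
  -- For `k ∈ K`, all bins with small items of type `K` are used in scenario `k`, so there are at
  -- most `v` of them; and there are at most `2^d` types.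
  have h2 : ∑ K ∈ types S with k ∈ K, (B.extra K : ℚ) ≤ 2 ^ d * (2 * B.v / B.h + 1) := by
    refine (Finset.sum_le_card_nsmul _ _ (2 * B.v / B.h + 1 : ℚ) fun K hK => ?_).trans ?_
    · have h3 : (B.bins K).card ≤ B.v := by
        refine le_trans (Finset.card_le_card ?_) (B.used_le k)
        refine Finset.image_subset_image fun i hi => ?_
        simp only [smallItems, Finset.mem_filter] at hi hK ⊢
        exact ⟨hi.1.1, hi.2 ▸ hK.2⟩
      rw [extra]
      push_cast
      gcongr
      refine Nat.cast_div_le.trans ?_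
      push_cast
      gcongr
    · rw [nsmul_eq_mul]
      gcongr
      refine le_trans (b := ((types S).card : ℚ)) ?_ (by exact_mod_cast card_types_le S)
      exact_mod_cast Finset.card_filter_le _ _
  have h3 : ({i ∈ B.G | k ∈ S.scen i}.card : ℚ) ≤ 4 * B.h ^ 2 * B.v / B.M := by
    rw [le_div_iff₀ hM]
    refine le_trans ?_ (B.card_large_le k)
    exact_mod_cast B.card_G k
  linarith

/-- Needed to keep labels and multiplicities below the number of rounds of the loops. -/
theorem length_plan_le :
    B.plan.length ≤ 2 * (active S).card + 2 ^ d * (2 * (active S).card + 1) := by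
  rw [plan, List.length_append, List.length_append, List.length_map, List.length_map,
    List.length_flatMap, Finset.length_toList, Finset.length_toList, Finset.sum_map_toList]
  have h1 : B.allBins.card ≤ (active S).card := Finset.card_image_le
  have h2 : B.G.card ≤ (active S).card := by
    refine Finset.card_le_card (B.G_sub.trans fun i hi => ?_)
    obtain ⟨h1, h2, -⟩ := B.mem_large hi
    exact Finset.mem_filter.2 ⟨h1, h2⟩
  have h3 : ∑ K ∈ types S, (List.replicate (B.extra K) (List.replicate B.h (B.sc K))).length ≤
      2 ^ d * (2 * (active S).card + 1) := by
    refine (Finset.sum_le_card_nsmul _ _ (2 * (active S).card + 1) fun K hK => ?_).trans ?_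
    · rw [List.length_replicate, extra]
      gcongr
      refine (Nat.div_le_self _ _).trans (Nat.mul_le_mul_left 2 ?_)
      exact (Finset.card_le_card (B.bins_subset_allBins K)).trans h1
    · exact Nat.mul_le_mul_right _ (card_types_le S)
  omega

/-- Each slot accounts for at least `δ` of the content of bin `β`. The items there that occur in
some scenario have total size at most `d`, by summing the loads of the `d` scenarios. -/
theorem length_mixedBin_le (β : ℕ) : (B.mixedBin β).length ≤ 4 * B.h ^ 2 * d := by
  have hh := B.cast_h_pos
  have h1 : ((B.mixedBin β).length : ℚ) * S.δ ≤ d := by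
    have h2 : ∑ i ∈ S.U with B.Q i = β ∧ (S.scen i).Nonempty, S.size i ≤ d := by
      have h3 : ∑ k : Fin d, load S.U S.size S.scen B.Q β k ≤ d := by
        refine (Finset.sum_le_card_nsmul _ _ 1 fun k _ => B.load_le β k).trans ?_
        simp
      refine le_trans ?_ h3
      simp only [load, Finset.sum_filter]
      rw [Finset.sum_comm]
      refine Finset.sum_le_sum fun i _ => ?_
      split_ifs with hc
      · obtain ⟨k, hk⟩ := hc.2
        have := Finset.single_le_sum (s := Finset.univ)
          (f := fun k => if B.Q i = β ∧ k ∈ S.scen i then S.size i else 0)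
          (fun k _ => by have := S.size_nonneg i; positivity) (Finset.mem_univ k)
        simpa [hc.1, hk] using this
      · exact Finset.sum_nonneg fun k _ => by have := S.size_nonneg i; positivity
    refine le_trans ?_ h2
    refine le_trans ?_ (B.mixed_le β fun K => K.Nonempty)
    have h4 : ((B.mixedBin β).length : ℚ) = ((B.mixedBin β).map fun _ => (1 : ℚ)).sum := by
      simp
    rw [h4, B.sum_mixedBin, add_mul, Finset.sum_mul, Finset.sum_mul, Finset.sum_filter,
      Finset.sum_filter]
    refine add_le_add (Finset.sum_le_sum fun i hi => ?_) (Finset.sum_le_sum fun K hK => ?_)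
    · simp only [shifted, Finset.mem_filter] at hi
      rw [if_pos (B.mem_large (Finset.mem_sdiff.1 hi.1).1).2.1, one_mul]
      exact (B.mem_large (B.σ_mem i hi.1).1).2.2.1.le
    · rw [if_pos (B.mem_types hK).1, mul_one]
      exact mul_le_mul_of_nonneg_left (le_add_of_nonneg_left S.η_pos.le) (Nat.cast_nonneg _)
  rw [B.δ_eq, mul_one_div, div_le_iff₀ (by positivity)] at h1
  have h5 : ((B.mixedBin β).length : ℚ) ≤ ((4 * B.h ^ 2 * d : ℕ) : ℚ) := by
    push_cast; linarith
  exact_mod_cast h5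

/-- The reason that only constantly many configurations have to be considered. -/
theorem mem_plan {c : List ℕ} (hc : c ∈ B.plan) :
    c.length ≤ 4 * B.h ^ 2 * d + B.h + 1 ∧ ∀ κ ∈ c, κ ∈ S.U.image S.cls := by
  simp only [plan, List.mem_append, List.mem_map, List.mem_flatMap, Finset.mem_toList] at hc
  rcases hc with (⟨β, -, rfl⟩ | ⟨K, hK, hc⟩) | ⟨i, hi, rfl⟩
  · refine ⟨(B.length_mixedBin_le β).trans (by omega), fun κ hκ => ?_⟩
    simp only [mixedBin, List.mem_append, List.mem_map, List.mem_flatMap, Finset.mem_toList,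
      List.mem_replicate] at hκ
    rcases hκ with ⟨i, hi, rfl⟩ | ⟨K, hK, -, rfl⟩
    · simp only [shifted, Finset.mem_filter] at hi
      exact Finset.mem_image_of_mem _ (B.mem_large (Finset.mem_sdiff.1 hi.1).1).1
    · exact (B.mem_types hK).2.2.2
  · rw [(List.mem_replicate.1 hc).2]
    refine ⟨by rw [List.length_replicate]; omega, fun κ hκ => ?_⟩
    rw [(List.mem_replicate.1 hκ).2]
    exact (B.mem_types hK).2.2.2
  · refine ⟨by simp, fun κ hκ => ?_⟩
    rw [List.mem_singleton.1 hκ]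
    exact Finset.mem_image_of_mem _ (B.mem_large (B.G_sub hi)).1

/-- Carrying out the plan, with the bins in any order, gives a feasible packing. -/
theorem sound {cs : List (List ℕ)} (hcs : cs.Perm B.plan) {L : ℕ → ℕ}
    (h : S.Fills (numbered 1 cs) (fun _ => 0) L) (k : Fin d) :
    (∀ b, load S.U S.size S.scen L b k ≤ 1) ∧ ((used S.U S.scen L k).card : ℚ) ≤
      B.v + 2 ^ d * (2 * B.v / B.h + 1) + 4 * B.h ^ 2 * B.v / B.M := by
  obtain ⟨h1, h2⟩ := h.sound (fun k c hc => B.binSum_plan_le k c (hcs.mem_iff.1 hc)) (by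
    have := B.suffices_plan
    intro κ
    rw [hcs.flatten.count_eq]
    exact this κ) k
  refine ⟨h1, le_trans ?_ (B.value_le k)⟩
  rw [hcs.countP_eq] at h2
  exact_mod_cast h2

end Blueprint
end Classified
end BPPS

/-! ### Derived expressions and basic programs -/

namespace RAM

namespace Expr

/-- The expression for `c * e`. -/
def smul (c : ℕ) (e : Expr) : Expr :=
  match c with
  | 0 => .const 0
  | c + 1 => .add (smul c e) e

@[simp] theorem eval_smul (s : State) (c : ℕ) (e : Expr) : (smul c e).eval s = c * e.eval s := by
  induction c with
  | zero => simp [smul]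
  | succ c ih => simp [smul, ih, add_mul]

/-- The expression for the sum of a list of expressions. -/
def sum : List Expr → Expr
  | [] => .const 0
  | e :: l => .add e (sum l)

@[simp] theorem eval_sum (s : State) (l : List Expr) :
    (sum l).eval s = (l.map fun e => e.eval s).sum := by
  induction l with
  | nil => rfl
  | cons e l ih => simp [sum, ih]

/-- The expression with value `1` if `e₁ ≤ e₂` and `0` otherwise. -/
def le (e₁ e₂ : Expr) : Expr := .sub (.const 1) (.sub e₁ e₂)

@[simp] theorem eval_le (s : State) (e₁ e₂ : Expr) :
    (le e₁ e₂).eval s = if e₁.eval s ≤ e₂.eval s then 1 else 0 := by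
  simp only [le, eval]
  split_ifs <;> omega

/-- The expression with value `1` if `e₁ = e₂` and `0` otherwise. -/
def eq (e₁ e₂ : Expr) : Expr := .sub (.const 1) (.add (.sub e₁ e₂) (.sub e₂ e₁))

@[simp] theorem eval_eq (s : State) (e₁ e₂ : Expr) :
    (eq e₁ e₂).eval s = if e₁.eval s = e₂.eval s then 1 else 0 := by
  simp only [eq, eval]
  split_ifs <;> omega

/-- The expression with value `1` if `e ≠ 0` and `0` otherwise. -/
def nonzero (e : Expr) : Expr := .sub (.const 1) (.sub (.const 1) e)

@[simp] theorem eval_nonzero (s : State) (e : Expr) :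
    (nonzero e).eval s = if e.eval s ≠ 0 then 1 else 0 := by
  simp only [nonzero, eval]
  split_ifs <;> omega

end Expr

namespace LoopProg

/-- Run `p` if `e` is nonzero. -/
def when (e : Expr) (p : LoopProg) : LoopProg := branch e p skip

/-- Run the programs of a list one after the other. -/
def seqs : List LoopProg → LoopProg
  | [] => skip
  | p :: l => seq p (seqs l)

@[simp] theorem run_assign (s : State) (x : ℕ) (e : Expr) :
    (assign x e).run s = s.setReg x (e.eval s) := rfl

@[simp] theorem run_store (s : State) (a : ℕ) (i e : Expr) :
    (store a i e).run s = s.setArr a (i.eval s) (e.eval s) := rfl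

@[simp] theorem run_seq (s : State) (p q : LoopProg) : (seq p q).run s = q.run (p.run s) := rfl

@[simp] theorem run_branch (s : State) (e : Expr) (p q : LoopProg) :
    (branch e p q).run s = if e.eval s ≠ 0 then p.run s else q.run s := rfl

@[simp] theorem run_when (s : State) (e : Expr) (p : LoopProg) :
    (when e p).run s = if e.eval s ≠ 0 then p.run s else s := rfl

@[simp] theorem run_seqs_nil (s : State) : (seqs []).run s = s := rfl

@[simp] theorem run_seqs_cons (s : State) (p : LoopProg) (l : List LoopProg) :
    (seqs (p :: l)).run s = (seqs l).run (p.run s) := rfl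

@[simp] theorem keeps_skip (y : ℕ) : skip.Keeps y ↔ True := Iff.rfl
@[simp] theorem keeps_assign (y x : ℕ) (e : Expr) : (assign x e).Keeps y ↔ y ≠ x := Iff.rfl
@[simp] theorem keeps_store (y a : ℕ) (i e : Expr) : (store a i e).Keeps y ↔ True := Iff.rfl
@[simp] theorem keeps_seq (y : ℕ) (p q : LoopProg) :
    (seq p q).Keeps y ↔ p.Keeps y ∧ q.Keeps y := Iff.rfl
@[simp] theorem keeps_branch (y : ℕ) (e : Expr) (p q : LoopProg) :
    (branch e p q).Keeps y ↔ p.Keeps y ∧ q.Keeps y := Iff.rfl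
@[simp] theorem keeps_when (y : ℕ) (e : Expr) (p : LoopProg) :
    (when e p).Keeps y ↔ p.Keeps y := by simp [when]
@[simp] theorem keeps_iter (y x : ℕ) (p : LoopProg) :
    (iter x p).Keeps y ↔ y ≠ x ∧ p.Keeps y := Iff.rfl
@[simp] theorem keeps_seqs (y : ℕ) (l : List LoopProg) :
    (seqs l).Keeps y ↔ ∀ p ∈ l, p.Keeps y := by
  induction l with
  | nil => simp [seqs]
  | cons p l ih => simp [seqs, ih]

@[simp] theorem keepsArr_skip (b : ℕ) : skip.KeepsArr b ↔ True := Iff.rfl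
@[simp] theorem keepsArr_assign (b x : ℕ) (e : Expr) : (assign x e).KeepsArr b ↔ True := Iff.rfl
@[simp] theorem keepsArr_store (b a : ℕ) (i e : Expr) :
    (store a i e).KeepsArr b ↔ b ≠ a := Iff.rfl
@[simp] theorem keepsArr_seq (b : ℕ) (p q : LoopProg) :
    (seq p q).KeepsArr b ↔ p.KeepsArr b ∧ q.KeepsArr b := Iff.rfl
@[simp] theorem keepsArr_branch (b : ℕ) (e : Expr) (p q : LoopProg) :
    (branch e p q).KeepsArr b ↔ p.KeepsArr b ∧ q.KeepsArr b := Iff.rfl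
@[simp] theorem keepsArr_when (b : ℕ) (e : Expr) (p : LoopProg) :
    (when e p).KeepsArr b ↔ p.KeepsArr b := by simp [when]
@[simp] theorem keepsArr_iter (b x : ℕ) (p : LoopProg) :
    (iter x p).KeepsArr b ↔ p.KeepsArr b := Iff.rfl
@[simp] theorem keepsArr_seqs (b : ℕ) (l : List LoopProg) :
    (seqs l).KeepsArr b ↔ ∀ p ∈ l, p.KeepsArr b := by
  induction l with
  | nil => simp [seqs]
  | cons p l ih => simp [seqs, ih]

@[simp] theorem wF_skip : skip.WF ↔ True := Iff.rfl
@[simp] theorem wF_assign (x : ℕ) (e : Expr) : (assign x e).WF ↔ True := Iff.rfl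
@[simp] theorem wF_store (a : ℕ) (i e : Expr) : (store a i e).WF ↔ True := Iff.rfl
@[simp] theorem wF_seq (p q : LoopProg) : (seq p q).WF ↔ p.WF ∧ q.WF := Iff.rfl
@[simp] theorem wF_branch (e : Expr) (p q : LoopProg) :
    (branch e p q).WF ↔ p.WF ∧ q.WF := Iff.rfl
@[simp] theorem wF_when (e : Expr) (p : LoopProg) : (when e p).WF ↔ p.WF := by simp [when]
@[simp] theorem wF_iter (x : ℕ) (p : LoopProg) : (iter x p).WF ↔ p.Keeps x ∧ p.WF := Iff.rfl
@[simp] theorem wF_seqs (l : List LoopProg) : (seqs l).WF ↔ ∀ p ∈ l, p.WF := by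
  induction l with
  | nil => simp [seqs]
  | cons p l ih => simp [seqs, ih]

/-- Store the value of `e` in each of the cells of array `a`; register `1` is the index. -/
def tabulate (a : ℕ) (e : Expr) : LoopProg := iter 1 (store a (.reg 1) e)

theorem tabulate_spec (a : ℕ) (e : Expr) (f : ℕ → ℕ) (s : State)
    (hf : ∀ i < s.reg 0, ∀ s' : State, s'.reg 1 = i → (∀ y, y ≠ 1 → s'.reg y = s.reg y) →
      (∀ b, b ≠ a → s'.arr b = s.arr b) → e.eval s' = f i) :
    ∀ i < s.reg 0, ((tabulate a e).run s).arr a i = f i := by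
  refine run_iter_induction
    (fun m s' => ∀ i < m, s'.arr a i = f i) (by simp) ?_
  intro m hm s' hs1 hr hb ih i hi
  simp only [run_store, State.setReg_arr, State.setArr_arr, true_and, Expr.eval, hs1]
  split_ifs with h
  · rw [h]
    exact hf m hm s' hs1 (fun y hy => hr y (by simpa using hy)) (fun b h => hb b (by simpa using h))
  · exact ih i (by omega)

/-- Multiply register `5` by the value of `e`. -/
def mulBy (e : Expr) : LoopProg :=
  seqs [assign 6 e, assign 7 (.reg 5), assign 5 (.const 0),
    iter 3 (seqs [
      when (.sub (.reg 6) (.add (.half (.reg 6)) (.half (.reg 6))))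
        (assign 5 (.add (.reg 5) (.reg 7))),
      assign 7 (.add (.reg 7) (.reg 7)),
      assign 6 (.half (.reg 6))])]

/-- Binary multiplication: register `5` plus the product of registers `6` and `7` is invariant, and
after as many rounds as `he` allows for, register `6` has been halved to zero. -/
theorem mulBy_spec (e : Expr) (s : State) (he : e.eval s < 2 ^ s.reg 0) :
    ((mulBy e).run s).reg 5 = s.reg 5 * e.eval s := by
  simp only [mulBy, run_seqs_cons, run_seqs_nil, run_assign]
  set s₁ := ((s.setReg 6 (e.eval s)).setReg 7 (Expr.eval (s.setReg 6 (e.eval s)) (.reg 5))).setReg 5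
    (Expr.eval ((s.setReg 6 (e.eval s)).setReg 7
      (Expr.eval (s.setReg 6 (e.eval s)) (.reg 5))) (.const 0)) with hs₁
  have h0 : s₁.reg 0 = s.reg 0 := by simp [hs₁]
  have := run_iter_induction (s := s₁) (x := 3) (p := seqs [
      when (.sub (.reg 6) (.add (.half (.reg 6)) (.half (.reg 6))))
        (assign 5 (.add (.reg 5) (.reg 7))),
      assign 7 (.add (.reg 7) (.reg 7)),
      assign 6 (.half (.reg 6))])
    (fun i s' => s'.reg 5 + s'.reg 7 * s'.reg 6 = s.reg 5 * e.eval s ∧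
      s'.reg 6 = e.eval s / 2 ^ i) (by simp [hs₁]) ?_
  · obtain ⟨h1, h2⟩ := this
    rw [h2, h0, Nat.div_eq_of_lt he] at h1
    simpa using h1
  · intro i _ s' _ _ _ ⟨h1, h2⟩
    have h3 : s'.reg 6 / 2 = e.eval s / 2 ^ (i + 1) := by
      rw [h2, Nat.div_div_eq_div_mul, pow_succ]
    by_cases hodd : s'.reg 6 - (s'.reg 6 / 2 + s'.reg 6 / 2) = 0
    · simp only [run_seqs_cons, run_seqs_nil, run_when, run_assign, Expr.eval, hodd, ne_eq,
        not_true_eq_false, if_false, State.setReg_reg]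
      norm_num
      refine ⟨?_, h3⟩
      rw [← h1]
      have : s'.reg 6 = 2 * (s'.reg 6 / 2) := by omega
      conv_rhs => rw [this]
      ring
    · simp only [run_seqs_cons, run_seqs_nil, run_when, run_assign, Expr.eval, hodd, ne_eq,
        not_false_eq_true, if_true, State.setReg_reg]
      norm_num
      refine ⟨?_, h3⟩
      rw [← h1]
      have : s'.reg 6 = 2 * (s'.reg 6 / 2) + 1 := by omega
      conv_rhs => rw [this]
      ring

theorem keeps_mulBy {y : ℕ} (e : Expr) (h : y ∉ [3, 5, 6, 7]) : (mulBy e).Keeps y := by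
  simp at h
  simp [mulBy]; omega

theorem keepsArr_mulBy (b : ℕ) (e : Expr) : (mulBy e).KeepsArr b := by simp [mulBy]

theorem wF_mulBy (e : Expr) : (mulBy e).WF := by simp [mulBy]

end LoopProg
end RAM

namespace RAM

/-! ### The algorithm

Register `0` holds the number of rounds of the loops. Array `0` holds the input, array `1` the best
packing so far, array `2` the scaled sizes, array `3` the classes, array `4` the current labels, and
array `5` the weights. Register `4` holds the scaled capacity, register `11` the value of the best
packing so far, and the registers from `20` on hold the parameters that are enumerated. -/

open LoopProg

/-- The numerator of the size of an item. -/
def numExpr (d : ℕ) (i : Expr) : Expr := .cell 0 (.add (.const 1) (.smul (d + 2) i))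

/-- The denominator of the size of an item. -/
def denExpr (d : ℕ) (i : Expr) : Expr := .cell 0 (.add (.const 2) (.smul (d + 2) i))

/-- The entry that tells whether an item occurs in scenario `k`. -/
def bitExpr (d k : ℕ) (i : Expr) : Expr := .cell 0 (.add (.const (3 + k)) (.smul (d + 2) i))

@[simp] theorem eval_numExpr (d : ℕ) (i : Expr) (s : State) :
    (numExpr d i).eval s = s.arr 0 (1 + (d + 2) * i.eval s) := by simp [numExpr]

@[simp] theorem eval_denExpr (d : ℕ) (i : Expr) (s : State) :
    (denExpr d i).eval s = s.arr 0 (2 + (d + 2) * i.eval s) := by simp [denExpr]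

@[simp] theorem eval_bitExpr (d k : ℕ) (i : Expr) (s : State) :
    (bitExpr d k i).eval s = s.arr 0 (3 + k + (d + 2) * i.eval s) := by simp [bitExpr]

/-- The scenarios of item `i` according to the input word. -/
def scenOf (d : ℕ) (A : ℕ → ℕ) (i : ℕ) : Finset (Fin d) :=
  {k | A (3 + k + (d + 2) * i) ≠ 0}

@[simp] theorem mem_scenOf {d : ℕ} {A : ℕ → ℕ} {i : ℕ} {k : Fin d} :
    k ∈ scenOf d A i ↔ A (3 + k + (d + 2) * i) ≠ 0 := by simp [scenOf]

/-- Multiply register `5` by the denominators of all items `j`, counted by register `2`, for which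
`c` is nonzero. -/
def mulDens (d : ℕ) (c : Expr) : LoopProg :=
  iter 2 (when (.sub (.cell 0 (.const 0)) (.reg 2)) (when c (mulBy (denExpr d (.reg 2)))))

theorem keeps_mulDens {y : ℕ} (d : ℕ) (c : Expr) (h : y ∉ [2, 3, 5, 6, 7]) :
    (mulDens d c).Keeps y := by
  simp at h
  simp only [mulDens, keeps_iter, keeps_when]
  exact ⟨by omega, keeps_mulBy _ (by simp; omega)⟩

theorem keepsArr_mulDens (b d : ℕ) (c : Expr) : (mulDens d c).KeepsArr b := by
  simp [mulDens, keepsArr_mulBy]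

/-- The loop overshoots the number of items, hence the guard in the program and the minimum in the
invariant. The condition `c` must not depend on the working registers of the multiplication, except
on the counter. -/
theorem mulDens_spec (d : ℕ) (c : Expr) (P : ℕ → Prop) [DecidablePred P] (s : State)
    (hn : s.arr 0 0 ≤ s.reg 0)
    (hden : ∀ j < s.arr 0 0, s.arr 0 (2 + (d + 2) * j) < 2 ^ s.reg 0)
    (hc : ∀ j < s.reg 0, ∀ s' : State, s'.reg 2 = j →
      (∀ y, y ∉ [2, 3, 5, 6, 7] → s'.reg y = s.reg y) → (c.eval s' ≠ 0 ↔ P j)) :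
    ((mulDens d c).run s).reg 5 =
      s.reg 5 * ∏ j ∈ Finset.range (s.arr 0 0) with P j, s.arr 0 (2 + (d + 2) * j) := by
  have key := run_iter_induction (s := s) (x := 2)
    (p := when (.sub (.cell 0 (.const 0)) (.reg 2)) (when c (mulBy (denExpr d (.reg 2)))))
    (fun m s' => s'.reg 5 = s.reg 5 *
      ∏ j ∈ Finset.range (min m (s.arr 0 0)) with P j, s.arr 0 (2 + (d + 2) * j))
    (by simp) ?_
  · rwa [min_eq_right hn] at key
  · intro m hm s' hs2 hr hb ih
    have hA : s'.arr 0 = s.arr 0 := hb 0 (by simp [keepsArr_mulBy])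
    have hr' : ∀ y, y ∉ [2, 3, 5, 6, 7] → s'.reg y = s.reg y := fun y hy =>
      hr y (keeps_mulDens d c hy)
    rw [State.setReg_reg, if_neg (by norm_num)]
    simp only [run_when, Expr.eval, hA, hs2, ne_eq]
    by_cases h1 : m < s.arr 0 0
    · rw [if_pos (by omega)]
      have h2 : min (m + 1) (s.arr 0 0) = min m (s.arr 0 0) + 1 := by omega
      have h3 : min m (s.arr 0 0) = m := by omega
      rw [h3] at ih
      rw [h2, h3, Finset.range_add_one, Finset.filter_insert]
      by_cases h4 : P m
      · rw [if_pos ((hc m hm s' hs2 hr').2 h4), if_pos h4, Finset.prod_insert (by simp),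
          mulBy_spec _ _ ?_, ih]
        · simp only [eval_denExpr, hA, Expr.eval, hs2]
          ring
        · simp only [eval_denExpr, hA, Expr.eval, hs2]
          rw [hr' 0 (by simp)]
          exact hden m h1
      · rw [if_neg (fun h => h4 ((hc m hm s' hs2 hr').1 h)), if_neg h4, ih]
    · rw [if_neg (by omega), ih, min_eq_right (by omega), min_eq_right (by omega)]

/-- Compute the scaled capacity and the scaled sizes. -/
def scale (d : ℕ) : LoopProg :=
  seqs [assign 5 (.const 1), mulDens d (.const 1), assign 4 (.reg 5),
    iter 1 (seqs [assign 5 (numExpr d (.reg 1)),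
      mulDens d (.add (.sub (.reg 1) (.reg 2)) (.sub (.reg 2) (.reg 1))),
      store 2 (.reg 1) (.reg 5)])]

/-- Scaling by the product of all denominators makes capacity and sizes integral; without division,
the scaled size is computed as the numerator times the other denominators. -/
theorem scale_spec (d : ℕ) (s : State) (hn : s.arr 0 0 ≤ s.reg 0)
    (hden : ∀ j < s.arr 0 0, s.arr 0 (2 + (d + 2) * j) < 2 ^ s.reg 0) :
    ((scale d).run s).reg 4 = ∏ j ∈ Finset.range (s.arr 0 0), s.arr 0 (2 + (d + 2) * j) ∧
    ∀ i < s.reg 0, ((scale d).run s).arr 2 i = s.arr 0 (1 + (d + 2) * i) *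
      ∏ j ∈ Finset.range (s.arr 0 0) with j ≠ i, s.arr 0 (2 + (d + 2) * j) := by
  simp only [scale, run_seqs_cons, run_seqs_nil, run_assign, Expr.eval]
  set s₁ := (mulDens d (.const 1)).run (s.setReg 5 1) with hs₁
  have h1 : s₁.reg 5 = ∏ j ∈ Finset.range (s.arr 0 0), s.arr 0 (2 + (d + 2) * j) := by
    rw [hs₁, mulDens_spec d _ (fun _ => True)]
    · simp
    · simpa using hn
    · simpa using hden
    · simp
  have h2 : s₁.arr 0 = s.arr 0 := run_arr (keepsArr_mulDens _ _ _) _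
  have h3 : s₁.reg 0 = s.reg 0 := run_reg (keeps_mulDens _ _ (by simp)) _
  set s₂ := s₁.setReg 4 (s₁.reg 5) with hs₂
  have h4 : s₂.reg 0 = s.reg 0 := by simp [hs₂, h3]
  constructor
  · rw [run_reg]
    · simpa [hs₂] using h1
    · simp only [keeps_iter, keeps_seqs, List.forall_mem_cons]
      exact ⟨by simp, by simp, keeps_mulDens _ _ (by simp), by simp, by simp⟩
  · have key := run_iter_induction (s := s₂) (x := 1)
      (p := seqs [assign 5 (numExpr d (.reg 1)),
        mulDens d (.add (.sub (.reg 1) (.reg 2)) (.sub (.reg 2) (.reg 1))),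
        store 2 (.reg 1) (.reg 5)])
      (fun m s' => ∀ i < m, s'.arr 2 i = s.arr 0 (1 + (d + 2) * i) *
        ∏ j ∈ Finset.range (s.arr 0 0) with j ≠ i, s.arr 0 (2 + (d + 2) * j)) (by simp) ?_
    · rwa [h4] at key
    · intro m hm s' hs1 hr hb ih i hi
      have hA : s'.arr 0 = s.arr 0 := by
        rw [hb 0 (by simp [keepsArr_mulDens]), ← h2]; rfl
      have h0 : s'.reg 0 = s.reg 0 := by
        rw [hr 0, h4]
        simp only [keeps_iter, keeps_seqs, List.forall_mem_cons]
        exact ⟨by simp, by simp, keeps_mulDens _ _ (by simp), by simp, by simp⟩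
      simp only [run_seqs_cons, run_seqs_nil, run_assign, run_store, State.setReg_arr,
        State.setArr_arr, true_and, Expr.eval, eval_numExpr, hs1]
      rw [run_reg (keeps_mulDens _ _ (by simp)), mulDens_spec d _ (fun j => j ≠ m),
        run_arr (keepsArr_mulDens _ _ _)]
      · simp only [State.setReg_reg, State.setReg_arr, hA, hs1]
        norm_num
        by_cases h : i = m
        · simp [h]
        · rw [if_neg h]
          exact ih i (by omega)
      · simpa [hA, h0] using hn
      · simpa [hA, h0] using hden
      · intro j _ s'' h1 h2
        have := h2 1 (by simp)
        simp only [State.setReg_reg, hs1] at this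
        simp only [Expr.eval, h1, this]
        norm_num
        omega

theorem keepsArr_scale (d b : ℕ) (hb : b ≠ 2) : (scale d).KeepsArr b := by
  simp [scale, keepsArr_mulDens, hb]

theorem keeps_scale (d y : ℕ) (hy : y ∉ [1, 2, 3, 4, 5, 6, 7]) : (scale d).Keeps y := by
  simp at hy
  have h := keeps_mulDens (y := y) d
  simp at h
  simp only [scale, keeps_seqs, List.forall_mem_cons, keeps_iter, keeps_assign, keeps_store]
  refine ⟨by omega, h _ (by omega) (by omega) (by omega) (by omega) (by omega), by omega,
    ⟨by omega, by omega, h _ (by omega) (by omega) (by omega) (by omega) (by omega), by simp⟩,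
    by simp⟩

theorem wF_mulDens (d : ℕ) (c : Expr) : (mulDens d c).WF := by
  simp only [mulDens, wF_iter, keeps_when, wF_when]
  exact ⟨keeps_mulBy _ (by simp), wF_mulBy _⟩

theorem wF_scale (d : ℕ) : (scale d).WF := by
  simp only [scale, wF_seqs, keeps_seqs, List.forall_mem_cons, wF_iter, keeps_assign, keeps_store]
  exact ⟨trivial, wF_mulDens _ _, trivial,
    ⟨⟨by simp, keeps_mulDens _ _ (by simp), by simp⟩, trivial, wF_mulDens _ _, by simp⟩, by simp⟩

/-- Compute the weights: the size of a small item and the capacity for a large one. -/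
def weigh (q : ℕ) : LoopProg :=
  iter 1 (branch (.le (.smul q (.cell 2 (.reg 1))) (.reg 4))
    (store 5 (.reg 1) (.cell 2 (.reg 1))) (store 5 (.reg 1) (.reg 4)))

theorem weigh_spec (q : ℕ) (s : State) : ∀ i < s.reg 0, ((weigh q).run s).arr 5 i =
    if q * s.arr 2 i ≤ s.reg 4 then s.arr 2 i else s.reg 4 := by
  refine run_iter_induction
    (fun m s' => ∀ i < m, s'.arr 5 i = if q * s.arr 2 i ≤ s.reg 4 then s.arr 2 i else s.reg 4)
    (by simp) ?_
  intro m hm s' hs1 hr hb ih i hi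
  have hA : s'.arr 2 = s.arr 2 := hb 2 (by simp)
  have h4 : s'.reg 4 = s.reg 4 := hr 4 (by simp)
  simp only [run_branch, Expr.eval_le, Expr.eval_smul, Expr.eval, run_store, hA, h4, hs1,
    State.setReg_arr]
  by_cases h : i = m
  · subst h
    by_cases h5 : q * s.arr 2 i ≤ s.reg 4 <;> simp [h5]
  · have := ih i (by omega)
    by_cases h5 : q * s.arr 2 m ≤ s.reg 4 <;> simp [h5, h, this]

/-- The class of item `i`: its scenarios are encoded together with the number of those of the `J`
thresholds that it does not exceed, or with `J + 1` if the item is small. -/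
def classOf (d J q D : ℕ) (A a τ : ℕ → ℕ) (i : ℕ) : ℕ :=
  (if q * a i ≤ D then J + 1 else ((Finset.range J).filter fun m => a i ≤ a (τ m)).card) +
    (J + 2) * ∑ k ∈ scenOf d A i, 2 ^ (k : ℕ)

/-- The expression for the class of the item in register `1`. -/
def classExpr (d J q : ℕ) : Expr :=
  let sm : Expr := .smul (J + 1) (.le (.smul q (.cell 2 (.reg 1))) (.reg 4))
  .add (.add sm (.sub (.sum ((List.range J).map fun m =>
      .le (.cell 2 (.reg 1)) (.cell 2 (.reg (20 + m))))) sm))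
    (.smul (J + 2) (.sum ((List.finRange d).map fun k : Fin d =>
      .smul (2 ^ (k : ℕ)) (.nonzero (bitExpr d k (.reg 1))))))

/-- Truncated subtraction replaces a case distinction: `sm` is `J + 1` or `0`, and the number of
thresholds is at most `J`, so `sm + (count - sm)` is `J + 1` or the count. -/
theorem eval_classExpr (d J q : ℕ) (s : State) : (classExpr d J q).eval s =
    classOf d J q (s.reg 4) (s.arr 0) (s.arr 2) (fun m => s.reg (20 + m)) (s.reg 1) := by
  have h1 : (Expr.sum ((List.range J).map fun m =>
      .le (.cell 2 (.reg 1)) (.cell 2 (.reg (20 + m))))).eval s =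
      ((Finset.range J).filter fun m => s.arr 2 (s.reg 1) ≤ s.arr 2 (s.reg (20 + m))).card := by
    rw [Expr.eval_sum, List.map_map, Finset.card_filter]
    exact congrArg List.sum (List.map_congr_left fun m _ => Expr.eval_le _ _ _)
  have h2 : (Expr.sum ((List.finRange d).map fun k : Fin d =>
      .smul (2 ^ (k : ℕ)) (.nonzero (bitExpr d k (.reg 1))))).eval s =
      ∑ k ∈ scenOf d (s.arr 0) (s.reg 1), 2 ^ (k : ℕ) := by
    rw [scenOf, Finset.sum_filter, Expr.eval_sum, List.map_map, ← List.ofFn_eq_map, List.sum_ofFn]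
    refine Finset.sum_congr rfl fun k _ => ?_
    simp
  have h3 : ((Finset.range J).filter fun m =>
      s.arr 2 (s.reg 1) ≤ s.arr 2 (s.reg (20 + m))).card ≤ J := by
    simpa using Finset.card_filter_le (Finset.range J) fun m =>
      s.arr 2 (s.reg 1) ≤ s.arr 2 (s.reg (20 + m))
  simp only [classExpr, Expr.eval, Expr.eval_smul, Expr.eval_le, classOf, h1, h2]
  split_ifs <;> omega

/-- Compute the classes. -/
def classify (d J q : ℕ) : LoopProg := tabulate 3 (classExpr d J q)

theorem classify_spec (d J q : ℕ) (s : State) : ∀ i < s.reg 0, ((classify d J q).run s).arr 3 i =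
    classOf d J q (s.reg 4) (s.arr 0) (s.arr 2) (fun m => s.reg (20 + m)) i := by
  refine tabulate_spec 3 _ _ s fun i _ s' h1 h2 h3 => ?_
  rw [eval_classExpr, h1, h2 4 (by simp), h3 0 (by simp), h3 2 (by simp)]
  congr 1
  funext m
  exact h2 _ (by omega)

end RAM

/-! ### Filling slots and opening bins by programs -/

namespace RAM

open LoopProg BPPS

/-- Fill a slot of class `κ`: give the label in register `9` to unlabelled items of the class until
their weight, accumulated in register `8`, is too large. -/
def slot (h κ : ℕ) : LoopProg :=
  seqs [assign 8 (.const 0),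
    iter 1 (when (.eq (.cell 3 (.reg 1)) (.const κ)) (when (.eq (.cell 4 (.reg 1)) (.const 0))
      (when (.le (.smul (2 * h) (.reg 8)) (.reg 4)) (seqs [store 4 (.reg 1) (.reg 9),
        assign 8 (.add (.reg 8) (.cell 5 (.reg 1)))]))))]

/-- One pass over the items suffices: once the accumulated weight is too large, the test fails for
the rest of the pass, and until then every free item of the class is taken. -/
theorem slot_spec (h κ : ℕ) (s : State) :
    ∃ F ⊆ {i ∈ Finset.range (s.reg 0) | s.arr 3 i = κ ∧ s.arr 4 i = 0},
      (∀ i, ((slot h κ).run s).arr 4 i = if i ∈ F then s.reg 9 else s.arr 4 i) ∧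
      (F = {i ∈ Finset.range (s.reg 0) | s.arr 3 i = κ ∧ s.arr 4 i = 0} ∨
        s.reg 4 < 2 * h * ∑ i ∈ F, s.arr 5 i) ∧
      (F = ∅ ∨ ∃ i₀ ∈ F, 2 * h * ∑ i ∈ F.erase i₀, s.arr 5 i ≤ s.reg 4) := by
  simp only [slot, run_seqs_cons, run_seqs_nil, run_assign, Expr.eval]
  have key := run_iter_induction (s := s.setReg 8 0) (x := 1)
    (p := when (.eq (.cell 3 (.reg 1)) (.const κ)) (when (.eq (.cell 4 (.reg 1)) (.const 0))
      (when (.le (.smul (2 * h) (.reg 8)) (.reg 4)) (seqs [store 4 (.reg 1) (.reg 9),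
        assign 8 (.add (.reg 8) (.cell 5 (.reg 1)))]))))
    (fun m s' => ∃ F ⊆ {i ∈ Finset.range m | s.arr 3 i = κ ∧ s.arr 4 i = 0},
      (∀ i, s'.arr 4 i = if i ∈ F then s.reg 9 else s.arr 4 i) ∧
      (F = {i ∈ Finset.range m | s.arr 3 i = κ ∧ s.arr 4 i = 0} ∨
        s.reg 4 < 2 * h * ∑ i ∈ F, s.arr 5 i) ∧
      (F = ∅ ∨ ∃ i₀ ∈ F, 2 * h * ∑ i ∈ F.erase i₀, s.arr 5 i ≤ s.reg 4) ∧
      s'.reg 8 = ∑ i ∈ F, s.arr 5 i)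
    ⟨∅, by simp⟩ ?_
  · obtain ⟨F, h1, h2, h3, h4, -⟩ := key
    exact ⟨F, by simpa using h1, h2, by simpa using h3, h4⟩
  · rintro m hm s' hs1 hr hb ⟨F, h1, h2, h3, h4, h5⟩
    have hA3 : s'.arr 3 = s.arr 3 := hb 3 (by simp)
    have hA5 : s'.arr 5 = s.arr 5 := hb 5 (by simp)
    have hr4 : s'.reg 4 = s.reg 4 := hr 4 (by simp)
    have hr9 : s'.reg 9 = s.reg 9 := hr 9 (by simp)
    have hmF : m ∉ F := fun hm => by simpa using h1 hm
    have h4m : s'.arr 4 m = s.arr 4 m := by rw [h2, if_neg hmF]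
    simp only [run_when, Expr.eval_eq, Expr.eval_le, Expr.eval_smul, Expr.eval, hA3, hr4, hs1, h4m,
      h5, run_seqs_cons, run_seqs_nil, run_store, run_assign, hr9]
    rw [Finset.range_add_one, Finset.filter_insert]
    by_cases hc : s.arr 3 m = κ ∧ s.arr 4 m = 0
    · obtain ⟨hc1, hc2⟩ := hc
      by_cases hc3 : 2 * h * ∑ i ∈ F, s.arr 5 i ≤ s.reg 4
      · refine ⟨insert m F, ?_, fun i => ?_, ?_, ?_, ?_⟩
        · rw [if_pos ⟨hc1, hc2⟩]
          exact Finset.insert_subset_insert _ h1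
        · by_cases him : i = m
          · simp [hc1, hc2, hc3, him]
          · simp [hc1, hc2, hc3, him, h2]
        · left
          rw [if_pos ⟨hc1, hc2⟩]
          rcases h3 with h3 | h3
          · rw [h3]
          · exact absurd hc3 h3.not_ge
        · right
          exact ⟨m, Finset.mem_insert_self _ _, by rwa [Finset.erase_insert hmF]⟩
        · rw [Finset.sum_insert hmF]
          simp [hc1, hc2, hc3, hA5, h5, hs1, add_comm]
      · refine ⟨F, ?_, fun i => ?_, Or.inr (not_le.1 hc3), h4, ?_⟩
        · rw [if_pos ⟨hc1, hc2⟩]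
          exact h1.trans (Finset.subset_insert _ _)
        · simp [hc3, h2]
        · simp [hc3, h5]
    · rw [if_neg hc]
      refine ⟨F, h1, fun i => ?_, h3, h4, ?_⟩
      · by_cases hc1 : s.arr 3 m = κ
        · simp [hc1, show s.arr 4 m ≠ 0 from fun h => hc ⟨hc1, h⟩, h2]
        · simp [hc1, h2]
      · by_cases hc1 : s.arr 3 m = κ
        · simp [hc1, show s.arr 4 m ≠ 0 from fun h => hc ⟨hc1, h⟩, h5]
        · simp [hc1, h5]

/-- The labels of the items; everything beyond is cut off. -/
def labels (s : State) (i : ℕ) : ℕ := if i < s.reg 0 then s.arr 4 i else 0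

/-- The classes and weights in the state `s` are those of `S`. -/
structure Matches {d : ℕ} (S : Classified d) (h : ℕ) (s : State) : Prop where
  h_pos : 0 < h
  cap_pos : 0 < s.reg 4
  U_eq : S.U = Finset.range (s.reg 0)
  cls_eq : ∀ i < s.reg 0, S.cls i = s.arr 3 i
  weight_eq : ∀ i < s.reg 0, S.weight i = s.arr 5 i / s.reg 4
  η_eq : S.η = 1 / (2 * h)

theorem Matches.run {d : ℕ} {S : Classified d} {h : ℕ} {s : State} (hs : Matches S h s)
    {p : LoopProg} (h0 : p.Keeps 0) (h4 : p.Keeps 4) (h3 : p.KeepsArr 3) (h5 : p.KeepsArr 5) :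
    Matches S h (p.run s) := by
  constructor
  · exact hs.h_pos
  · rw [run_reg h4]; exact hs.cap_pos
  · rw [run_reg h0]; exact hs.U_eq
  · rw [run_reg h0, run_arr h3]; exact hs.cls_eq
  · rw [run_reg h0, run_arr h5, run_reg h4]; exact hs.weight_eq
  · exact hs.η_eq

theorem Matches.fill {d : ℕ} {S : Classified d} {h : ℕ} {s : State} (hs : Matches S h s) (κ : ℕ) :
    S.Fill κ (s.reg 9) (labels s) (labels ((slot h κ).run s)) := by
  obtain ⟨F, h1, h2, h3, h4⟩ := slot_spec h κ s
  have h0 : ((slot h κ).run s).reg 0 = s.reg 0 := run_reg (by simp [slot]) s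
  have hfree : S.free κ (labels s) =
      {i ∈ Finset.range (s.reg 0) | s.arr 3 i = κ ∧ s.arr 4 i = 0} := by
    rw [Classified.free, hs.U_eq]
    refine Finset.filter_congr fun i hi => ?_
    have hi' := Finset.mem_range.1 hi
    rw [hs.cls_eq i hi', labels, if_pos hi']
  have hF : ∀ i ∈ F, i < s.reg 0 := fun i hi => by
    have := h1 hi
    simp only [Finset.mem_filter, Finset.mem_range] at this
    exact this.1
  have hD : (0 : ℚ) < s.reg 4 := by exact_mod_cast hs.cap_pos
  have hh : (0 : ℚ) < h := by exact_mod_cast hs.h_pos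
  have hw : ∀ X ⊆ F, ∑ i ∈ X, S.weight i = ((∑ i ∈ X, s.arr 5 i : ℕ) : ℚ) / s.reg 4 := by
    intro X hX
    rw [Nat.cast_sum, Finset.sum_div]
    exact Finset.sum_congr rfl fun i hi => hs.weight_eq i (hF i (hX hi))
  refine ⟨F, hfree ▸ h1, fun i => ?_, ?_, ?_⟩
  · by_cases hi : i ∈ F
    · simp [labels, h0, hF i hi, h2, hi]
    · simp [labels, h0, h2, hi]
  · rw [hfree]
    refine h3.imp_right fun h3 => ?_
    rw [hw F subset_rfl, hs.η_eq, div_lt_div_iff₀ (by positivity) hD]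
    have : (s.reg 4 : ℚ) < 2 * h * (∑ i ∈ F, s.arr 5 i : ℕ) := by exact_mod_cast h3
    linarith
  · refine h4.imp_right fun ⟨i₀, hi₀, h4⟩ => ⟨i₀, hi₀, ?_⟩
    rw [hw _ (Finset.erase_subset _ _), hs.η_eq, div_le_div_iff₀ hD (by positivity)]
    have : 2 * (h : ℚ) * (∑ i ∈ F.erase i₀, s.arr 5 i : ℕ) ≤ s.reg 4 := by exact_mod_cast h4
    linarith

theorem keeps_slot {y : ℕ} (h κ : ℕ) (hy : y ≠ 1 ∧ y ≠ 8) : (slot h κ).Keeps y := by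
  simp [slot, hy]

theorem keepsArr_slot {b : ℕ} (h κ : ℕ) (hb : b ≠ 4) : (slot h κ).KeepsArr b := by
  simp [slot, hb]

theorem Matches.fills_slots {d : ℕ} {S : Classified d} {h : ℕ} (c : List ℕ) :
    ∀ {s : State}, Matches S h s → S.Fills (c.map fun κ => (κ, s.reg 9)) (labels s)
      (labels ((seqs (c.map (slot h))).run s)) := by
  induction c with
  | nil => exact fun _ => .nil _
  | cons κ c ih =>
    intro s hs
    refine .cons (hs.fill κ) ?_
    have h9 : ((slot h κ).run s).reg 9 = s.reg 9 := run_reg (keeps_slot _ _ (by simp)) s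
    rw [← h9]
    exact ih (hs.run (keeps_slot _ _ (by simp)) (keeps_slot _ _ (by simp))
      (keepsArr_slot _ _ (by simp)) (keepsArr_slot _ _ (by simp)))

/-- Open a new bin and fill slots of the given classes. -/
def openBin (h : ℕ) (c : List ℕ) : LoopProg :=
  seq (assign 9 (.add (.reg 9) (.const 1))) (seqs (c.map (slot h)))

theorem keeps_openBin {y : ℕ} (h : ℕ) (c : List ℕ) (hy : y ≠ 1 ∧ y ≠ 8 ∧ y ≠ 9) :
    (openBin h c).Keeps y := by
  simp only [openBin, keeps_seq, keeps_assign, keeps_seqs, List.forall_mem_map]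
  exact ⟨hy.2.2, fun κ _ => keeps_slot _ _ ⟨hy.1, hy.2.1⟩⟩

theorem keepsArr_openBin {b : ℕ} (h : ℕ) (c : List ℕ) (hb : b ≠ 4) :
    (openBin h c).KeepsArr b := by
  simp only [openBin, keepsArr_seq, keepsArr_assign, keepsArr_seqs, List.forall_mem_map, true_and]
  exact fun κ _ => keepsArr_slot _ _ hb

theorem wF_openBin (h : ℕ) (c : List ℕ) : (openBin h c).WF := by
  simp [openBin, slot]

theorem Matches.openBin {d : ℕ} {S : Classified d} {h : ℕ} {s : State} (hs : Matches S h s)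
    (c : List ℕ) : S.Fills (c.map fun κ => (κ, s.reg 9 + 1)) (labels s)
      (labels ((openBin h c).run s)) ∧ ((openBin h c).run s).reg 9 = s.reg 9 + 1 := by
  have h1 := (hs.run (p := assign 9 (.add (.reg 9) (.const 1))) (by simp) (by simp) (by simp)
    (by simp)).fills_slots c
  constructor
  · have h2 : labels ((assign 9 (.add (.reg 9) (.const 1))).run s) = labels s := by
      funext i; simp [labels]
    rw [h2] at h1
    simpa [RAM.openBin] using h1
  · rw [RAM.openBin, run_seq, run_reg]
    · simp
    · simp only [keeps_seqs, List.forall_mem_map]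
      exact fun κ _ => keeps_slot _ _ (by simp)

/-- Open as many bins with the slots `c` as register `x` says. -/
def openBins (h x : ℕ) (c : List ℕ) : LoopProg :=
  iter 10 (when (.sub (.reg x) (.reg 10)) (openBin h c))

theorem keeps_openBins {y : ℕ} (h x : ℕ) (c : List ℕ) (hy : y ∉ [1, 8, 9, 10]) :
    (openBins h x c).Keeps y := by
  simp at hy
  simp only [openBins, keeps_iter, keeps_when]
  exact ⟨hy.2.2.2, keeps_openBin _ _ ⟨hy.1, hy.2.1, hy.2.2.1⟩⟩

theorem keepsArr_openBins {b : ℕ} (h x : ℕ) (c : List ℕ) (hb : b ≠ 4) :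
    (openBins h x c).KeepsArr b := by
  simp only [openBins, keepsArr_iter, keepsArr_when]
  exact keepsArr_openBin _ _ hb

theorem wF_openBins (h x : ℕ) (c : List ℕ) : (openBins h x c).WF := by
  simp only [openBins, wF_iter, wF_when, keeps_when]
  exact ⟨keeps_openBin _ _ (by simp), wF_openBin _ _⟩

/-- The loop always makes all its rounds and the guard silences the superfluous ones, hence the
minimum in the invariant. The bound `20 ≤ x` protects the multiplicity from being overwritten. -/
theorem Matches.openBins {d : ℕ} {S : Classified d} {h : ℕ} {s : State} (hs : Matches S h s)
    {x : ℕ} (hx : 20 ≤ x) (hxs : s.reg x ≤ s.reg 0) (c : List ℕ) :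
    S.Fills (Classified.numbered (s.reg 9 + 1) (List.replicate (s.reg x) c)) (labels s)
      (labels ((openBins h x c).run s)) ∧
    ((openBins h x c).run s).reg 9 = s.reg 9 + s.reg x := by
  have key := run_iter_induction (s := s) (x := 10)
    (p := when (.sub (.reg x) (.reg 10)) (RAM.openBin h c))
    (fun m s' => S.Fills (Classified.numbered (s.reg 9 + 1)
        (List.replicate (min m (s.reg x)) c)) (labels s) (labels s') ∧
      s'.reg 9 = s.reg 9 + min m (s.reg x)) ?_ ?_
  · rwa [min_eq_right hxs] at key
  · have : labels (s.setReg 10 0) = labels s := by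
      funext i; simp [labels]
    simpa [this, Classified.numbered] using Classified.Fills.nil (S := S) (labels s)
  · rintro m hm s' hs1 hr hb ⟨h1, h2⟩
    have hr' : ∀ y, y ∉ [1, 8, 9, 10] → s'.reg y = s.reg y := fun y hy =>
      hr y (keeps_openBins h x c hy)
    have hb' : ∀ b, b ≠ 4 → s'.arr b = s.arr b := fun b hy =>
      hb b (by simpa using keepsArr_openBin h c hy)
    have hs' : Matches S h s' := by
      constructor
      · exact hs.h_pos
      · rw [hr' 4 (by simp)]; exact hs.cap_pos
      · rw [hr' 0 (by simp)]; exact hs.U_eq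
      · rw [hr' 0 (by simp), hb' 3 (by simp)]; exact hs.cls_eq
      · rw [hr' 0 (by simp), hb' 5 (by simp), hr' 4 (by simp)]; exact hs.weight_eq
      · exact hs.η_eq
    have hlab : ∀ s'' : State, labels (s''.setReg 10 (m + 1)) = labels s'' := fun s'' => by
      funext i; simp [labels]
    have h9 : ∀ s'' : State, (s''.setReg 10 (m + 1)).reg 9 = s''.reg 9 := fun s'' => by simp
    have hx' : s'.reg x = s.reg x := hr' x (by simp; omega)
    simp only [run_when, Expr.eval, hx', hs1]
    rw [hlab, h9]
    by_cases hc : m < s.reg x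
    · rw [if_pos (by omega), min_eq_left (by omega)]
      rw [min_eq_left hc.le] at h1 h2
      obtain ⟨h3, h4⟩ := hs'.openBin c
      refine ⟨?_, by omega⟩
      rw [List.replicate_succ', Classified.numbered_append]
      refine h1.append ?_
      rw [h2] at h3
      simpa [Classified.numbered, add_right_comm] using h3
    · rw [if_neg (by omega), min_eq_right (by omega)]
      rw [min_eq_right (by omega)] at h1 h2
      exact ⟨h1, h2⟩

/-- Open bins of several kinds, each given by a register for their number and by their slots. -/
def pack (h : ℕ) (l : List (ℕ × List ℕ)) : LoopProg := seqs (l.map fun o => openBins h o.1 o.2)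

theorem keeps_pack {y : ℕ} (h : ℕ) (l : List (ℕ × List ℕ)) (hy : y ∉ [1, 8, 9, 10]) :
    (pack h l).Keeps y := by
  simp only [pack, keeps_seqs, List.forall_mem_map]
  exact fun o _ => keeps_openBins _ _ _ hy

theorem keepsArr_pack {b : ℕ} (h : ℕ) (l : List (ℕ × List ℕ)) (hb : b ≠ 4) :
    (pack h l).KeepsArr b := by
  simp only [pack, keepsArr_seqs, List.forall_mem_map]
  exact fun o _ => keepsArr_openBins _ _ _ hb

theorem wF_pack (h : ℕ) (l : List (ℕ × List ℕ)) : (pack h l).WF := by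
  simp only [pack, wF_seqs, List.forall_mem_map]
  exact fun o _ => wF_openBins _ _ _

theorem Matches.pack {d : ℕ} {S : Classified d} {h : ℕ} (l : List (ℕ × List ℕ)) :
    ∀ {s : State}, Matches S h s → (∀ o ∈ l, 20 ≤ o.1 ∧ s.reg o.1 ≤ s.reg 0) →
    S.Fills (Classified.numbered (s.reg 9 + 1) (l.flatMap fun o => List.replicate (s.reg o.1) o.2))
      (labels s) (labels ((pack h l).run s)) := by
  induction l with
  | nil => exact fun _ _ => .nil _
  | cons o l ih =>
    intro s hs hl
    obtain ⟨ho1, ho2⟩ := hl o List.mem_cons_self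
    obtain ⟨h1, h2⟩ := hs.openBins ho1 ho2 o.2
    have hr : ∀ y, y ∉ [1, 8, 9, 10] → ((RAM.openBins h o.1 o.2).run s).reg y = s.reg y :=
      fun y hy => run_reg (keeps_openBins _ _ _ hy) s
    have hr' : ∀ o' ∈ l, ((RAM.openBins h o.1 o.2).run s).reg o'.1 = s.reg o'.1 := fun o' ho' => by
      have := (hl o' (List.mem_cons_of_mem _ ho')).1
      exact hr _ (by simp; omega)
    rw [List.flatMap_cons, Classified.numbered_append]
    refine h1.append ?_
    have h3 := ih (hs.run (keeps_openBins h o.1 o.2 (by simp)) (keeps_openBins h o.1 o.2 (by simp))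
      (keepsArr_openBins h o.1 o.2 (by simp)) (keepsArr_openBins h o.1 o.2 (by simp)))
      (fun o' ho' => by
        rw [hr' o' ho', hr 0 (by simp)]
        exact hl o' (List.mem_cons_of_mem _ ho'))
    rw [h2] at h3
    have h4 : (l.flatMap fun o' => List.replicate (((RAM.openBins h o.1 o.2).run s).reg o'.1) o'.2) =
        l.flatMap fun o' => List.replicate (s.reg o'.1) o'.2 :=
      List.flatMap_congr fun o' ho' => by rw [hr' o' ho']
    rw [h4] at h3
    rw [List.length_replicate, add_right_comm]
    exact h3

end RAM

/-! ### Checking a labeling, keeping the best, enumerating parameters -/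

namespace RAM

open LoopProg BPPS

/-- The total scaled size of the items of scenario `k` with label `b`. -/
def natLoad (d N : ℕ) (A a L : ℕ → ℕ) (b : ℕ) (k : Fin d) : ℕ :=
  ∑ i ∈ Finset.range N with L i = b ∧ k ∈ scenOf d A i, a i

/-- Compute the load (in register `15`) of the label in register `2` in scenario `k`, and whether
the label is used there (in register `16`). -/
def inspect (d k : ℕ) : LoopProg :=
  iter 1 (when (.eq (.cell 4 (.reg 1)) (.reg 2)) (when (bitExpr d k (.reg 1))
    (seqs [assign 15 (.add (.reg 15) (.cell 2 (.reg 1))), assign 16 (.const 1)])))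

theorem inspect_spec (d : ℕ) (k : Fin d) (s : State) (h15 : s.reg 15 = 0) (h16 : s.reg 16 = 0) :
    ((inspect d k).run s).reg 15 =
      natLoad d (s.reg 0) (s.arr 0) (s.arr 2) (s.arr 4) (s.reg 2) k ∧
    ((inspect d k).run s).reg 16 =
      if s.reg 2 ∈ used (Finset.range (s.reg 0)) (scenOf d (s.arr 0)) (s.arr 4) k then 1 else 0 := by
  refine run_iter_induction
    (fun m s' => s'.reg 15 = natLoad d m (s.arr 0) (s.arr 2) (s.arr 4) (s.reg 2) k ∧
      s'.reg 16 = if s.reg 2 ∈ used (Finset.range m) (scenOf d (s.arr 0)) (s.arr 4) k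
        then 1 else 0) (by simp [h15, h16, natLoad, used]) ?_
  rintro m hm s' hs1 hr hb ⟨h1, h2⟩
  have hA0 : s'.arr 0 = s.arr 0 := hb 0 (by simp)
  have hA2 : s'.arr 2 = s.arr 2 := hb 2 (by simp)
  have hA4 : s'.arr 4 = s.arr 4 := hb 4 (by simp)
  have hr2 : s'.reg 2 = s.reg 2 := hr 2 (by simp)
  simp only [run_when, Expr.eval_eq, eval_bitExpr, Expr.eval, hA0, hA4, hr2, hs1, run_seqs_cons,
    run_seqs_nil, run_assign]
  have hused : s.reg 2 ∈ used (Finset.range (m + 1)) (scenOf d (s.arr 0)) (s.arr 4) k ↔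
      (s.arr 4 m = s.reg 2 ∧ k ∈ scenOf d (s.arr 0) m) ∨
        s.reg 2 ∈ used (Finset.range m) (scenOf d (s.arr 0)) (s.arr 4) k := by
    simp only [used, Finset.mem_image, Finset.mem_filter, Finset.mem_range, Nat.lt_succ_iff_lt_or_eq]
    constructor
    · rintro ⟨i, ⟨h3 | rfl, h4⟩, h5⟩
      · exact Or.inr ⟨i, ⟨h3, h4⟩, h5⟩
      · exact Or.inl ⟨h5, h4⟩
    · rintro (⟨h5, h4⟩ | ⟨i, ⟨h3, h4⟩, h5⟩)
      · exact ⟨m, ⟨Or.inr rfl, h4⟩, h5⟩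
      · exact ⟨i, ⟨Or.inl h3, h4⟩, h5⟩
  have hload : natLoad d (m + 1) (s.arr 0) (s.arr 2) (s.arr 4) (s.reg 2) k =
      natLoad d m (s.arr 0) (s.arr 2) (s.arr 4) (s.reg 2) k +
        if s.arr 4 m = s.reg 2 ∧ k ∈ scenOf d (s.arr 0) m then s.arr 2 m else 0 := by
    rw [natLoad, Finset.sum_filter, Finset.sum_range_succ, ← Finset.sum_filter]; rfl
  rw [hload]
  simp only [hused]
  by_cases hc1 : s.arr 4 m = s.reg 2
  · by_cases hc2 : k ∈ scenOf d (s.arr 0) m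
    · have hc3 := mem_scenOf.1 hc2
      simp [hc1, hc2, hc3, h1, hA2]
    · have hc3 : s.arr 0 (3 + k + (d + 2) * m) = 0 := by simpa using hc2
      simp [hc1, hc2, hc3, h1, h2]
  · simp [hc1, h1, h2]

theorem forall_lt_and_iff {P : ℕ → Prop} {m : ℕ} :
    ((∀ i < m, P i) ∧ P m) ↔ ∀ i ≤ m, P i := by
  refine ⟨fun h i hi => ?_, fun h => ⟨fun i hi => h i hi.le, h m le_rfl⟩⟩
  rcases hi.lt_or_eq with hi | rfl
  · exact h.1 i hi
  · exact h.2

/-- Evaluate the labeling in scenario `k`: update the infeasibility in register `12` and the value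
in register `13`. -/
def evaluateScen (d k : ℕ) : LoopProg :=
  seqs [assign 14 (.const 0),
    iter 2 (seqs [assign 15 (.const 0), assign 16 (.const 0), inspect d k,
      assign 12 (.add (.reg 12) (.sub (.reg 15) (.reg 4))),
      assign 14 (.add (.reg 14) (.reg 16))]),
    assign 13 (.add (.reg 13) (.sub (.reg 14) (.reg 13)))]

/-- Register `12` sums truncated excesses, so it stays zero exactly if no capacity is exceeded; `x +
(y - x)` is the maximum of `x` and `y`. -/
theorem evaluateScen_spec (d : ℕ) (k : Fin d) (s : State) :
    (((evaluateScen d k).run s).reg 12 = 0 ↔ s.reg 12 = 0 ∧ ∀ b < s.reg 0,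
      natLoad d (s.reg 0) (s.arr 0) (s.arr 2) (s.arr 4) b k ≤ s.reg 4) ∧
    ((evaluateScen d k).run s).reg 13 = max (s.reg 13) {b ∈ Finset.range (s.reg 0) |
      b ∈ used (Finset.range (s.reg 0)) (scenOf d (s.arr 0)) (s.arr 4) k}.card := by
  have key := run_iter_induction (s := s.setReg 14 0) (x := 2)
    (p := seqs [assign 15 (.const 0), assign 16 (.const 0), inspect d k,
      assign 12 (.add (.reg 12) (.sub (.reg 15) (.reg 4))),
      assign 14 (.add (.reg 14) (.reg 16))])
    (fun m s' => (s'.reg 12 = 0 ↔ s.reg 12 = 0 ∧ ∀ b < m,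
        natLoad d (s.reg 0) (s.arr 0) (s.arr 2) (s.arr 4) b k ≤ s.reg 4) ∧
      s'.reg 14 = {b ∈ Finset.range m |
        b ∈ used (Finset.range (s.reg 0)) (scenOf d (s.arr 0)) (s.arr 4) k}.card)
    (by simp) ?_
  · simp only [evaluateScen, run_seqs_cons, run_seqs_nil, run_assign, Expr.eval, State.setReg_reg,
      if_true]
    obtain ⟨h1, h2⟩ := key
    have h13 := run_reg (p := iter 2 (seqs [assign 15 (.const 0), assign 16 (.const 0), inspect d k,
      assign 12 (.add (.reg 12) (.sub (.reg 15) (.reg 4))),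
      assign 14 (.add (.reg 14) (.reg 16))])) (y := 13) (by simp [inspect]) (s.setReg 14 0)
    refine ⟨by simpa using h1, ?_⟩
    rw [h2, h13]
    simp only [State.setReg_reg]
    norm_num
    omega
  · rintro m hm s' hs1 hr hb ⟨h1, h2⟩
    have hA : ∀ b, s'.arr b = s.arr b := fun b => hb b (by simp [inspect])
    have hr0 : s'.reg 0 = s.reg 0 := by rw [hr 0 (by simp [inspect])]; simp
    have hr4 : s'.reg 4 = s.reg 4 := by rw [hr 4 (by simp [inspect])]; simp
    simp only [run_seqs_cons, run_seqs_nil, run_assign, Expr.eval]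
    set s₁ := (s'.setReg 15 0).setReg 16 0 with hs₁
    obtain ⟨h3, h4⟩ := inspect_spec d k s₁ (by simp [hs₁]) (by simp [hs₁])
    have h12 : ((inspect d k).run s₁).reg 12 = s'.reg 12 := by
      rw [run_reg (by simp [inspect])]; simp [hs₁]
    have h14 : ((inspect d k).run s₁).reg 14 = s'.reg 14 := by
      rw [run_reg (by simp [inspect])]; simp [hs₁]
    have h5 : ((inspect d k).run s₁).reg 4 = s.reg 4 := by
      rw [run_reg (by simp [inspect])]; simp [hs₁, hr4]
    have e0 : s₁.reg 0 = s.reg 0 := by simp [hs₁, hr0]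
    have e2 : s₁.reg 2 = m := by simp [hs₁, hs1]
    have ea : ∀ b, s₁.arr b = s.arr b := fun b => by simp [hs₁, hA]
    rw [e0, e2, ea, ea, ea] at h3
    rw [e0, e2, ea, ea] at h4
    constructor
    · simp only [State.setReg_reg, h12, h3, h5]
      norm_num
      rw [h1, and_assoc]
      refine and_congr_right fun _ => ?_
      rw [Nat.sub_eq_zero_iff_le, forall_lt_and_iff]
    · simp only [State.setReg_reg, h14, h4]
      norm_num
      rw [h2, Finset.range_add_one, Finset.filter_insert]
      split_ifs with hc
      · rw [Finset.card_insert_of_notMem (by simp)]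
      · rfl

theorem keeps_evaluateScen {y : ℕ} (d k : ℕ) (hy : y ∉ [1, 2, 12, 13, 14, 15, 16]) :
    (evaluateScen d k).Keeps y := by
  simp at hy
  simp [evaluateScen, inspect]; omega

theorem keepsArr_evaluateScen (b d k : ℕ) : (evaluateScen d k).KeepsArr b := by
  simp [evaluateScen, inspect]

theorem wF_evaluateScen (d k : ℕ) : (evaluateScen d k).WF := by
  simp [evaluateScen, inspect]

/-- Evaluate the labeling: register `12` becomes zero if it is feasible, and register `13` becomes
its value. -/
def evaluate (d : ℕ) : LoopProg :=
  seqs [assign 12 (.const 0),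
    iter 1 (assign 12 (.add (.reg 12) (.le (.reg 0) (.cell 4 (.reg 1))))),
    assign 13 (.const 0), seqs ((List.finRange d).map fun k : Fin d => evaluateScen d k)]

theorem evaluateScens_spec (d : ℕ) (ks : List (Fin d)) : ∀ s : State,
    ((((seqs (ks.map fun k : Fin d => evaluateScen d k)).run s).reg 12 = 0 ↔
      s.reg 12 = 0 ∧ ∀ k ∈ ks, ∀ b < s.reg 0,
        natLoad d (s.reg 0) (s.arr 0) (s.arr 2) (s.arr 4) b k ≤ s.reg 4) ∧
    ∀ v, ((seqs (ks.map fun k : Fin d => evaluateScen d k)).run s).reg 13 ≤ v ↔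
      s.reg 13 ≤ v ∧ ∀ k ∈ ks, {b ∈ Finset.range (s.reg 0) |
        b ∈ used (Finset.range (s.reg 0)) (scenOf d (s.arr 0)) (s.arr 4) k}.card ≤ v) := by
  induction ks with
  | nil => simp
  | cons k ks ih =>
    intro s
    obtain ⟨h1, h2⟩ := evaluateScen_spec d k s
    have hr : ∀ y, y ∉ [1, 2, 12, 13, 14, 15, 16] →
      ((evaluateScen d k).run s).reg y = s.reg y := fun y hy => run_reg (keeps_evaluateScen d k hy) s
    have hA : ∀ b, ((evaluateScen d k).run s).arr b = s.arr b :=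
      fun b => run_arr (keepsArr_evaluateScen b d k) s
    obtain ⟨h3, h4⟩ := ih ((evaluateScen d k).run s)
    rw [hr 0 (by simp), hr 4 (by simp), hA, hA, hA, h1] at h3
    rw [hr 0 (by simp), hA, hA, h2] at h4
    simp only [List.map_cons, run_seqs_cons, List.forall_mem_cons]
    exact ⟨h3.trans and_assoc, fun v => (h4 v).trans (by rw [max_le_iff, and_assoc])⟩

/-- Loads are examined only for labels below the number of rounds; labelings with larger labels are
rejected, so nothing escapes the check. -/
theorem evaluate_spec (d : ℕ) (s : State) :
    (((evaluate d).run s).reg 12 = 0 ↔ (∀ i < s.reg 0, s.arr 4 i < s.reg 0) ∧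
      ∀ k, ∀ b < s.reg 0, natLoad d (s.reg 0) (s.arr 0) (s.arr 2) (s.arr 4) b k ≤ s.reg 4) ∧
    ∀ v, ((evaluate d).run s).reg 13 ≤ v ↔ ∀ k, {b ∈ Finset.range (s.reg 0) |
      b ∈ used (Finset.range (s.reg 0)) (scenOf d (s.arr 0)) (s.arr 4) k}.card ≤ v := by
  simp only [evaluate, run_seqs_cons, run_seqs_nil, run_assign, Expr.eval]
  set p := iter 1 (assign 12 (.add (.reg 12) (.le (.reg 0) (.cell 4 (.reg 1))))) with hp
  have hr : ∀ y, y ∉ [1, 12] → (p.run (s.setReg 12 0)).reg y = s.reg y := fun y hy => by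
    simp at hy
    rw [run_reg (by simp [hp, hy])]; simp [hy]
  have hA : ∀ b, (p.run (s.setReg 12 0)).arr b = s.arr b := fun b => by
    rw [run_arr (by simp [hp])]; simp
  have h12 : (p.run (s.setReg 12 0)).reg 12 = 0 ↔ ∀ i < s.reg 0, s.arr 4 i < s.reg 0 := by
    refine run_iter_induction (s := s.setReg 12 0) (x := 1)
      (fun m s' => s'.reg 12 = 0 ↔ ∀ i < m, s.arr 4 i < s.reg 0) (by simp) ?_
    intro m hm s' hs1 hr hb h1
    have hr0 : s'.reg 0 = s.reg 0 := by rw [hr 0 (by simp)]; simp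
    have hA4 : s'.arr 4 = s.arr 4 := by rw [hb 4 (by simp)]; simp
    simp only [run_assign, Expr.eval, Expr.eval_le, State.setReg_reg, hr0, hA4, hs1]
    norm_num
    rw [h1, forall_lt_and_iff]
  obtain ⟨h1, h2⟩ := evaluateScens_spec d (List.finRange d) ((p.run (s.setReg 12 0)).setReg 13 0)
  simp only [State.setReg_arr, hA] at h1 h2
  simp only [State.setReg_reg, hr 0 (by simp), hr 4 (by simp)] at h1 h2
  norm_num at h1 h2
  rw [h12] at h1
  exact ⟨h1, h2⟩

theorem keeps_evaluate {y : ℕ} (d : ℕ) (hy : y ∉ [1, 2, 12, 13, 14, 15, 16]) :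
    (evaluate d).Keeps y := by
  have h := fun k => keeps_evaluateScen d k hy
  simp at hy
  simp only [evaluate, keeps_seqs, List.forall_mem_cons, List.forall_mem_map, keeps_assign,
    keeps_iter]
  refine ⟨by omega, by omega, by omega, fun k _ => h k, by simp⟩

theorem keepsArr_evaluate (b d : ℕ) : (evaluate d).KeepsArr b := by
  simp [evaluate, keepsArr_evaluateScen]

theorem wF_evaluate (d : ℕ) : (evaluate d).WF := by
  simp [evaluate, wF_evaluateScen]

/-- The labeling `L` is feasible and has at most the value `v`. -/
def IsSolution (d N D : ℕ) (A a L : ℕ → ℕ) (v : ℕ) : Prop :=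
  ∀ k : Fin d, (∀ b, natLoad d N A a L b k ≤ D) ∧
    (used (Finset.range N) (scenOf d A) L k).card ≤ v

theorem IsSolution.congr {d N D v : ℕ} {A a L L' : ℕ → ℕ} (h : IsSolution d N D A a L v)
    (hL : ∀ i < N, L' i = L i) : IsSolution d N D A a L' v := by
  intro k
  obtain ⟨h1, h2⟩ := h k
  constructor
  · intro b
    refine le_trans (le_of_eq ?_) (h1 b)
    refine Finset.sum_congr (Finset.filter_congr fun i hi => ?_) fun _ _ => rfl
    rw [hL i (Finset.mem_range.1 hi)]
  · refine le_trans (le_of_eq ?_) h2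
    congr 1
    refine Finset.image_congr fun i hi => ?_
    simp only [Finset.coe_filter, Finset.mem_range] at hi
    exact hL i hi.1

/-- If the current labeling is feasible and better than the best one so far, replace the latter. -/
def select : LoopProg :=
  when (.eq (.reg 12) (.const 0)) (when (.sub (.reg 11) (.reg 13))
    (seqs [assign 11 (.reg 13), tabulate 1 (.cell 4 (.reg 1))]))

/-- The best packing so far is as good as register `11` says. -/
def BestOK (d : ℕ) (s : State) : Prop :=
  s.reg 11 ≤ s.reg 0 →
    IsSolution d (s.reg 0) (s.reg 4) (s.arr 0) (s.arr 2) (s.arr 1) (s.reg 11)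

/-- Evaluate the current labeling and keep the better one. -/
def improve (d : ℕ) : LoopProg := seq (evaluate d) select

theorem keeps_improve {y : ℕ} (d : ℕ) (hy : y ∉ [1, 2, 11, 12, 13, 14, 15, 16]) :
    (improve d).Keeps y := by
  simp at hy
  simp only [improve, keeps_seq]
  exact ⟨keeps_evaluate d (by simp; omega), by simp [select, tabulate]; omega⟩

theorem keepsArr_improve {b : ℕ} (d : ℕ) (hb : b ≠ 1) : (improve d).KeepsArr b := by
  simp [improve, keepsArr_evaluate, select, tabulate, hb]

theorem wF_improve (d : ℕ) : (improve d).WF := by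
  simp [improve, wF_evaluate, select, tabulate]

/-- Correctness of the stored labeling rests on the check alone, not on how the current labeling
arose. So wrong guesses do no harm, and one good guess bounds the final value. -/
theorem improve_spec (d : ℕ) (s : State) (hs : BestOK d s) :
    BestOK d ((improve d).run s) ∧ ((improve d).run s).reg 11 ≤ s.reg 11 ∧
    ∀ W, (∀ i < s.reg 0, s.arr 4 i < s.reg 0) →
      IsSolution d (s.reg 0) (s.reg 4) (s.arr 0) (s.arr 2) (s.arr 4) W →
      ((improve d).run s).reg 11 ≤ W := by
  obtain ⟨h1, h2⟩ := evaluate_spec d s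
  simp only [improve, run_seq]
  set s₁ := (evaluate d).run s with hs₁
  have hr : ∀ y, y ∉ [1, 2, 12, 13, 14, 15, 16] → s₁.reg y = s.reg y :=
    fun y hy => run_reg (keeps_evaluate d hy) s
  have hA : ∀ b, s₁.arr b = s.arr b := fun b => run_arr (keepsArr_evaluate b d) s
  have hs₁' : BestOK d s₁ := by
    simp only [BestOK, hA]
    rw [hr 0 (by simp), hr 4 (by simp), hr 11 (by simp)]
    exact hs
  have hsol : ∀ W, (∀ i < s.reg 0, s.arr 4 i < s.reg 0) →
      IsSolution d (s.reg 0) (s.reg 4) (s.arr 0) (s.arr 2) (s.arr 4) W →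
      s₁.reg 12 = 0 ∧ s₁.reg 13 ≤ W := fun W hl hW =>
    ⟨h1.2 ⟨hl, fun k b _ => (hW k).1 b⟩, (h2 W).2 fun k =>
      (Finset.card_le_card fun b hb => (Finset.mem_filter.1 hb).2).trans (hW k).2⟩
  by_cases hc1 : s₁.reg 12 = 0
  · by_cases hc2 : s₁.reg 13 < s₁.reg 11
    · have hrun : select.run s₁ = (tabulate 1 (.cell 4 (.reg 1))).run (s₁.setReg 11 (s₁.reg 13)) := by
        simp only [select, run_when, Expr.eval_eq, Expr.eval, hc1, if_true, run_seqs_cons,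
          run_seqs_nil, run_assign]
        rw [if_pos (by norm_num)]
        exact if_pos (by omega)
      rw [hrun]
      set s₂ := s₁.setReg 11 (s₁.reg 13) with hs₂
      have h3 := tabulate_spec 1 (.cell 4 (.reg 1)) (s₂.arr 4) s₂ fun i _ s' e1 e2 e3 => by
        simp only [Expr.eval, e1, e3 4 (by simp)]
      have hr2 : ∀ y, y ≠ 1 → ((tabulate 1 (.cell 4 (.reg 1))).run s₂).reg y = s₂.reg y :=
        fun y hy => run_reg (by simp [tabulate, hy]) s₂
      have hA2 : ∀ b, b ≠ 1 → ((tabulate 1 (.cell 4 (.reg 1))).run s₂).arr b = s₂.arr b :=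
        fun b hb => run_arr (by simp [tabulate, hb]) s₂
      have e11 : s₂.reg 11 = s₁.reg 13 := by simp [hs₂]
      have e0 : s₂.reg 0 = s.reg 0 := by simp [hs₂, hr 0]
      have e4 : s₂.reg 4 = s.reg 4 := by simp [hs₂, hr 4]
      have ea : ∀ b, s₂.arr b = s.arr b := fun b => by simp [hs₂, hA]
      refine ⟨?_, ?_, ?_⟩
      · intro _
        rw [hr2 0 (by simp), hr2 4 (by simp), hr2 11 (by simp), hA2 0 (by simp), hA2 2 (by simp),
          e11, e0, e4, ea, ea]
        rw [e0, ea] at h3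
        obtain ⟨h5, h6⟩ := h1.1 hc1
        refine IsSolution.congr (L := s.arr 4) (fun k => ⟨fun b => ?_, ?_⟩) h3
        · by_cases hb : b < s.reg 0
          · exact h6 k b hb
          · refine le_trans (le_of_eq (Finset.sum_eq_zero fun i hi => ?_)) (Nat.zero_le _)
            simp only [Finset.mem_filter, Finset.mem_range] at hi
            have := h5 i hi.1
            omega
        · refine le_trans (Finset.card_le_card fun b hb => ?_) ((h2 _).1 le_rfl k)
          refine Finset.mem_filter.2 ⟨?_, hb⟩
          obtain ⟨i, hi, rfl⟩ := Finset.mem_image.1 hb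
          exact Finset.mem_range.2 (h5 i (Finset.mem_range.1 (Finset.mem_filter.1 hi).1))
      · rw [hr2 11 (by simp), e11, ← hr 11 (by simp)]
        exact hc2.le
      · intro W hl hW
        rw [hr2 11 (by simp), e11]
        exact (hsol W hl hW).2
    · have hrun : select.run s₁ = s₁ := by
        simp only [select, run_when, Expr.eval_eq, Expr.eval, hc1, if_true]
        rw [if_pos (by norm_num)]
        exact if_neg (by omega)
      rw [hrun]
      refine ⟨hs₁', (hr 11 (by simp)).le, fun W hl hW => ?_⟩
      have := (hsol W hl hW).2
      omega
  · have hrun : select.run s₁ = s₁ := by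
      simp [select, hc1]
    rw [hrun]
    exact ⟨hs₁', (hr 11 (by simp)).le, fun W hl hW => absurd (hsol W hl hW).1 hc1⟩

/-- Run `p` for all values of the given registers below the content of register `0`. -/
def forAll : List ℕ → LoopProg → LoopProg
  | [], p => p
  | x :: xs, p => iter x (forAll xs p)

theorem keeps_forAll {y : ℕ} {xs : List ℕ} {p : LoopProg} (hy : y ∉ xs) (hp : p.Keeps y) :
    (forAll xs p).Keeps y := by
  induction xs with
  | nil => exact hp
  | cons x xs ih =>
    simp only [List.mem_cons, not_or] at hy
    exact ⟨hy.1, ih hy.2⟩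

theorem wF_forAll {xs : List ℕ} {p : LoopProg} (hxs : xs.Nodup) (hp : p.WF)
    (hk : ∀ x ∈ xs, p.Keeps x) : (forAll xs p).WF := by
  induction xs with
  | nil => exact hp
  | cons x xs ih =>
    rw [List.nodup_cons] at hxs
    exact ⟨keeps_forAll hxs.1 (hk x List.mem_cons_self),
      ih hxs.2 fun y hy => hk y (List.mem_cons_of_mem _ hy)⟩

theorem forAll_invariant {p : LoopProg} (xs : List ℕ) (Inv : State → Prop)
    (hp : ∀ s, Inv s → Inv (p.run s)) (hset : ∀ s, ∀ x ∈ xs, ∀ v, Inv s → Inv (s.setReg x v)) :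
    ∀ s, Inv s → Inv ((forAll xs p).run s) := by
  induction xs with
  | nil => exact hp
  | cons x xs ih =>
    intro s hs
    refine run_iter_induction (fun _ s' => Inv s') (hset s x List.mem_cons_self 0 hs) ?_
    intro m _ s' _ _ _ h
    exact hset _ x List.mem_cons_self _
      (ih (fun s y hy => hset s y (List.mem_cons_of_mem _ hy)) s' h)

/-- If `p` reaches the goal for one choice of the values, then the loop over all values does. -/
theorem forAll_goal {p : LoopProg} (xs : List ℕ) (v : ℕ → ℕ) (Inv Goal : State → Prop)
    (hxs : xs.Nodup)
    (hk : ∀ x ∈ xs, p.Keeps x) (hp : ∀ s, Inv s → Inv (p.run s))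
    (hset : ∀ s, ∀ x ∈ xs, ∀ v, Inv s → Inv (s.setReg x v))
    (gp : ∀ s, Inv s → Goal s → Goal (p.run s))
    (gset : ∀ s, ∀ x ∈ xs, ∀ v, Goal s → Goal (s.setReg x v))
    (hv : ∀ s, Inv s → ∀ x ∈ xs, v x < s.reg 0)
    (goal : ∀ s, Inv s → (∀ x ∈ xs, s.reg x = v x) → Goal (p.run s)) :
    ∀ s, Inv s → Goal ((forAll xs p).run s) := by
  induction xs generalizing Inv with
  | nil => exact fun s hs => goal s hs (by simp)
  | cons x xs ih =>
    intro s hs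
    rw [List.nodup_cons] at hxs
    have hx := List.mem_cons_self (a := x) (l := xs)
    have hsub : ∀ y ∈ xs, y ∈ x :: xs := fun y hy => List.mem_cons_of_mem _ hy
    have hset' : ∀ s, ∀ x ∈ xs, ∀ v, Inv s → Inv (s.setReg x v) := fun s y hy => hset s y (hsub y hy)
    have key := run_iter_induction (s := s) (x := x) (p := forAll xs p)
      (fun m s' => Inv s' ∧ (v x < m → Goal s')) ⟨hset s x hx 0 hs, by simp⟩ ?_
    · exact key.2 (hv s hs x hx)
    rintro m _ s' hs1 hr _ ⟨h1, h2⟩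
    refine ⟨hset _ x hx _ (forAll_invariant xs Inv hp hset' s' h1), fun hm => gset _ x hx _ ?_⟩
    rcases Nat.lt_succ_iff_lt_or_eq.1 hm with hm | hm
    · refine (forAll_invariant xs (fun s => Inv s ∧ Goal s) (fun s h => ⟨hp s h.1, gp s h.1 h.2⟩)
        (fun s y hy v h => ⟨hset' s y hy v h.1, gset s y (hsub y hy) v h.2⟩) s' ⟨h1, h2 hm⟩).2
    -- In the round where the outer counter has the desired value, this value joins the invariant;
    -- the inner loops keep it because `x` is not among their counters.
    · refine ih (Inv := fun s => Inv s ∧ s.reg x = v x) hxs.2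
        (fun y hy => hk y (hsub y hy))
        (fun s h => ⟨hp s h.1, (run_reg (hk x hx) s).trans h.2⟩)
        (fun s y hy w h => ⟨hset' s y hy w h.1, ?_⟩) (fun s h => gp s h.1)
        (fun s y hy => gset s y (hsub y hy)) (fun s h y hy => hv s h.1 y (hsub y hy))
        (fun s h hy => goal s h.1 fun y hy' => ?_) s' ⟨h1, by rw [hs1, hm]⟩
      · rw [State.setReg_reg, if_neg, h.2]
        rintro rfl
        exact hxs.1 hy
      · rcases List.mem_cons.1 hy' with rfl | hy'
        · exact h.2
        · exact hy y hy'

end RAM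

/-! ### The exhaustive search -/

namespace RAM

open LoopProg BPPS

/-- Carry out the plan that the parameters describe and keep the result if it is an improvement. -/
def attempt (d h J : ℕ) (l : List (ℕ × List ℕ)) : LoopProg :=
  seqs [classify d J (4 * h ^ 2), tabulate 4 (.const 0), assign 9 (.const 0), pack h l, improve d]

theorem keeps_attempt {y : ℕ} (d h J : ℕ) (l : List (ℕ × List ℕ))
    (hy : y ∉ [1, 2, 8, 9, 10, 11, 12, 13, 14, 15, 16]) : (attempt d h J l).Keeps y := by
  simp at hy
  simp only [attempt, keeps_seqs, List.forall_mem_cons, classify, tabulate, keeps_iter,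
    keeps_store, keeps_assign]
  exact ⟨⟨hy.1, trivial⟩, ⟨hy.1, trivial⟩, by omega, keeps_pack _ _ (by simp; omega),
    keeps_improve _ (by simp; omega), by simp⟩

theorem keepsArr_attempt {b : ℕ} (d h J : ℕ) (l : List (ℕ × List ℕ)) (hb : b ∉ [1, 3, 4]) :
    (attempt d h J l).KeepsArr b := by
  simp at hb
  simp only [attempt, keepsArr_seqs, List.forall_mem_cons, classify, tabulate, keepsArr_iter,
    keepsArr_store, keepsArr_assign]
  exact ⟨hb.2.1, hb.2.2, trivial, keepsArr_pack _ _ hb.2.2, keepsArr_improve _ hb.1, by simp⟩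

theorem wF_attempt (d h J : ℕ) (l : List (ℕ × List ℕ)) : (attempt d h J l).WF := by
  simp [attempt, classify, tabulate, wF_pack, wF_improve]

/-- The first two claims hold for every guess. The last one concerns a good guess; it assumes that
every result of the filling relation is a solution, so the order in which the program picks items is
irrelevant. -/
theorem attempt_spec (d h J : ℕ) (l : List (ℕ × List ℕ)) (s : State) (hs : BestOK d s) :
    BestOK d ((attempt d h J l).run s) ∧ ((attempt d h J l).run s).reg 11 ≤ s.reg 11 ∧
    ∀ (S : Classified d) (W : ℕ), 0 < h → 0 < s.reg 4 → S.U = Finset.range (s.reg 0) →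
      (∀ i < s.reg 0, S.cls i = classOf d J (4 * h ^ 2) (s.reg 4) (s.arr 0) (s.arr 2)
        (fun m => s.reg (20 + m)) i) →
      (∀ i < s.reg 0, S.weight i = s.arr 5 i / s.reg 4) → S.η = 1 / (2 * h) →
      (∀ o ∈ l, 20 ≤ o.1 ∧ s.reg o.1 ≤ s.reg 0) →
      (∀ L, S.Fills (Classified.numbered 1 (l.flatMap fun o => List.replicate (s.reg o.1) o.2))
        (fun _ => 0) L → (∀ i < s.reg 0, L i < s.reg 0) ∧
          IsSolution d (s.reg 0) (s.reg 4) (s.arr 0) (s.arr 2) L W) →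
      ((attempt d h J l).run s).reg 11 ≤ W := by
  have h3 := classify_spec d J (4 * h ^ 2) s
  simp only [attempt, run_seqs_cons, run_seqs_nil, run_assign, Expr.eval]
  set s₁ := (classify d J (4 * h ^ 2)).run s with hs₁
  have hr₁ : ∀ y, y ≠ 1 → s₁.reg y = s.reg y := fun y hy =>
    run_reg (by simp [classify, tabulate, hy]) s
  have hA₁ : ∀ b, b ≠ 3 → s₁.arr b = s.arr b := fun b hb =>
    run_arr (by simp [classify, tabulate, hb]) s
  have h4 := tabulate_spec 4 (.const 0) (fun _ => 0) s₁ fun i _ s' _ _ _ => rfl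
  set s₂ := (tabulate 4 (.const 0)).run s₁ with hs₂
  have hr₂ : ∀ y, y ≠ 1 → s₂.reg y = s.reg y := fun y hy => by
    rw [← hr₁ y hy]; exact run_reg (by simp [tabulate, hy]) s₁
  have hA₂ : ∀ b, b ≠ 4 → s₂.arr b = s₁.arr b := fun b hb =>
    run_arr (by simp [tabulate, hb]) s₁
  set s₃ := s₂.setReg 9 0 with hs₃
  have hr₃ : ∀ y, y ∉ [1, 9] → s₃.reg y = s.reg y := fun y hy => by
    simp at hy
    simp [hs₃, hy, hr₂]
  have hA₃ : ∀ b, s₃.arr b = s₂.arr b := fun b => by simp [hs₃]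
  set s₄ := (pack h l).run s₃ with hs₄
  have hr₄ : ∀ y, y ∉ [1, 8, 9, 10] → s₄.reg y = s.reg y := fun y hy => by
    rw [← hr₃ y (by simp at hy ⊢; omega)]; exact run_reg (keeps_pack _ _ hy) s₃
  have hA₄ : ∀ b, b ∉ [3, 4] → s₄.arr b = s.arr b := fun b hb => by
    simp at hb
    rw [← hA₁ b hb.1, ← hA₂ b hb.2, ← hA₃ b]
    exact run_arr (keepsArr_pack _ _ hb.2) s₃
  have hs₄' : BestOK d s₄ := by
    simp only [BestOK]
    rw [hr₄ 0 (by simp), hr₄ 4 (by simp), hr₄ 11 (by simp), hA₄ 0 (by simp), hA₄ 1 (by simp),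
      hA₄ 2 (by simp)]
    exact hs
  obtain ⟨h5, h6, h7⟩ := improve_spec d s₄ hs₄'
  refine ⟨h5, h6.trans (hr₄ 11 (by simp)).le, ?_⟩
  intro S W hh hD hU hcls hw hη hl hL
  have e0 : s₃.reg 0 = s.reg 0 := hr₃ 0 (by simp)
  have hmatch : Matches S h s₃ := by
    constructor
    · exact hh
    · rwa [hr₃ 4 (by simp)]
    · rw [e0, hU]
    · rw [e0, hA₃, hA₂ 3 (by simp)]
      intro i hi
      rw [h3 i hi, hcls i hi]
    · rw [e0, hA₃, hA₂ 5 (by simp), hA₁ 5 (by simp), hr₃ 4 (by simp)]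
      exact hw
    · exact hη
  have hreg : ∀ o ∈ l, s₃.reg o.1 = s.reg o.1 := fun o ho => by
    have := (hl o ho).1
    exact hr₃ _ (by simp; omega)
  have key := hmatch.pack l fun o ho => by
    rw [hreg o ho, e0]
    exact hl o ho
  have hlist : (l.flatMap fun o => List.replicate (s₃.reg o.1) o.2) =
      l.flatMap fun o => List.replicate (s.reg o.1) o.2 :=
    List.flatMap_congr fun o ho => by rw [hreg o ho]
  have hlab : labels s₃ = fun _ => 0 := by
    funext i
    simp only [labels, e0, hA₃]
    split_ifs with hi
    · exact h4 i (by rwa [hr₁ 0 (by simp)])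
    · rfl
  have h9 : s₃.reg 9 = 0 := by simp [hs₃]
  rw [hlist, hlab, h9, zero_add] at key
  obtain ⟨h8, h10⟩ := hL _ key
  have e0' : s₄.reg 0 = s.reg 0 := hr₄ 0 (by simp)
  have hl4 : ∀ i < s.reg 0, s₄.arr 4 i = labels s₄ i := fun i hi => by
    rw [labels, e0', if_pos hi]
  refine h7 W ?_ ?_
  · rw [e0']
    intro i hi
    rw [hl4 i hi]
    exact h8 i hi
  · rw [e0', hr₄ 4 (by simp), hA₄ 0 (by simp), hA₄ 2 (by simp)]
    exact h10.congr hl4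

/-- The whole search, once register `0` is set. -/
def search (d h J : ℕ) (l : List (ℕ × List ℕ)) (xs : List ℕ) : LoopProg :=
  seqs [scale d, weigh (4 * h ^ 2), assign 11 (.add (.reg 0) (.const 1)),
    forAll xs (attempt d h J l)]

theorem wF_search (d h J : ℕ) (l : List (ℕ × List ℕ)) {xs : List ℕ} (hxs : xs.Nodup)
    (h20 : ∀ x ∈ xs, 20 ≤ x) : (search d h J l xs).WF := by
  simp only [search, wF_seqs, List.forall_mem_cons, weigh, wF_iter, wF_branch, wF_store, wF_assign,
    keeps_branch, keeps_store]
  refine ⟨wF_scale d, by simp, trivial, wF_forAll hxs (wF_attempt _ _ _ _) fun x hx => ?_, by simp⟩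
  have := h20 x hx
  exact keeps_attempt _ _ _ _ (by simp; omega)

theorem keeps_search (d h J : ℕ) (l : List (ℕ × List ℕ)) {xs : List ℕ}
    (h20 : ∀ x ∈ xs, 20 ≤ x) : (search d h J l xs).Keeps 0 := by
  simp only [search, keeps_seqs, List.forall_mem_cons, weigh, keeps_iter, keeps_branch,
    keeps_store, keeps_assign]
  refine ⟨keeps_scale d 0 (by simp), by simp, by simp,
    keeps_forAll (fun h => ?_) (keeps_attempt _ _ _ _ (by simp)), by simp⟩
  have := h20 0 h
  omega

/-- Here `v` is a good choice of the enumerated numbers: the registers `20 + m` with `m < J` hold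
the items that serve as thresholds, the registers named in `l` the multiplicities of the
configurations. -/
theorem search_spec (d h J : ℕ) (l : List (ℕ × List ℕ)) (xs : List ℕ) (hxs : xs.Nodup)
    (h20 : ∀ x ∈ xs, 20 ≤ x) (hl : ∀ o ∈ l, o.1 ∈ xs) (hJ : ∀ m < J, 20 + m ∈ xs) (hh : 0 < h)
    (s : State) (hn : s.arr 0 0 ≤ s.reg 0)
    (hden : ∀ j < s.arr 0 0, s.arr 0 (2 + (d + 2) * j) < 2 ^ s.reg 0)
    (D : ℕ) (hD : D = ∏ j ∈ Finset.range (s.arr 0 0), s.arr 0 (2 + (d + 2) * j)) (hD0 : 0 < D)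
    (a : ℕ → ℕ) (ha : ∀ i < s.reg 0, a i = s.arr 0 (1 + (d + 2) * i) *
      ∏ j ∈ Finset.range (s.arr 0 0) with j ≠ i, s.arr 0 (2 + (d + 2) * j))
    (v : ℕ → ℕ) (hv : ∀ x ∈ xs, v x < s.reg 0) (S : Classified d)
    (hU : S.U = Finset.range (s.reg 0))
    (hcls : ∀ i < s.reg 0, S.cls i = classOf d J (4 * h ^ 2) D (s.arr 0) a (fun m => v (20 + m)) i)
    (hw : ∀ i < s.reg 0, S.weight i = ((if 4 * h ^ 2 * a i ≤ D then a i else D : ℕ) : ℚ) / D)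
    (hη : S.η = 1 / (2 * h)) (W : ℕ) (hW : W ≤ s.reg 0)
    (hL : ∀ L, S.Fills (Classified.numbered 1 (l.flatMap fun o => List.replicate (v o.1) o.2))
      (fun _ => 0) L → (∀ i < s.reg 0, L i < s.reg 0) ∧
        IsSolution d (s.reg 0) D (s.arr 0) a L W) :
    IsSolution d (s.reg 0) D (s.arr 0) a (((search d h J l xs).run s).arr 1) W := by
  obtain ⟨h1, h2⟩ := scale_spec d s hn hden
  simp only [search, run_seqs_cons, run_seqs_nil, run_assign, Expr.eval]
  set s₁ := (scale d).run s with hs₁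
  have hr₁ : s₁.reg 0 = s.reg 0 := run_reg (keeps_scale d 0 (by simp)) s
  have hA₁ : ∀ b, b ≠ 2 → s₁.arr b = s.arr b := fun b hb => run_arr (keepsArr_scale d b hb) s
  have h3 := weigh_spec (4 * h ^ 2) s₁
  set s₂ := (weigh (4 * h ^ 2)).run s₁ with hs₂
  have hr₂ : ∀ y, y ≠ 1 → s₂.reg y = s₁.reg y := fun y hy => run_reg (by simp [weigh, hy]) s₁
  have hA₂ : ∀ b, b ≠ 5 → s₂.arr b = s₁.arr b := fun b hb => run_arr (by simp [weigh, hb]) s₁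
  set s₃ := s₂.setReg 11 (s₂.reg 0 + 1) with hs₃
  have e0 : s₃.reg 0 = s.reg 0 := by simp [hs₃, hr₂, hr₁]
  have e4 : s₃.reg 4 = D := by simp [hs₃, hr₂, h1, hD]
  have eA : s₃.arr 0 = s.arr 0 := by simp [hs₃, hA₂, hA₁]
  have e2 : ∀ i < s.reg 0, s₃.arr 2 i = a i := fun i hi => by
    rw [ha i hi, ← h2 i hi]; simp [hs₃, hA₂]
  have e5 : ∀ i < s.reg 0, s₃.arr 5 i = if 4 * h ^ 2 * a i ≤ D then a i else D := fun i hi => by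
    have := h3 i (by rwa [hr₁])
    rw [h1, ← hD] at this
    rw [← e2 i hi]
    simpa [hs₃, hA₂] using this
  -- The initial value, one more than register `0`, marks that no labeling has been found yet and
  -- makes the claim vacuous.
  have hbest : BestOK d s₃ := by
    intro h
    simp [hs₃] at h
  let Inv : State → Prop := fun s' => s'.reg 0 = s.reg 0 ∧ s'.reg 4 = D ∧ s'.arr 0 = s.arr 0 ∧
    s'.arr 2 = s₃.arr 2 ∧ s'.arr 5 = s₃.arr 5 ∧ BestOK d s'
  have hInv : Inv s₃ := ⟨e0, e4, eA, rfl, rfl, hbest⟩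
  have hp : ∀ s', Inv s' → Inv ((attempt d h J l).run s') := by
    rintro s' ⟨i1, i2, i3, i4, i5, i6⟩
    refine ⟨?_, ?_, ?_, ?_, ?_, (attempt_spec d h J l s' i6).1⟩
    · rw [run_reg (keeps_attempt _ _ _ _ (by simp)), i1]
    · rw [run_reg (keeps_attempt _ _ _ _ (by simp)), i2]
    · rw [run_arr (keepsArr_attempt _ _ _ _ (by simp)), i3]
    · rw [run_arr (keepsArr_attempt _ _ _ _ (by simp)), i4]
    · rw [run_arr (keepsArr_attempt _ _ _ _ (by simp)), i5]
  have hset : ∀ s', ∀ x ∈ xs, ∀ w, Inv s' → Inv (s'.setReg x w) := by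
    rintro s' x hx w ⟨i1, i2, i3, i4, i5, i6⟩
    have hx' := h20 x hx
    have f0 : (s'.setReg x w).reg 0 = s'.reg 0 := by
      rw [State.setReg_reg, if_neg (by omega)]
    have f4 : (s'.setReg x w).reg 4 = s'.reg 4 := by
      rw [State.setReg_reg, if_neg (by omega)]
    have f11 : (s'.setReg x w).reg 11 = s'.reg 11 := by
      rw [State.setReg_reg, if_neg (by omega)]
    refine ⟨f0.trans i1, f4.trans i2, i3, i4, i5, ?_⟩
    simp only [BestOK, f0, f4, f11]
    exact i6
  obtain ⟨j1, j2, j3, j4, j5, j6⟩ := forAll_invariant xs Inv hp hset s₃ hInv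
  have hgoal := forAll_goal xs v Inv (fun s' => s'.reg 11 ≤ W) hxs
    (fun x hx => keeps_attempt _ _ _ _ (by have := h20 x hx; simp; omega)) hp hset
    (fun s' hs' hg => (attempt_spec d h J l s' hs'.2.2.2.2.2).2.1.trans hg)
    (fun s' x hx w hg => by
      have := h20 x hx
      rwa [State.setReg_reg, if_neg (by omega)])
    (fun s' hs' x hx => by rw [hs'.1]; exact hv x hx)
    (fun s' hs' hx => by
      obtain ⟨i1, i2, i3, i4, i5, i6⟩ := hs'
      refine (attempt_spec d h J l s' i6).2.2 S W hh (by rwa [i2]) (by rw [i1, hU]) ?_ ?_ hη ?_ ?_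
      · intro i hi
        rw [i1] at hi
        rw [hcls i hi, i2, i3, i4]
        have hf : ((Finset.range J).filter fun m => s₃.arr 2 i ≤ s₃.arr 2 (s'.reg (20 + m))) =
            (Finset.range J).filter fun m => a i ≤ a (v (20 + m)) := by
          refine Finset.filter_congr fun m hm => ?_
          have hm' := hJ m (Finset.mem_range.1 hm)
          rw [hx _ hm', e2 i hi, e2 _ (hv _ hm')]
        simp only [classOf]
        rw [hf, e2 i hi]
      · intro i hi
        rw [i1] at hi
        rw [hw i hi, i2, i5, e5 i hi]
      · intro o ho
        refine ⟨h20 _ (hl o ho), ?_⟩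
        rw [i1, hx _ (hl o ho)]
        exact (hv _ (hl o ho)).le
      · intro L hfill
        have hlist : (l.flatMap fun o => List.replicate (s'.reg o.1) o.2) =
            l.flatMap fun o => List.replicate (v o.1) o.2 :=
          List.flatMap_congr fun o ho => by rw [hx _ (hl o ho)]
        rw [hlist] at hfill
        obtain ⟨k1, k2⟩ := hL L hfill
        rw [i1, i2, i3, i4]
        refine ⟨k1, fun k => ⟨fun b => le_trans (le_of_eq ?_) ((k2 k).1 b), (k2 k).2⟩⟩
        refine Finset.sum_congr rfl fun i hi => e2 i ?_
        exact Finset.mem_range.1 (Finset.mem_filter.1 hi).1) s₃ hInv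
  -- Reaching a value at most `W ≤ N` rules out the initial marker; this is where `hW` enters.
  have hfin := j6 (by rw [j1]; exact hgoal.trans hW)
  rw [j1, j2, j3, j4] at hfin
  intro k
  obtain ⟨k1, k2⟩ := hfin k
  refine ⟨fun b => le_trans (le_of_eq ?_) (k1 b), k2.trans hgoal⟩
  refine Finset.sum_congr rfl fun i hi => (e2 i ?_).symm
  exact Finset.mem_range.1 (Finset.mem_filter.1 hi).1

end RAM

namespace RAM

/-! ### The length of the input -/

theorem size_eq_size_half_add_one {v : ℕ} (hv : v ≠ 0) : Nat.size v = Nat.size (v / 2) + 1 := by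
  have h := Nat.bit_bodd_div2 v
  rw [← Nat.div2_val]
  conv_lhs => rw [← h]
  rw [Nat.size_bit (by rwa [h])]

/-- Add the number of binary digits of register `2` to register `0`. -/
def addSize : Prog :=
  .loop (.reg 2) (.seq (.assign 0 (.add (.reg 0) (.const 1))) (.assign 2 (.half (.reg 2))))

/-- Each binary digit costs nine steps: two for the test, four for counting and three for halving.
-/
theorem exec_addSize (v : ℕ) : ∀ s : State, s.reg 2 = v → ∃ t s', Exec addSize s t s' ∧
    t ≤ 9 * Nat.size v + 2 ∧ s'.arr = s.arr ∧ s'.reg 1 = s.reg 1 ∧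
    s'.reg 0 = s.reg 0 + Nat.size v := by
  induction v using Nat.strong_induction_on with
  | _ v ih =>
    intro s hs
    by_cases hv : v = 0
    · exact ⟨_, s, Exec.loop_false (by simp [hs, hv]), by simp [Expr.cost], rfl, rfl, by simp [hv]⟩
    · have hb := Exec.seq (Exec.assign s 0 (.add (.reg 0) (.const 1)))
        (Exec.assign (s.setReg 0 (Expr.eval s (.add (.reg 0) (.const 1)))) 2 (.half (.reg 2)))
      obtain ⟨t, s', h1, h2, h3, h4, h5⟩ := ih (v / 2) (by omega)
        ((s.setReg 0 (Expr.eval s (.add (.reg 0) (.const 1)))).setReg 2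
          (Expr.eval (s.setReg 0 (Expr.eval s (.add (.reg 0) (.const 1)))) (.half (.reg 2))))
        (by simp [hs])
      refine ⟨_, s', Exec.loop_true (by simpa [hs] using hv) hb h1, ?_, by simpa using h3,
        by simpa using h4, ?_⟩
      · rw [size_eq_size_half_add_one hv]
        simp only [Expr.cost]
        omega
      · rw [h5, size_eq_size_half_add_one hv]
        simp
        omega

/-- Add the lengths of the first entries of the input, as many as register `1` says, to register
`0`. -/
def addSizes : Prog :=
  .loop (.reg 1) (.seq (.assign 1 (.sub (.reg 1) (.const 1))) (.seq (.assign 2 (.cell 0 (.reg 1)))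
    (.seq addSize (.assign 0 (.add (.reg 0) (.const 1))))))

/-- Apart from the nine steps per digit, an entry costs fifteen steps, two of them for the last test
of the inner loop. -/
theorem exec_addSizes (m : ℕ) : ∀ s : State, s.reg 1 = m → ∃ t s', Exec addSizes s t s' ∧
    t ≤ 15 * ∑ i ∈ Finset.range m, (Nat.size (s.arr 0 i) + 1) + 2 ∧ s'.arr = s.arr ∧
    s'.reg 0 = s.reg 0 + ∑ i ∈ Finset.range m, (Nat.size (s.arr 0 i) + 1) := by
  induction m with
  | zero =>
    intro s hs
    exact ⟨_, s, Exec.loop_false (by simp [hs]), by simp [Expr.cost], rfl, by simp⟩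
  | succ m ih =>
    intro s hs
    have h1 := Exec.assign s 1 (.sub (.reg 1) (.const 1))
    have h2 := Exec.assign (s.setReg 1 (Expr.eval s (.sub (.reg 1) (.const 1)))) 2
      (.cell 0 (.reg 1))
    set s₁ := (s.setReg 1 (Expr.eval s (.sub (.reg 1) (.const 1)))).setReg 2
      (Expr.eval (s.setReg 1 (Expr.eval s (.sub (.reg 1) (.const 1)))) (.cell 0 (.reg 1))) with hs₁
    obtain ⟨t, s₂, h3, h4, h5, h6, h7⟩ := exec_addSize (s.arr 0 m) s₁ (by simp [hs₁, hs])
    have h8 := Exec.assign s₂ 0 (.add (.reg 0) (.const 1))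
    have hs₁a : s₁.arr = s.arr := by simp [hs₁]
    have hs₁0 : s₁.reg 0 = s.reg 0 := by simp [hs₁]
    obtain ⟨t', s₃, h9, h10, h11, h12⟩ := ih (s₂.setReg 0 (Expr.eval s₂ (.add (.reg 0) (.const 1))))
      (by simp [h6, hs₁, hs])
    rw [State.setReg_arr, h5, hs₁a] at h10 h11 h12
    refine ⟨_, s₃, Exec.loop_true (by simp [hs]) (Exec.seq h1 (Exec.seq h2 (Exec.seq h3 h8))) h9,
      ?_, h11, ?_⟩
    · rw [Finset.sum_range_succ]
      simp only [Expr.cost]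
      omega
    · rw [h12, Finset.sum_range_succ]
      simp [h7, hs₁0]
      omega

/-- Set register `0` to `c` times the length of the input word. -/
def setRounds (d c : ℕ) : Prog :=
  .seq (.assign 1 (.add (.const 1) (.smul (d + 2) (.cell 0 (.const 0)))))
    (.seq addSizes (.assign 0 (.smul c (.reg 0))))

theorem sum_range_getD (w : List ℕ) (f : ℕ → ℕ) :
    ∑ i ∈ Finset.range w.length, f (w.getD i 0) = (w.map f).sum := by
  induction w with
  | nil => rfl
  | cons a w ih =>
    rw [List.length_cons, Finset.sum_range_succ', List.map_cons, List.sum_cons, ← ih, add_comm]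
    rfl

/-- The machine is not told where its input ends; the number of entries is recovered from the first
one. -/
theorem exec_setRounds (d c : ℕ) : ∃ T : Polynomial ℕ, ∀ w : List ℕ,
    w.length = 1 + (d + 2) * w.getD 0 0 → ∃ t s, Exec (setRounds d c) (init w) t s ∧
      t ≤ T.eval (bitLength w) ∧ s.arr = (init w).arr ∧ s.reg 0 = c * bitLength w := by
  refine ⟨15 * Polynomial.X + Polynomial.C (2 + (Expr.cost (.add (.const 1)
    (.smul (d + 2) (.cell 0 (.const 0)))) + 1) + (Expr.cost (.smul c (.reg 0)) + 1)), ?_⟩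
  intro w hw
  have h1 := Exec.assign (init w) 1 (.add (.const 1) (.smul (d + 2) (.cell 0 (.const 0))))
  set s₁ := (init w).setReg 1 (Expr.eval (init w)
    (.add (.const 1) (.smul (d + 2) (.cell 0 (.const 0))))) with hs₁
  have hlen : s₁.reg 1 = w.length := by
    rw [hw]
    simp [hs₁, init]
  have hs₁a : s₁.arr = (init w).arr := rfl
  obtain ⟨t, s₂, h2, h3, h4, h5⟩ := exec_addSizes w.length s₁ hlen
  have hsum : ∑ i ∈ Finset.range w.length, (Nat.size (s₁.arr 0 i) + 1) = bitLength w := by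
    rw [bitLength, ← sum_range_getD]
    simp [hs₁a, init]
  rw [hsum] at h3 h5
  have h6 := Exec.assign s₂ 0 (.smul c (.reg 0))
  refine ⟨_, _, Exec.seq h1 (Exec.seq h2 h6), ?_, h4.trans hs₁a, ?_⟩
  · simp only [Polynomial.eval_add, Polynomial.eval_mul, Polynomial.eval_X, Polynomial.eval_C,
      Polynomial.eval_ofNat]
    omega
  · have : s₁.reg 0 = 0 := by simp [hs₁, init]
    simp [h5, this]

end RAM

theorem List.getElem?_flatMap_of_length {α β : Type*} {m : ℕ} (f : α → List β)
    (hf : ∀ a, (f a).length = m) (l : List α) (i r : ℕ) (hr : r < m) :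
    (l.flatMap f)[r + m * i]? = l[i]?.bind fun a => (f a)[r]? := by
  induction l generalizing i with
  | nil => simp
  | cons a l ih =>
    rw [List.flatMap_cons]
    cases i with
    | zero => rw [mul_zero, add_zero, List.getElem?_append_left (by rwa [hf])]; simp
    | succ i =>
      rw [List.getElem?_append_right (by rw [hf]; nlinarith), hf,
        show r + m * (i + 1) - m = r + m * i by rw [mul_add]; omega, ih]
      simp

namespace BPPS

open RAM

variable {d : ℕ}

/-! ### The input word -/

theorem length_itemCode (I : BPPS d) (i : Fin I.n) :
    ((I.size i).num :: (I.size i).den ::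
      (List.finRange d).map fun k => if k ∈ I.scen i then 1 else 0).length = d + 2 := by
  simp

theorem length_encode (I : BPPS d) : I.encode.length = 1 + (d + 2) * I.n := by
  rw [encode, List.length_cons, List.length_flatMap]
  simp only [length_itemCode]
  simp [add_comm, mul_comm]

@[simp] theorem encode_zero (I : BPPS d) : I.encode.getD 0 0 = I.n := rfl

theorem encode_item (I : BPPS d) (i : Fin I.n) {r : ℕ} (hr : r < d + 2) :
    I.encode.getD (1 + r + (d + 2) * i) 0 = (((I.size i).num :: (I.size i).den ::
      (List.finRange d).map fun k => if k ∈ I.scen i then 1 else 0)[r]?).getD 0 := by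
  rw [encode, show 1 + r + (d + 2) * (i : ℕ) = (r + (d + 2) * i) + 1 by ring,
    List.getD_cons_succ, List.getD_eq_getElem?_getD,
    List.getElem?_flatMap_of_length _ (length_itemCode I) _ _ _ hr]
  simp

theorem encode_num (I : BPPS d) (i : Fin I.n) :
    I.encode.getD (1 + (d + 2) * i) 0 = (I.size i).num := by
  simpa using I.encode_item i (r := 0) (by omega)

theorem encode_den (I : BPPS d) (i : Fin I.n) :
    I.encode.getD (2 + (d + 2) * i) 0 = (I.size i).den := by
  simpa using I.encode_item i (r := 1) (by omega)

theorem encode_scen (I : BPPS d) (i : Fin I.n) (k : Fin d) :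
    I.encode.getD (3 + k + (d + 2) * i) 0 = if k ∈ I.scen i then 1 else 0 := by
  have := I.encode_item i (r := k + 2) (by omega)
  rw [show 1 + ((k : ℕ) + 2) = 3 + k by omega] at this
  simpa using this

/-- This turns the indices beyond the input into dummy items without scenarios. -/
theorem encode_eq_zero (I : BPPS d) {i : ℕ} (hi : I.n ≤ i) (r : ℕ) :
    I.encode.getD (1 + r + (d + 2) * i) 0 = 0 := by
  apply List.getD_eq_default
  rw [length_encode]
  nlinarith

/-- The input word as the content of an array. -/
def word (I : BPPS d) (j : ℕ) : ℕ := I.encode.getD j 0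

theorem scenOf_word (I : BPPS d) (i : Fin I.n) : scenOf d I.word i = I.scen i := by
  ext k
  rw [mem_scenOf, word, encode_scen]
  simp

theorem scenOf_word_eq_empty (I : BPPS d) {i : ℕ} (hi : I.n ≤ i) : scenOf d I.word i = ∅ := by
  ext k
  rw [mem_scenOf, word, show 3 + (k : ℕ) = 1 + (2 + k) by omega, I.encode_eq_zero hi]
  simp

theorem n_lt_bitLength (I : BPPS d) : I.n < bitLength I.encode := by
  have h : I.encode.length ≤ bitLength I.encode := by
    rw [bitLength, ← List.length_map (f := fun m => Nat.size m + 1)]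
    refine List.length_le_sum_of_one_le _ fun x hx => ?_
    obtain ⟨m, -, rfl⟩ := List.mem_map.1 hx
    omega
  rw [length_encode] at h
  nlinarith

theorem word_lt (I : BPPS d) (j : ℕ) : I.word j < 2 ^ bitLength I.encode := by
  refine (Nat.lt_size_self _).trans_le (Nat.pow_le_pow_right (by norm_num) ?_)
  rw [word]
  by_cases hj : j < I.encode.length
  · rw [List.getD_eq_getElem _ _ hj]
    refine (Nat.le_succ _).trans ?_
    refine List.single_le_sum (fun _ _ => Nat.zero_le _) _ (List.mem_map.2 ⟨_, ?_, rfl⟩)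
    exact List.getElem_mem hj
  · rw [List.getD_eq_default _ _ (not_lt.1 hj)]
    simp

/-! ### Labelings and packings -/

theorem card_image_congr {α β γ : Type*} [DecidableEq α] [DecidableEq β] [DecidableEq γ]
    (s : Finset α) (f : α → β) (g : α → γ) (h : ∀ i ∈ s, ∀ j ∈ s, f i = f j ↔ g i = g j) :
    (s.image f).card = (s.image g).card := by
  induction s using Finset.induction_on with
  | empty => rfl
  | insert a s ha ih =>
    have hsub : ∀ i ∈ s, i ∈ insert a s := fun i hi => Finset.mem_insert_of_mem hi
    have ih' := ih fun i hi j hj => h i (hsub i hi) j (hsub j hj)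
    have hmem : f a ∈ s.image f ↔ g a ∈ s.image g := by
      simp only [Finset.mem_image]
      exact exists_congr fun i => and_congr_right fun hi =>
        h i (hsub i hi) a (Finset.mem_insert_self _ _)
    rw [Finset.image_insert, Finset.image_insert]
    by_cases hc : f a ∈ s.image f
    · rw [Finset.insert_eq_of_mem hc, Finset.insert_eq_of_mem (hmem.1 hc), ih']
    · rw [Finset.card_insert_of_notMem hc, Finset.card_insert_of_notMem (fun h => hc (hmem.2 h)),
        ih']

/-- The labeling `L` describes the packing `P`. -/
def Describes (I : BPPS d) (L : ℕ → ℕ) (P : I.Packing) : Prop :=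
  ∀ i j : Fin I.n, L i = L j ↔ P.part i = P.part j

theorem card_used_eq (I : BPPS d) {L : ℕ → ℕ} {P : I.Packing} (h : I.Describes L P) {N : ℕ}
    (hN : I.n ≤ N) (k : Fin d) :
    (used (Finset.range N) (scenOf d I.word) L k).card =
      (P.parts.filter fun B => (B ∩ I.items k).Nonempty).card := by
  have h1 : used (Finset.range N) (scenOf d I.word) L k =
      (I.items k).image fun i : Fin I.n => L i := by
    ext b
    simp only [used, items, Finset.mem_image, Finset.mem_filter, Finset.mem_range,
      Finset.mem_univ, true_and]
    constructor
    · rintro ⟨i, ⟨-, hk⟩, rfl⟩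
      have hi : i < I.n := by
        by_contra hc
        rw [I.scenOf_word_eq_empty (not_lt.1 hc)] at hk
        simp at hk
      exact ⟨⟨i, hi⟩, by rwa [← I.scenOf_word], rfl⟩
    · rintro ⟨i, hk, rfl⟩
      exact ⟨i, ⟨i.2.trans_le hN, by rwa [I.scenOf_word]⟩, rfl⟩
  have h2 : P.parts.filter (fun B => (B ∩ I.items k).Nonempty) = (I.items k).image P.part := by
    ext B
    simp only [Finset.mem_filter, Finset.mem_image]
    constructor
    · rintro ⟨hB, i, hi⟩
      rw [Finset.mem_inter] at hi
      exact ⟨i, hi.2, P.part_eq_of_mem hB hi.1⟩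
    · rintro ⟨i, hi, rfl⟩
      exact ⟨P.part_mem.2 (Finset.mem_univ i), i,
        Finset.mem_inter.2 ⟨P.mem_part (Finset.mem_univ i), hi⟩⟩
  rw [h1, h2]
  exact card_image_congr _ _ _ fun i _ j _ => h i j

theorem load_eq (I : BPPS d) {L : ℕ → ℕ} {P : I.Packing} (h : I.Describes L P) {N : ℕ}
    (hN : I.n ≤ N) {size : ℕ → ℚ} (hs : ∀ i : Fin I.n, size i = (I.size i : ℚ)) (i₀ : Fin I.n)
    (k : Fin d) : load (Finset.range N) size (scenOf d I.word) L (L i₀) k =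
      ((∑ i ∈ P.part i₀ ∩ I.items k, I.size i : ℚ≥0) : ℚ) := by
  have h1 : load (Finset.range N) size (scenOf d I.word) L (L i₀) k =
      ∑ i ∈ Finset.range I.n, if L i = L i₀ ∧ k ∈ scenOf d I.word i then size i else 0 := by
    rw [load, Finset.sum_filter]
    symm
    refine Finset.sum_subset (Finset.range_subset_range.2 hN) fun i _ hi => ?_
    rw [Finset.mem_range, not_lt] at hi
    rw [I.scenOf_word_eq_empty hi]
    simp
  rw [h1, Finset.sum_range, NNRat.cast_sum, ← Finset.sum_filter]
  refine Finset.sum_congr ?_ fun i _ => hs i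
  ext i
  simp only [Finset.mem_filter, Finset.mem_univ, true_and, Finset.mem_inter, items, I.scenOf_word]
  rw [h, P.mem_part_iff_part_eq_part (Finset.mem_univ i) (Finset.mem_univ i₀)]

/-- Used in both directions: to turn an optimal packing into a labeling, and to read off a packing
from the computed labels. Dummy items and labels of no item carry no load. -/
theorem isFeasible_iff (I : BPPS d) {L : ℕ → ℕ} {P : I.Packing} (h : I.Describes L P) {N : ℕ}
    (hN : I.n ≤ N) {size : ℕ → ℚ} (hs : ∀ i : Fin I.n, size i = (I.size i : ℚ)) :
    I.IsFeasible P ↔ ∀ b k, load (Finset.range N) size (scenOf d I.word) L b k ≤ 1 := by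
  constructor
  · intro hP b k
    by_cases hb : ∃ i₀ : Fin I.n, L i₀ = b
    · obtain ⟨i₀, rfl⟩ := hb
      rw [I.load_eq h hN hs]
      exact_mod_cast hP _ (P.part_mem.2 (Finset.mem_univ i₀)) k
    · refine le_trans (le_of_eq (Finset.sum_eq_zero fun i hi => ?_)) zero_le_one
      simp only [Finset.mem_filter] at hi
      exfalso
      by_cases hin : i < I.n
      · exact hb ⟨⟨i, hin⟩, hi.2.1⟩
      · have := hi.2.2
        rw [I.scenOf_word_eq_empty (not_lt.1 hin)] at this
        simp at this
  · intro hL B hB k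
    obtain ⟨i₀, hi₀⟩ := P.nonempty_of_mem_parts hB
    have h1 := hL (L i₀) k
    rw [I.load_eq h hN hs, P.part_eq_of_mem hB hi₀] at h1
    exact_mod_cast h1

/-- Every packing is described by some labeling. -/
theorem exists_describes (I : BPPS d) (P : I.Packing) : ∃ L, I.Describes L P := by
  refine ⟨fun i => if h : i < I.n then Encodable.encode (P.part ⟨i, h⟩) else 0, fun i j => ?_⟩
  simp [Encodable.encode_inj]

/-- Every labeling describes some packing. -/
theorem exists_packing (I : BPPS d) (L : ℕ → ℕ) : ∃ P, I.Describes L P := by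
  let r : Setoid (Fin I.n) := Setoid.ker fun i : Fin I.n => L i
  have : DecidableRel r := fun i j => decidable_of_iff (L i = L j) Iff.rfl
  refine ⟨Finpartition.ofSetoid r, fun i j => ?_⟩
  rw [← Finpartition.mem_part_iff_part_eq_part _ (Finset.mem_univ i) (Finset.mem_univ j),
    Finpartition.mem_part_ofSetoid_iff_rel]
  exact eq_comm

end BPPS

namespace BPPS

open RAM

/-! ### The classes of the algorithm -/

section Classes

variable {d h J D : ℕ} {A a τ : ℕ → ℕ}

theorem classOf_mod (i : ℕ) : classOf d J (4 * h ^ 2) D A a τ i % (J + 2) =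
    if 4 * h ^ 2 * a i ≤ D then J + 1
      else ((Finset.range J).filter fun m => a i ≤ a (τ m)).card := by
  have h3 : ((Finset.range J).filter fun m => a i ≤ a (τ m)).card ≤ J := by
    simpa using Finset.card_filter_le (Finset.range J) fun m => a i ≤ a (τ m)
  rw [classOf, Nat.add_mul_mod_self_left, Nat.mod_eq_of_lt]
  split_ifs <;> omega

theorem classOf_div (i : ℕ) : classOf d J (4 * h ^ 2) D A a τ i / (J + 2) =
    ∑ k ∈ scenOf d A i, 2 ^ (k : ℕ) := by
  have h3 : ((Finset.range J).filter fun m => a i ≤ a (τ m)).card ≤ J := by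
    simpa using Finset.card_filter_le (Finset.range J) fun m => a i ≤ a (τ m)
  rw [classOf, Nat.add_mul_div_left _ _ (by omega), Nat.div_eq_of_lt, zero_add]
  split_ifs <;> omega

theorem classOf_mod_eq_iff (i : ℕ) :
    classOf d J (4 * h ^ 2) D A a τ i % (J + 2) = J + 1 ↔ 4 * h ^ 2 * a i ≤ D := by
  have h3 : ((Finset.range J).filter fun m => a i ≤ a (τ m)).card ≤ J := by
    simpa using Finset.card_filter_le (Finset.range J) fun m => a i ≤ a (τ m)
  rw [classOf_mod]
  split_ifs with hc
  · simp [hc]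
  · simp only [hc, iff_false]
    omega

/-- The bound does not depend on the instance, so the configurations can be fixed in the program. -/
theorem classOf_lt (i : ℕ) : classOf d J (4 * h ^ 2) D A a τ i <
    (J + 2) * (∑ k : Fin d, 2 ^ (k : ℕ) + 1) := by
  rw [mul_comm (J + 2), ← Nat.div_lt_iff_lt_mul (by omega), classOf_div, Nat.lt_succ_iff]
  exact Finset.sum_le_sum_of_subset (Finset.subset_univ _)

/-- The code of a set of scenarios. -/
def scenCode (d : ℕ) (K : Finset (Fin d)) : ℕ := ∑ k ∈ K, 2 ^ (k : ℕ)

theorem scenCode_injective (d : ℕ) : Function.Injective (scenCode d) := by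
  intro K K' hK
  have h1 : ∀ K : Finset (Fin d), scenCode d K = ∑ i ∈ K.map Fin.valEmbedding, 2 ^ i := fun K => by
    rw [Finset.sum_map]; rfl
  rw [h1, h1] at hK
  exact Finset.map_injective _ (Finset.geomSum_injective le_rfl hK)

end Classes

/-- The scaled size of an item as a rational number. -/
def ratSize (D : ℕ) (a : ℕ → ℕ) (i : ℕ) : ℚ≥0 := (a i : ℚ≥0) / D

/-- The classes of the algorithm, for the thresholds `τ`. -/
noncomputable def classified (d h J N D : ℕ) (A a τ : ℕ → ℕ) (hh : 0 < h) (hD : 0 < D) :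
    Classified d where
  U := Finset.range N
  size i := ratSize D a i
  scen := scenOf d A
  cls := classOf d J (4 * h ^ 2) D A a τ
  weight i := ((if 4 * h ^ 2 * a i ≤ D then a i else D : ℕ) : ℚ) / D
  classScen κ := Function.invFun (scenCode d) (κ / (J + 2))
  small κ := κ % (J + 2) = J + 1
  -- For a large class this is the size of its largest item; in `ℚ≥0` the supremum over an empty
  -- class is `0`.
  cap κ := if κ % (J + 2) = J + 1 then 1 / (2 * h) + 1 / (4 * h ^ 2) else
    (({i ∈ Finset.range N | classOf d J (4 * h ^ 2) D A a τ i = κ}.sup (ratSize D a) : ℚ≥0) : ℚ)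
  η := 1 / (2 * h)
  δ := 1 / (4 * h ^ 2)
  size_nonneg i := NNRat.coe_nonneg _
  η_pos := by positivity
  δ_pos := by positivity
  η_lt_one := by
    have : (1 : ℚ) ≤ h := by exact_mod_cast hh
    rw [div_lt_one (by positivity)]
    linarith
  classScen_cls i _ := by
    rw [classOf_div]
    exact Function.leftInverse_invFun (scenCode_injective d) _
  weight_small i _ hs := by
    rw [classOf_mod_eq_iff] at hs
    simp [hs, ratSize]
  size_small i _ hs := by
    rw [classOf_mod_eq_iff] at hs
    have hD' : (0 : ℚ) < D := by exact_mod_cast hD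
    have hh' : (0 : ℚ) < h := by exact_mod_cast hh
    have hs' : (4 : ℚ) * h ^ 2 * a i ≤ D := by exact_mod_cast hs
    simp only [ratSize, NNRat.cast_div, NNRat.cast_natCast]
    rw [div_le_div_iff₀ hD' (by positivity)]
    linarith
  weight_large i _ hs := by
    rw [classOf_mod_eq_iff] at hs
    have hD' : (D : ℚ) ≠ 0 := by exact_mod_cast hD.ne'
    rw [if_neg hs, div_self hD']
  cap_small κ hκ := if_pos hκ
  cap_nonneg κ := by
    split_ifs
    · positivity
    · exact NNRat.coe_nonneg _
  size_le_cap i hi hs := by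
    rw [if_neg hs]
    have hmem : i ∈ {j ∈ Finset.range N | classOf d J (4 * h ^ 2) D A a τ j =
        classOf d J (4 * h ^ 2) D A a τ i} := Finset.mem_filter.2 ⟨hi, rfl⟩
    exact_mod_cast Finset.le_sup (f := ratSize D a) hmem

/-- For suitable thresholds there is a blueprint. -/
theorem exists_blueprint {d h M N D : ℕ} (A a : ℕ → ℕ) (hh : 0 < h) (hM : 0 < M) (hD : 0 < D)
    (hN : 0 < N) (Q : ℕ → ℕ) (v : ℕ)
    (hQ : ∀ b k, load (Finset.range N) (fun i => (ratSize D a i : ℚ)) (scenOf d A) Q b k ≤ 1)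
    (hv : ∀ k, (used (Finset.range N) (scenOf d A) Q k).card ≤ v) :
    ∃ τ : ℕ → ℕ, (∀ m, τ m < N) ∧
      ∃ B : (classified d h (2 ^ d * (2 * M)) N D A a τ hh hD).Blueprint,
        B.h = h ∧ B.M = M ∧ B.v = v := by
  have hD' : (0 : ℚ) < D := by exact_mod_cast hD
  have hh' : (0 : ℚ) < h := by exact_mod_cast hh
  let size : ℕ → ℚ := fun i => ratSize D a i
  have hsize : ∀ i j, size i ≤ size j ↔ a i ≤ a j := fun i j => by
    simp only [size, ratSize, NNRat.cast_div, NNRat.cast_natCast]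
    rw [div_le_div_iff_of_pos_right hD', Nat.cast_le]
  have hsmall : ∀ i, size i ≤ 1 / (4 * h ^ 2) ↔ 4 * h ^ 2 * a i ≤ D := fun i => by
    simp only [size, ratSize, NNRat.cast_div, NNRat.cast_natCast]
    rw [div_le_div_iff₀ hD' (by positivity), one_mul, mul_comm]
    exact_mod_cast Iff.rfl
  let Λ : Finset ℕ := {i ∈ Finset.range N | (scenOf d A i).Nonempty ∧ 1 / (4 * (h : ℚ) ^ 2) < size i}
  obtain ⟨T, G, σ, hT, hG, hTc, hGc, hσ, hinj, hTσ⟩ := exists_shift_scen Λ size (scenOf d A) hM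
  set J := 2 ^ d * (2 * M) with hJ
  -- Surplus thresholds are set to item `0`, which exists as `N` is positive; they can only refine
  -- the classes.
  let τ : ℕ → ℕ := fun m => T.toList.getD m 0
  have hτT : ∀ t ∈ T, ∃ m < J, τ m = t := fun t ht => by
    obtain ⟨m, hm, hmt⟩ := List.getElem_of_mem (Finset.mem_toList.2 ht)
    refine ⟨m, ?_, by simp only [τ]; rw [List.getD_eq_getElem _ _ hm, hmt]⟩
    rw [Finset.length_toList] at hm
    omega
  have hτN : ∀ m, τ m < N := fun m => by
    by_cases hm : m < T.toList.length
    · have : τ m ∈ T := by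
        simp only [τ]
        rw [List.getD_eq_getElem _ _ hm]
        exact Finset.mem_toList.1 (List.getElem_mem hm)
      exact Finset.mem_range.1 (Finset.mem_filter.1 (hT this)).1
    · simp only [τ]
      rw [List.getD_eq_default _ _ (not_lt.1 hm)]
      exact hN
  refine ⟨τ, hτN, ?_⟩
  set S := classified d h J N D A a τ hh hD with hS
  have hlarge : S.large = Λ := rfl
  have hload : ∀ i ∈ Λ, size i ≤ 1 := fun i hi => by
    obtain ⟨h1, ⟨k, hk⟩, -⟩ := Finset.mem_filter.1 hi
    refine le_trans ?_ (hQ (Q i) k)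
    exact Finset.single_le_sum (f := size) (fun j _ => NNRat.coe_nonneg _)
      (Finset.mem_filter.2 ⟨h1, rfl, hk⟩)
  have hcap : ∀ i ∈ Λ, ∀ B : ℚ, 0 ≤ B → (∀ j < N, S.cls j = S.cls i → size j ≤ B) →
      S.cap (S.cls i) ≤ B := fun i hi B hB hj => by
    obtain ⟨h1, -, h2⟩ := Finset.mem_filter.1 hi
    have hns : ¬ S.cls i % (J + 2) = J + 1 := by
      rw [← not_le, hsmall] at h2
      exact fun h => h2 (classOf_mod_eq_iff i |>.1 h)
    have h3 : S.cap (S.cls i) =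
        (({j ∈ Finset.range N | S.cls j = S.cls i}.sup (ratSize D a) : ℚ≥0) : ℚ) := if_neg hns
    rw [h3]
    lift B to ℚ≥0 using hB
    rw [NNRat.cast_le]
    refine Finset.sup_le fun j hj' => ?_
    obtain ⟨h4, h5⟩ := Finset.mem_filter.1 hj'
    exact_mod_cast hj j (Finset.mem_range.1 h4) h5
  -- A class number determines the scenarios and whether its items are small.
  have hmemΛ : ∀ i ∈ Λ, ∀ j < N, S.cls j = S.cls i → j ∈ Λ := fun i hi j hj hij => by
    obtain ⟨h1, h2, h3⟩ := Finset.mem_filter.1 hi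
    have hjN := Finset.mem_range.2 hj
    refine Finset.mem_filter.2 ⟨hjN, ?_, ?_⟩
    · have e1 := S.classScen_cls j hjN
      have e2 := S.classScen_cls i h1
      rw [hij, e2] at e1
      have e3 : scenOf d A i = scenOf d A j := e1
      rwa [← e3]
    · rw [← not_le, hsmall] at h3 ⊢
      rw [← classOf_mod_eq_iff (d := d) (J := J) (A := A) (τ := τ)] at h3 ⊢
      have hij' : classOf d J (4 * h ^ 2) D A a τ j = classOf d J (4 * h ^ 2) D A a τ i := hij
      rwa [hij']
  refine ⟨{
    h := h
    M := M
    v := v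
    Q := Q
    sc := fun K => J + 1 + (J + 2) * scenCode d K
    G := G
    σ := σ
    h_pos := hh
    M_pos := hM
    η_eq := rfl
    δ_eq := rfl
    small_iff := fun i _ => (classOf_mod_eq_iff i).trans (hsmall i).symm
    cls_small := fun i _ hi => ?_
    load_le := hQ
    used_le := hv
    σ_mem := hσ
    σ_inj := hinj
    cap_le_σ := fun i hi => ?_
    cap_le_one := fun i hi => ?_
    G_sub := hG
    card_G := hGc }, rfl, rfl, rfl⟩
  · have : 4 * h ^ 2 * a i ≤ D := (hsmall i).1 hi
    change classOf d J (4 * h ^ 2) D A a τ i = _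
    rw [classOf, if_pos this]
    rfl
  · have hiΛ : i ∈ Λ := (Finset.mem_sdiff.1 hi).1
    refine hcap i hiΛ _ (NNRat.coe_nonneg _) fun j hj hij => ?_
    obtain ⟨t, ht, h1, h2⟩ := hTσ i hi
    refine le_trans ?_ h2
    rcases le_total (a j) (a i) with hji | hji
    · exact ((hsize j i).2 hji).trans h1
    · obtain ⟨m, hm, rfl⟩ := hτT t ht
      have hjΛ := hmemΛ i hiΛ j hj hij
      have hlg : ∀ j ∈ Λ, ¬ 4 * h ^ 2 * a j ≤ D := fun j hj => by
        rw [← hsmall, not_le]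
        exact (Finset.mem_filter.1 hj).2.2
      have e1 := classOf_mod (d := d) (J := J) (h := h) (D := D) (A := A) (a := a) (τ := τ) j
      have e2 := classOf_mod (d := d) (J := J) (h := h) (D := D) (A := A) (a := a) (τ := τ) i
      rw [if_neg (hlg j hjΛ)] at e1
      rw [if_neg (hlg i hiΛ)] at e2
      have hij' : classOf d J (4 * h ^ 2) D A a τ j = classOf d J (4 * h ^ 2) D A a τ i := hij
      rw [hij', e2] at e1
      have hsub : ((Finset.range J).filter fun m => a j ≤ a (τ m)) ⊆
          (Finset.range J).filter fun m => a i ≤ a (τ m) := fun m hm => by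
        obtain ⟨h3, h4⟩ := Finset.mem_filter.1 hm
        exact Finset.mem_filter.2 ⟨h3, hji.trans h4⟩
      -- The sets of thresholds that bound two items are nested. Members of one class have equally
      -- many, hence the same ones, and so `j` is also at most the threshold between `i` and its
      -- image.
      have heq := Finset.eq_of_subset_of_card_le hsub e1.le
      have hmi : m ∈ (Finset.range J).filter fun m => a i ≤ a (τ m) :=
        Finset.mem_filter.2 ⟨Finset.mem_range.2 hm, (hsize _ _).1 h1⟩
      rw [← heq] at hmi
      exact (hsize _ _).2 (Finset.mem_filter.1 hmi).2
  · exact hcap i hi _ zero_le_one fun j hj hij => hload j (hmemΛ i hi j hj hij)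

end BPPS

namespace BPPS

open RAM

variable {d : ℕ}

/-! ### The final algorithm -/

/-- The lists of at most `m` numbers below `C`. -/
noncomputable def configs (C m : ℕ) : List (List ℕ) :=
  ((List.finite_length_le (Fin C) m).toFinset.image (List.map Fin.val)).toList

theorem nodup_configs (C m : ℕ) : (configs C m).Nodup := Finset.nodup_toList _

theorem mem_configs {C m : ℕ} {c : List ℕ} (hl : c.length ≤ m) (hc : ∀ κ ∈ c, κ < C) :
    c ∈ configs C m := by
  simp only [configs, Finset.mem_toList, Finset.mem_image, Set.Finite.mem_toFinset,
    Set.mem_ofPred_eq]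
  exact ⟨c.pmap Fin.mk hc, by simpa using hl, by simp [List.map_pmap]⟩

/-- Allows the search to guess multiplicities instead of an ordered list of bins. -/
theorem flatMap_replicate_count_perm {α : Type*} [BEq α] [LawfulBEq α] {cs l : List α}
    (hcs : cs.Nodup) (h : ∀ c ∈ l, c ∈ cs) : (cs.flatMap fun c => List.replicate (l.count c) c).Perm l := by
  rw [List.perm_iff_count]
  intro c
  rw [List.count_flatMap]
  by_cases hc : c ∈ cs
  · let _ : DecidableEq α := instDecidableEqOfLawfulBEq
    have h1 : @List.count α instBEqOfDecidableEq c cs = 1 :=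
      @List.count_eq_one_of_mem α instBEqOfDecidableEq inferInstance c cs hcs hc
    rw [List.sum_map_eq_nsmul_single c]
    · rw [Function.comp_apply, List.count_replicate_self, h1, one_smul]
    · intro c' hc' _
      simp [List.count_replicate, hc']
  · rw [List.count_eq_zero_of_not_mem fun hl => hc (h c hl)]
    refine List.sum_eq_zero fun x hx => ?_
    obtain ⟨c', hc', rfl⟩ := List.mem_map.1 hx
    have : c' ≠ c := fun e => hc (e ▸ hc')
    simp [List.count_replicate, this]

theorem load_ratSize (N D : ℕ) (A a L : ℕ → ℕ) (b : ℕ) (k : Fin d) :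
    load (Finset.range N) (fun i => (ratSize D a i : ℚ)) (scenOf d A) L b k =
      (natLoad d N A a L b k : ℚ) / D := by
  rw [load, natLoad, Nat.cast_sum, Finset.sum_div]
  simp [ratSize]

theorem natLoad_le_iff {N D : ℕ} (hD : 0 < D) {A a L : ℕ → ℕ} {b : ℕ} {k : Fin d} :
    natLoad d N A a L b k ≤ D ↔
      load (Finset.range N) (fun i => (ratSize D a i : ℚ)) (scenOf d A) L b k ≤ 1 := by
  have hD' : (0 : ℚ) < D := by exact_mod_cast hD
  rw [load_ratSize, div_le_one hD', Nat.cast_le]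

/-- The registers in which the search enumerates numbers. -/
def searchRegs (m : ℕ) : List ℕ := (List.range m).map (20 + ·)

theorem nodup_searchRegs (m : ℕ) : (searchRegs m).Nodup :=
  List.nodup_range.map (add_right_injective 20)

theorem mem_searchRegs {m x : ℕ} : x ∈ searchRegs m ↔ 20 ≤ x ∧ x < 20 + m := by
  simp only [searchRegs, List.mem_map, List.mem_range]
  exact ⟨by rintro ⟨j, hj, rfl⟩; omega, fun h => ⟨x - 20, by omega, by omega⟩⟩

/-- The configurations `cs`, with the registers that hold their multiplicities. -/
def counters (J : ℕ) (cs : List (List ℕ)) : List (ℕ × List ℕ) :=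
  cs.map fun c => (20 + J + cs.idxOf c, c)

/-- The number of thresholds. -/
def numThresholds (d M : ℕ) : ℕ := 2 ^ d * (2 * M)

/-- The configurations that the search enumerates. -/
noncomputable def searchConfigs (d h M : ℕ) : List (List ℕ) :=
  configs ((numThresholds d M + 2) * (∑ k : Fin d, 2 ^ (k : ℕ) + 1)) (4 * h ^ 2 * d + h + 1)

/-- The search with all constants. -/
noncomputable def mainSearch (d h M : ℕ) : LoopProg :=
  search d h (numThresholds d M) (counters (numThresholds d M) (searchConfigs d h M))
    (searchRegs (numThresholds d M + (searchConfigs d h M).length))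

theorem wF_mainSearch (d h M : ℕ) : (mainSearch d h M).WF :=
  wF_search _ _ _ _ (nodup_searchRegs _) fun _ hx => (mem_searchRegs.1 hx).1

theorem keeps_mainSearch (d h M : ℕ) : (mainSearch d h M).Keeps 0 :=
  keeps_search _ _ _ _ fun _ hx => (mem_searchRegs.1 hx).1

/-- The product of the denominators. -/
def denProd (I : BPPS d) : ℕ := ∏ j ∈ Finset.range I.n, I.word (2 + (d + 2) * j)

/-- The sizes, multiplied by the product of the denominators. -/
def intSize (I : BPPS d) (i : ℕ) : ℕ :=
  I.word (1 + (d + 2) * i) * ∏ j ∈ Finset.range I.n with j ≠ i, I.word (2 + (d + 2) * j)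

theorem word_den_pos (I : BPPS d) {j : ℕ} (hj : j < I.n) : 0 < I.word (2 + (d + 2) * j) := by
  rw [word, I.encode_den ⟨j, hj⟩]
  exact NNRat.den_pos _

theorem denProd_pos (I : BPPS d) : 0 < I.denProd :=
  Finset.prod_pos fun _ hj => I.word_den_pos (Finset.mem_range.1 hj)

theorem ratSize_intSize (I : BPPS d) (i : Fin I.n) : ratSize I.denProd I.intSize i = I.size i := by
  have h1 : I.denProd = I.word (2 + (d + 2) * i) *
      ∏ j ∈ Finset.range I.n with j ≠ (i : ℕ), I.word (2 + (d + 2) * j) := by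
    rw [denProd, Finset.filter_ne',
      Finset.mul_prod_erase _ (fun j => I.word (2 + (d + 2) * j)) (Finset.mem_range.2 i.2)]
  have h2 : ∏ j ∈ Finset.range I.n with j ≠ (i : ℕ), I.word (2 + (d + 2) * j) ≠ 0 :=
    right_ne_zero_of_mul (h1 ▸ I.denProd_pos.ne')
  rw [ratSize, h1, intSize, Nat.cast_mul, Nat.cast_mul,
    mul_div_mul_right _ _ (by exact_mod_cast h2), word, word, I.encode_num, I.encode_den, NNRat.num_div_den]

theorem card_active_le (I : BPPS d) {S : Classified d} (hS : S.scen = scenOf d I.word) :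
    (Classified.Blueprint.active S).card ≤ I.n := by
  rw [← Finset.card_range I.n]
  refine Finset.card_le_card fun i hi => ?_
  rw [Finset.mem_range]
  by_contra hc
  have := (Finset.mem_filter.1 hi).2
  rw [hS, I.scenOf_word_eq_empty (not_lt.1 hc)] at this
  simp at this

theorem classOf_congr {J q D : ℕ} {A a τ τ' : ℕ → ℕ} (h : ∀ m < J, τ m = τ' m) (i : ℕ) :
    classOf d J q D A a τ i = classOf d J q D A a τ' i := by
  have : ((Finset.range J).filter fun m => a i ≤ a (τ m)) =
      (Finset.range J).filter fun m => a i ≤ a (τ' m) :=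
    Finset.filter_congr fun m hm => by rw [h m (Finset.mem_range.1 hm)]
  rw [classOf, classOf, this]

/-- The value guaranteed by the search. -/
def valueBound (d h M v : ℕ) : ℚ := v + 2 ^ d * (2 * v / h + 1) + 4 * h ^ 2 * v / M

/-- The packing serves only to show that a good guess exists: its blueprint yields thresholds and
multiplicities within the range of the enumeration. -/
theorem isSolution_mainSearch (I : BPPS d) {P : I.Packing} (hP : I.IsFeasible P) {h M : ℕ}
    (hh : 0 < h) (hM : 0 < M) (s : State) (hA : s.arr 0 = I.word)
    (hN : (3 + 3 * 2 ^ d) * bitLength I.encode = s.reg 0) :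
    ∃ W : ℕ, (W : ℚ) ≤ valueBound d h M (I.val P) ∧
      IsSolution d (s.reg 0) I.denProd I.word I.intSize (((mainSearch d h M).run s).arr 1) W := by
  set N := s.reg 0 with hNdef
  set J := numThresholds d M with hJ
  set cs := searchConfigs d h M with hcs
  have hlen := I.n_lt_bitLength
  have hnN : (3 + 3 * 2 ^ d) * (I.n + 1) ≤ N := hN ▸ Nat.mul_le_mul_left _ hlen
  have hbN : bitLength I.encode ≤ N := hN ▸ Nat.le_mul_of_pos_left _ (by positivity)
  have hn : I.n ≤ N := hlen.le.trans hbN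
  have hD := I.denProd_pos
  have hs : ∀ i : Fin I.n, (ratSize I.denProd I.intSize i : ℚ) = I.size i := fun i => by
    rw [I.ratSize_intSize]
  obtain ⟨Q, hQ⟩ := I.exists_describes P
  obtain ⟨τ, hτ, hB⟩ := exists_blueprint I.word I.intSize hh hM hD
    ((Nat.zero_le _).trans_lt (hlen.trans_le hbN)) Q (I.val P)
    ((I.isFeasible_iff hQ hn hs).1 hP) fun k => by
      rw [I.card_used_eq hQ hn]
      exact Finset.le_sup (f := fun k => (P.parts.filter fun B => (B ∩ I.items k).Nonempty).card)
        (Finset.mem_univ k)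
  set S := classified d h (2 ^ d * (2 * M)) N I.denProd I.word I.intSize τ hh hD with hS
  obtain ⟨B, hBh, hBM, hBv⟩ := hB
  -- The factor `3 + 3 * 2^d` is large enough because `2n + 2^d(2n + 1) < (3 + 3 * 2^d)(n + 1)`.
  have hplan : B.plan.length < N := by
    refine (B.length_plan_le).trans_lt (lt_of_lt_of_le ?_ hnN)
    have h1 := I.card_active_le (S := S) rfl
    have h2 := Nat.mul_le_mul_left (2 ^ d) h1
    have h3 : 0 < 2 ^ d := by positivity
    nlinarith
  have hmem : ∀ c ∈ B.plan, c ∈ cs := fun c hc => by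
    obtain ⟨h1, h2⟩ := B.mem_plan hc
    rw [hBh] at h1
    refine mem_configs h1 fun κ hκ => ?_
    obtain ⟨i, -, rfl⟩ := Finset.mem_image.1 (h2 κ hκ)
    exact classOf_lt i
  let v : ℕ → ℕ := fun y => if y < 20 + J then τ (y - 20) else
    B.plan.count (cs.getD (y - (20 + J)) [])
  have hfm : ((counters J cs).flatMap fun o => List.replicate (v o.1) o.2) =
      cs.flatMap fun c => List.replicate (B.plan.count c) c := by
    rw [counters, List.flatMap_map]
    refine List.flatMap_congr fun c hc => ?_
    simp only [v]
    rw [if_neg (by omega), Nat.add_sub_cancel_left,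
      List.getD_eq_getElem _ _ (List.idxOf_lt_length_iff.2 hc), List.getElem_idxOf]
  have hperm : ((counters J cs).flatMap fun o => List.replicate (v o.1) o.2).Perm B.plan := by
    rw [hfm]
    exact flatMap_replicate_count_perm (nodup_configs _ _) hmem
  have hbound : (0 : ℚ) ≤ valueBound d h M (I.val P) := by
    rw [valueBound]
    positivity
  -- The search needs a value of at most `N`; the minimum costs nothing, as no labeling of `N` items
  -- uses more than `N` labels.
  refine ⟨min N ⌊valueBound d h M (I.val P)⌋₊, ?_, ?_⟩
  · exact (Nat.cast_le.2 (min_le_right _ _)).trans (Nat.floor_le hbound)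
  rw [← hA]
  have hA0 : s.arr 0 0 = I.n := by rw [hA]; exact I.encode_zero
  refine search_spec d h J (counters J cs) _ (nodup_searchRegs _)
    (fun x hx => (mem_searchRegs.1 hx).1) ?_ ?_ hh s (hA0 ▸ hn) ?_ I.denProd ?_ hD I.intSize ?_ v
    ?_ S rfl ?_ ?_ rfl _ (min_le_left _ _) ?_
  · intro o ho
    obtain ⟨c, hc, rfl⟩ := List.mem_map.1 ho
    have : cs.idxOf c < cs.length := List.idxOf_lt_length_iff.2 hc
    rw [← hcs]
    exact mem_searchRegs.2 ⟨by omega, by omega⟩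
  · exact fun m hm => mem_searchRegs.2 ⟨by omega, by omega⟩
  · intro j _
    rw [hA]
    exact (I.word_lt _).trans_le (Nat.pow_le_pow_right (by norm_num) hbN)
  · rw [hA0, hA, denProd]
  · intro i _
    rw [hA0, hA, intSize]
  · intro x hx
    simp only [v]
    split_ifs
    · exact hτ _
    · exact List.count_le_length.trans_lt hplan
  · intro i _
    rw [hA]
    refine classOf_congr (J := J) (fun m hm => ?_) i
    simp only [v]
    rw [if_pos (Nat.add_lt_add_left hm 20), Nat.add_sub_cancel_left]
  · exact fun i _ => rfl
  · intro L hL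
    refine ⟨fun i _ => ?_, fun k => ?_⟩
    · by_cases hi : L i = 0
      · omega
      · have h1 := Classified.lt_of_mem_numbered (hL.mem_ops hi)
        rw [hperm.length_eq] at h1
        simp only at h1
        omega
    · obtain ⟨h1, h2⟩ := B.sound hperm hL k
      rw [hA]
      refine ⟨fun b => (natLoad_le_iff hD).2 (h1 b), le_min ?_ (Nat.le_floor ?_)⟩
      · refine Finset.card_image_le.trans ((Finset.card_filter_le _ _).trans ?_)
        rw [Finset.card_range]
      · rw [hBv, hBh, hBM] at h2
        exact h2

/-- The choices of `h` and `M` make the surplus of additional bins and the bins for `G` cost at most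
`εv/2` each. -/
theorem valueBound_le {d h M v : ℕ} {ε : ℝ} (hε : 0 < ε) (hh : 2 ^ (d + 2) / ε ≤ h)
    (hM : 8 * h ^ 2 / ε ≤ M) :
    (valueBound d h M v : ℝ) ≤ (1 + ε) * v + 2 ^ d := by
  have hh0 : (0 : ℝ) < h := lt_of_lt_of_le (by positivity) hh
  have hM0 : (0 : ℝ) < M := lt_of_lt_of_le (by positivity) hM
  have h1 : 2 ^ d * (2 * (v : ℝ) / h) ≤ ε / 2 * v := by
    rw [div_le_iff₀ hε] at hh
    rw [← mul_div_assoc, div_le_iff₀ hh0]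
    have := mul_le_mul_of_nonneg_right hh (Nat.cast_nonneg (α := ℝ) v)
    rw [pow_add] at this
    linarith
  have h2 : 4 * (h : ℝ) ^ 2 * v / M ≤ ε / 2 * v := by
    rw [div_le_iff₀ hε] at hM
    rw [div_le_iff₀ hM0]
    have := mul_le_mul_of_nonneg_right hM (Nat.cast_nonneg (α := ℝ) v)
    linarith
  rw [valueBound]
  push_cast
  linarith

end BPPS

/-! ### The theorem -/

theorem mainTheorem1 (d : ℕ) (ε' : ℝ) (hε' : 0 < ε') :
    ∃ (A : RAM.Prog) (p : Polynomial ℕ), ∀ I : BPPS d, (∃ Q : I.Packing, I.IsFeasible Q) →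
      ∃ (t : ℕ) (s : RAM.State) (P : I.Packing),
        RAM.Exec A (RAM.init I.encode) t s ∧
        t ≤ p.eval (RAM.bitLength I.encode) ∧
        I.Represents s P ∧
        I.IsFeasible P ∧
        (I.val P : ℝ) ≤ (1 + ε') * (I.opt : ℝ) + 2 + 2 ^ d := by
  obtain ⟨h, hh⟩ := exists_nat_ge (2 ^ (d + 2) / ε')
  obtain ⟨M, hM⟩ := exists_nat_ge (8 * h ^ 2 / ε')
  have hh0 : 0 < h := by
    have : (0 : ℝ) < h := lt_of_lt_of_le (by positivity) hh
    exact_mod_cast this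
  have hM0 : 0 < M := by
    have : (0 : ℝ) < M := lt_of_lt_of_le (by positivity) hM
    exact_mod_cast this
  obtain ⟨T, hT⟩ := RAM.exec_setRounds d (3 + 3 * 2 ^ d)
  obtain ⟨c, hc⟩ :=
    RAM.LoopProg.exists_exec (BPPS.wF_mainSearch d h M) (BPPS.keeps_mainSearch d h M)
  refine ⟨.seq (RAM.setRounds d (3 + 3 * 2 ^ d)) (BPPS.mainSearch d h M).prog,
    T + c.comp (Polynomial.C (3 + 3 * 2 ^ d) * Polynomial.X), fun I hI => ?_⟩
  obtain ⟨t₁, s₁, e₁, ht₁, hs₁, hr₁⟩ := hT I.encode (by rw [I.length_encode, I.encode_zero])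
  obtain ⟨t₂, e₂, ht₂⟩ := hc s₁
  have hopt : ∃ Q : I.Packing, I.IsFeasible Q ∧ I.val Q = I.opt :=
    Nat.sInf_mem (s := {v | ∃ P : I.Packing, I.IsFeasible P ∧ I.val P = v})
      ⟨_, hI.choose, hI.choose_spec, rfl⟩
  obtain ⟨Q, hQ, hQopt⟩ := hopt
  obtain ⟨W, hW, hsol⟩ := I.isSolution_mainSearch hQ hh0 hM0 s₁
    (by rw [hs₁]; funext j; simp [RAM.init, BPPS.word]) hr₁.symm
  obtain ⟨P, hP⟩ := I.exists_packing (((BPPS.mainSearch d h M).run s₁).arr 1)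
  have hn : I.n ≤ s₁.reg 0 :=
    I.n_lt_bitLength.le.trans (hr₁ ▸ Nat.le_mul_of_pos_left _ (by positivity))
  refine ⟨_, _, P, .seq e₁ e₂, ?_, hP, ?_, ?_⟩
  · simp only [Polynomial.eval_add, Polynomial.eval_comp, Polynomial.eval_mul, Polynomial.eval_C,
      Polynomial.eval_X]
    rw [hr₁] at ht₂
    exact add_le_add ht₁ ht₂
  · refine (I.isFeasible_iff hP hn (size := fun i => BPPS.ratSize I.denProd I.intSize i)
      fun i => by rw [I.ratSize_intSize]).2 fun b k => ?_
    exact (BPPS.natLoad_le_iff I.denProd_pos).1 ((hsol k).1 b)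
  · have h1 : I.val P ≤ W := Finset.sup_le fun k _ => by
      rw [← I.card_used_eq hP hn]
      exact (hsol k).2
    -- The search is compared with an optimal packing; the summand `2` of the claim is not even
    -- needed.
    have h2 : (W : ℝ) ≤ (1 + ε') * I.opt + 2 ^ d := by
      rw [← hQopt]
      refine le_trans ?_ (BPPS.valueBound_le hε' hh hM)
      exact_mod_cast hW
    have h3 : (I.val P : ℝ) ≤ W := by exact_mod_cast h1
    linarith
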